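/- **Theorem A.** Let $M$ be a connected finite-dimensional $C^\infty$ Riemannian manifold without boundary, with Riemannian distance $d$ and balls $B_r(p)$. Let $\mathscr X^1(M)$ be the space of $C^1$ vector fields on $M$ with the $C^1$ topology (uniform convergence of the field and its first derivatives on compact sets), and let $\sigma$ be a hyperbolic singularity of saddle type of $X\in\mathscr X^1(M)$: $X(\sigma)=0$ and $T_\sigma M=E^s\oplus E^u$ with $E^s=\{v: e^{tDX(\sigma)}v\to0,\ t\to+\infty\}\neq0$ and $E^u=\{v: e^{tDX(\sigma)}v\to0,\ t\to-\infty\}\ne0$. Then there are constants $r_0,\kappa,H_1>0$, $0<L_0<L_1$, $0<K_0<K_1$, integers $n_0(r)\ge 0$ $(r>0)$, a neighbourhood $\mathcal U$ of $X$ in $\mathscr X^1(M)$, a neighbourhood $V$ of $\sigma$, and a map $Y\mapsto\sigma_Y$, continuous on $\mathcal U$, with $\sigma_X=\sigma$, such that for every $Y\in\mathcal U$ (in particular for $Y=X$) the following holds. The point $\sigma_Y$ is the only singularity of $Y$ in $V$, it is hyperbolic of saddle type, and $\overline{B}_{r_0}(\sigma_Y):=\{x:d(x,\sigma_Y)\le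 r_0\}\subset V$. There is an inner product on $T_{\sigma_Y}M$ making the splitting $E^s\oplus E^u$ of $DY(\sigma_Y)$ orthogonal such that, writing $v=v^s+v^u$, measuring $|v^s|,|v^u|$ by this inner product and putting $|v|=\max(|v^s|,|v^u|)$ (box norm), for every $0<r\le r_0$, with $n_0=n_0(r)$ and $$D_\sigma=\exp_{\sigma_Y}\{|v^s|=|v^u|,\ |v|<e^{-(n_0+1)}\},\qquad D_n=\exp_{\sigma_Y}\{|v^s|=|v^u|,\ e^{-(n+1)}\le|v|<e^{-n}\}\quad(n>n_0):$$ * $\exp_{\sigma_Y}$ is defined on these sets, $\sigma_Y\in D_\sigma\subset B_r(\sigma_Y)$, the field $Y$ is transverse to $D_\sigma$ at every point of $D_\sigma\setminus\{\sigma_Y\}$, and $\{D_n\}_{n>n_0}$ is a partition of $D_\sigma\setminus\{\sigma_Y\}$ into nonempty Borel sets; * (II) $|Y(x)|\in[L_0e^{-n-1},L_1e^{-n}]$ for all $n>n_0$, $x\in D_n$. If moreover $Y$ generates a (complete) flow $\phi_t$, put $t^{\pm}_x=\inf\{\tau>0:\phi_{\pm\tau}(x)\in\partial B_r(\sigma_Y)\}$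 and $C_n=\phi_{[0,1)}(D_n)$. Then: * (I) for every $x\neq\sigma_Y$ and every interval $[a,b]$ with $\phi_{[a,b]}(x)\subset \overline{B}_r(\sigma_Y)$ there is at most one $t\in[a,b]$ with $\phi_t(x)\in D_\sigma$; * (III) $t^{\pm}_x/n\in[K_0,K_1]$ for all $n>n_0$, $x\in D_n$; * (IV) the set $O(\sigma)=\bigcup_{n>n_0}\bigcup_{x\in D_n}\phi_{[-t^-_x,t^+_x]}(x)$ is contained in the closure of $B_r(\sigma_Y)$, and its closure contains the open ball with centre $\sigma_Y$ and diameter $e^{-n_0}$; * (V) $\mathscr C_\sigma=\{C_n:n>n_0\}\cup\{M\setminus\bigcup_{n>n_0}C_n\}$ is a countable Borel partition of $M$, and the $C_n$ form a cone with vertex $\sigma_Y$: $\kappa^{-1}e^{-n}\le d(y,\sigma_Y)\le\kappa e^{-n}$ for all $n>n_0$, $y\in C_n$ (in particular for $y\in D_n$); * (VI) $H_\mu(\mathscr C_\sigma)=-\sum_{C\in\mathscr C_\sigma}\mu(C)\log\mu(C)<H_1$ for every $\phi_t$-invariant Borel probability measure $\mu$. The constants do not depend on $Y\in\mathcal U$,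 and only $n_0$ depends on $r$. -/

import Mathlib

open Set Filter Topology MeasureTheory Manifold Bundle
open scoped ContDiff ENNReal

noncomputable section

namespace SingularFlow

/-! ### Linear algebra of a hyperbolic linear field -/

section Linear

variable {E : Type*} [NormedAddCommGroup E] [NormedSpace ℝ E]

/-- The stable subspace `E^s = {v | e^{tA} v → 0 as t → +∞}` of a linear field `A`. -/
def stableSpace (A : E →L[ℝ] E) : Submodule ℝ E where
  carrier := {v | Tendsto (fun t : ℝ => (NormedSpace.exp (t • A)) v) atTop (𝓝 0)}
  add_mem' := by
    intro a b ha hb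
    have h := Tendsto.add ha hb
    simpa using h
  zero_mem' := by simp
  smul_mem' := by
    intro c v hv
    have h := Tendsto.const_smul hv c
    simpa using h

/-- The unstable subspace `E^u = {v | e^{-tA} v → 0 as t → +∞}`. -/
def unstableSpace (A : E →L[ℝ] E) : Submodule ℝ E := stableSpace (-A)

/-- `A` is hyperbolic of saddle type: `E = E^s ⊕ E^u` (in finite dimension: no eigenvalue of `A` has
zero real part) and neither summand is trivial. -/
structure IsHyperbolicSaddle (A : E →L[ℝ] E) : Prop where
  isCompl : IsCompl (stableSpace A) (unstableSpace A)
  stable_ne_bot : stableSpace A ≠ ⊥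
  unstable_ne_bot : unstableSpace A ≠ ⊥

/-- `Q` is an inner product for which the splitting `E^s ⊕ E^u` is orthogonal. -/
structure IsSplittingInner (A : E →L[ℝ] E) (Q : LinearMap.BilinForm ℝ E) : Prop where
  symm : ∀ v w, Q v w = Q w v
  pos : ∀ v, v ≠ 0 → 0 < Q v v
  ortho : ∀ a ∈ stableSpace A, ∀ b ∈ unstableSpace A, Q a b = 0

/-- The piece `{v = v^s + v^u : |v^s| = |v^u|, s ≤ |v| < t}` of the cone `|v^s| = |v^u|`. Here
`|v^s|`, `|v^u|` are measured by `Q` and `|v| = max |v^s| |v^u|` is the box norm, which equals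
`|v^s|` on the cone. -/
def coneShell (A : E →L[ℝ] E) (Q : LinearMap.BilinForm ℝ E) (s t : ℝ) : Set E :=
  {v | ∃ a ∈ stableSpace A, ∃ b ∈ unstableSpace A, v = a + b ∧
    √(Q a a) = √(Q b b) ∧ s ≤ √(Q a a) ∧ √(Q a a) < t}

end Linear

section Entropy

/-- The entropy `H_μ(P) = - ∑_{A ∈ P} μ(A) log μ(A)` of a family of sets. -/
def partitionEntropy {Ω : Type*} [MeasurableSpace Ω] (μ : Measure Ω) (P : Set (Set Ω)) : ℝ≥0∞ :=
  ∑' A : P, ENNReal.ofReal (Real.negMulLog (μ.real (A : Set Ω)))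

end Entropy

section Manifold

variable {E : Type*} [NormedAddCommGroup E] [NormedSpace ℝ E]
  {M : Type*} [MetricSpace M] [ChartedSpace E M] [IsManifold 𝓘(ℝ, E) ∞ M]

variable (E M) in
/-- `C^1` vector fields on `M`. -/
abbrev C1VectorField : Type _ :=
  ContMDiffSection 𝓘(ℝ, E) E 1 (TangentSpace 𝓘(ℝ, E) : M → Type _)

/-- The coordinate expression `E → E` of a vector field in the chart at `p`
(relevant on the target of the chart). -/
def localRep (Y : C1VectorField E M) (p : M) (z : E) : E :=
  (trivializationAt E (TangentSpace 𝓘(ℝ, E) : M → Type _) p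
    ⟨(extChartAt 𝓘(ℝ, E) p).symm z, Y ((extChartAt 𝓘(ℝ, E) p).symm z)⟩).2

/-- The `C^1` topology: uniform convergence on compact sets, in the charts, of the coordinate
expressions and of their first derivatives. -/
instance c1Topology : TopologicalSpace (C1VectorField E M) :=
  ⨅ p : M, TopologicalSpace.induced
    (fun Y => UniformOnFun.ofFun {K : Set E | IsCompact K ∧ K ⊆ (extChartAt 𝓘(ℝ, E) p).target}
      (fun z => (localRep Y p z, fderiv ℝ (localRep Y p) z)))
    inferInstance

/-- The linearization `DY(p) : T_p M → T_p M` at a singularity `p` of `Y`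
(`T_p M` is `E`, through the chart at `p`). -/
def linearization (Y : C1VectorField E M) (p : M) : E →L[ℝ] E :=
  fderiv ℝ (localRep Y p) (extChartAt 𝓘(ℝ, E) p p)

/-- `p` is a hyperbolic singularity of `Y` of saddle type. -/
def IsSaddleSingularity (Y : C1VectorField E M) (p : M) : Prop :=
  Y p = 0 ∧ IsHyperbolicSaddle (linearization Y p)

/-- `φ` is the flow generated by `Y`. -/
def IsFlowOf (φ : Flow ℝ M) (Y : C1VectorField E M) : Prop :=
  ∀ x, IsMIntegralCurve (I := 𝓘(ℝ, E)) (fun t => φ t x) (fun y => Y y)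

/-! ### The exponential map -/

variable [RiemannianBundle (fun x : M => TangentSpace 𝓘(ℝ, E) x)]

/-- The coefficients `g_z(v, w)` of the Riemannian metric in the chart at `p`. -/
def metricRep (p : M) (z v w : E) : ℝ :=
  let e := trivializationAt E (TangentSpace 𝓘(ℝ, E) : M → Type _) p
  inner ℝ (e.symmL ℝ ((extChartAt 𝓘(ℝ, E) p).symm z) v)
    (e.symmL ℝ ((extChartAt 𝓘(ℝ, E) p).symm z) w)

/-- `γ` is a geodesic on `J`: it is `C^2` and, in the chart at `γ t`, its coordinate expression `u`
satisfies at `t` the Euler-Lagrange equations of the energy, which are the geodesic equation: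
`d/ds g_u(u', w) = (1/2) ∂_w g_u(u', u')` for every constant vector `w`. -/
def IsGeodesicOn (γ : ℝ → M) (J : Set ℝ) : Prop :=
  ContMDiffOn 𝓘(ℝ, ℝ) 𝓘(ℝ, E) 2 γ J ∧
  ∀ t ∈ J, ∀ w : E,
    let u : ℝ → E := fun s => extChartAt 𝓘(ℝ, E) (γ t) (γ s)
    HasDerivAt (fun s => metricRep (γ t) (u s) (deriv u s) w)
      ((1 / 2) * fderiv ℝ (fun z => metricRep (γ t) z (deriv u t) (deriv u t)) (u t) w) t

/-- `exp_p v = q`: a geodesic defined on an open set containing `[0, 1]` starts at `p` with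
velocity `v ∈ T_p M` and is at `q` at time `1`. -/
def IsExp (p : M) (v : E) (q : M) : Prop :=
  ∃ (γ : ℝ → M) (J : Set ℝ), IsOpen J ∧ Icc 0 1 ⊆ J ∧ IsGeodesicOn (E := E) γ J ∧
    γ 0 = p ∧ HasDerivAt (fun t => extChartAt 𝓘(ℝ, E) p (γ t)) v 0 ∧ γ 1 = q

/-- The image `exp_p(S)` of a set of tangent vectors. -/
def expImage (p : M) (S : Set E) : Set M :=
  {q | ∃ v ∈ S, IsExp p v q}

/-! ### The cross section, its layers, and the coarse partition -/

/-- The cross section `D_σ = exp_p {|v^s| = |v^u|, |v| < e^{-(n₀+1)}}`. -/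
def crossSection (Y : C1VectorField E M) (p : M) (Q : LinearMap.BilinForm ℝ E) (n₀ : ℕ) : Set M :=
  expImage p (coneShell (linearization Y p) Q 0 (Real.exp (-((n₀ : ℝ) + 1))))

/-- The layer `D_n = exp_p {|v^s| = |v^u|, e^{-(n+1)} ≤ |v| < e^{-n}}`. -/
def layer (Y : C1VectorField E M) (p : M) (Q : LinearMap.BilinForm ℝ E) (n : ℕ) : Set M :=
  expImage p (coneShell (linearization Y p) Q (Real.exp (-((n : ℝ) + 1))) (Real.exp (-(n : ℝ))))

/-- `t^+_x = inf {τ > 0 | φ_τ(x) ∈ ∂B_r(p)}`. -/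
def exitTime (φ : Flow ℝ M) (p : M) (r : ℝ) (x : M) : ℝ :=
  sInf {τ : ℝ | 0 < τ ∧ φ τ x ∈ frontier (Metric.ball p r)}

/-- `t^-_x = inf {τ > 0 | φ_{-τ}(x) ∈ ∂B_r(p)}`. -/
def entryTime (φ : Flow ℝ M) (p : M) (r : ℝ) (x : M) : ℝ :=
  sInf {τ : ℝ | 0 < τ ∧ φ (-τ) x ∈ frontier (Metric.ball p r)}

/-- `C_n = φ_{[0,1)}(D_n)`. -/
def flowLayer (Y : C1VectorField E M) (φ : Flow ℝ M) (p : M) (Q : LinearMap.BilinForm ℝ E)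
    (n : ℕ) : Set M :=
  {y | ∃ t ∈ Ico (0 : ℝ) 1, ∃ x ∈ layer Y p Q n, φ t x = y}

/-- `𝒞_σ = {C_n : n > n₀} ∪ {(⋃_{n > n₀} C_n)ᶜ}`. -/
def coarsePartition (Y : C1VectorField E M) (φ : Flow ℝ M) (p : M) (Q : LinearMap.BilinForm ℝ E)
    (n₀ : ℕ) : Set (Set M) :=
  {C | ∃ n, n₀ < n ∧ C = flowLayer Y φ p Q n} ∪
    {(⋃ n, ⋃ (_ : n₀ < n), flowLayer Y φ p Q n)ᶜ}

/-- `O(σ)`, the union of the orbit segments `φ_{[-t^-_x, t^+_x]}(x)` with `x ∈ D_n`, `n > n₀`. -/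
def orbitTube (Y : C1VectorField E M) (φ : Flow ℝ M) (p : M) (Q : LinearMap.BilinForm ℝ E)
    (n₀ : ℕ) (r : ℝ) : Set M :=
  {y | ∃ n, n₀ < n ∧ ∃ x ∈ layer Y p Q n,
    ∃ t ∈ Icc (-(entryTime φ p r x)) (exitTime φ p r x), φ t x = y}

/-- The properties of the cross section and its layers that do not involve the orbits. -/
structure CrossSectionProps [MeasurableSpace M] (Y : C1VectorField E M) (p : M)
    (Q : LinearMap.BilinForm ℝ E) (r : ℝ) (n₀ : ℕ) (L₀ L₁ : ℝ) : Prop where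
  /-- the exponential map is defined on the cone -/
  exp_defined : ∀ v ∈ coneShell (linearization Y p) Q 0 (Real.exp (-((n₀ : ℝ) + 1))),
    ∃! q, IsExp p v q
  subset_ball : crossSection Y p Q n₀ ⊆ Metric.ball p r
  mem : p ∈ crossSection Y p Q n₀
  /-- away from `p`, the field is transverse to the section: in the chart at `x`, the vector `Y x`
  is not tangent to the section -/
  transverse : ∀ x ∈ crossSection Y p Q n₀, x ≠ p →
    (Y x : E) ∉ tangentConeAt ℝ (extChartAt 𝓘(ℝ, E) x ''
      (crossSection Y p Q n₀ ∩ (extChartAt 𝓘(ℝ, E) x).source)) (extChartAt 𝓘(ℝ, E) x x)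
  /-- the layers are nonempty, measurable, and partition the section minus `p` -/
  layer_nonempty : ∀ n, n₀ < n → (layer Y p Q n).Nonempty
  layer_measurable : ∀ n, n₀ < n → MeasurableSet (layer Y p Q n)
  layer_disjoint : ∀ m n, n₀ < m → n₀ < n → m ≠ n → Disjoint (layer Y p Q m) (layer Y p Q n)
  layer_iUnion : (⋃ n, ⋃ (_ : n₀ < n), layer Y p Q n) = crossSection Y p Q n₀ \ {p}
  /-- the flow speed -/
  speed : ∀ n, n₀ < n → ∀ x ∈ layer Y p Q n,
    ‖Y x‖ ∈ Icc (L₀ * Real.exp (-((n : ℝ) + 1))) (L₁ * Real.exp (-(n : ℝ)))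

/-- The properties of the cross section and of the coarse partition that involve the flow. -/
structure CoarsePartitionProps [MeasurableSpace M] (Y : C1VectorField E M) (φ : Flow ℝ M) (p : M)
    (Q : LinearMap.BilinForm ℝ E) (r : ℝ) (n₀ : ℕ) (κ K₀ K₁ H₁ : ℝ) : Prop where
  /-- every orbit segment in the (closed) ball, other than the constant orbit `p`, hits the section
  at most at one time -/
  once : ∀ x, x ≠ p → ∀ a b : ℝ, (∀ t ∈ Icc a b, φ t x ∈ Metric.closedBall p r) →
    {t | t ∈ Icc a b ∧ φ t x ∈ crossSection Y p Q n₀}.Subsingleton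
  /-- the time to leave the ball, in the future and in the past -/
  exit_time : ∀ n, n₀ < n → ∀ x ∈ layer Y p Q n,
    exitTime φ p r x / n ∈ Icc K₀ K₁ ∧ entryTime φ p r x / n ∈ Icc K₀ K₁
  tube_subset : orbitTube Y φ p Q n₀ r ⊆ closure (Metric.ball p r)
  /-- the closure of the tube contains the open ball of diameter `e^{-n₀}` -/
  ball_subset : Metric.ball p (Real.exp (-(n₀ : ℝ)) / 2) ⊆ closure (orbitTube Y φ p Q n₀ r)
  /-- `𝒞_σ` is a countable measurable partition of `M` -/
  isPartition : Setoid.IsPartition (coarsePartition Y φ p Q n₀)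
  countable : (coarsePartition Y φ p Q n₀).Countable
  measurable : ∀ C ∈ coarsePartition Y φ p Q n₀, MeasurableSet C
  /-- the sets `C_n` form a cone with vertex `p`: `C_n` (in particular `D_n`) is at distance
  comparable to `e^{-n}` from `p` -/
  cone : ∀ n, n₀ < n → ∀ y ∈ flowLayer Y φ p Q n,
    dist y p ∈ Icc (κ⁻¹ * Real.exp (-(n : ℝ))) (κ * Real.exp (-(n : ℝ)))
  entropy : ∀ μ : Measure M, IsProbabilityMeasure μ → (∀ t, MeasurePreserving (φ t) μ μ) →
    partitionEntropy μ (coarsePartition Y φ p Q n₀) < ENNReal.ofReal H₁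

end Manifold

end SingularFlow

end

/-! Everything rests on one Lyapunov function. Choose an inner product on T_σM, and let `J` be the
reflection equal to 1 on E^u and -1 on E^s, in such a way that A = DX(σ) satisfies ⟨Jv, Av⟩ ≥ λ|v|²
(`exists_saddleForm`: integrate an inner product along the linear flow over a long time interval).
Then q(v) = ⟨Jv, v⟩ = |v^u|² - |v^s|² has derivative 2⟨Jv, Av⟩ > 0 along nonzero linear orbits, and
the cone |v^s| = |v^u| is {q = 0}. In suitable coordinates the field Z differs from a linear saddle,
and the inverse exponential map k differs from the identity, by maps of Lipschitz constant ε. Such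
errors leave q ∘ k strictly increasing along orbits (`IsLocalSaddle.strictMonoOn_quad`). Hence an
orbit segment near the singularity meets the section {q ∘ k = 0} at most once, and the same
inequality gives transversality.

Where q ∘ k ≥ 0 the unstable component dominates and grows at rate at least λ/2, while norms grow at
rate at most 2Λ. A point of the layer of index n, at distance about e^{-n}, therefore leaves after a
time comparable to n (`IsSaddleBall.exitTime_layer`); reversing time and the sign of `J` gives the
past. Flow boxes of height proportional to n over the layers are disjoint, so an invariant
probability has ∑ n μ(C_n) bounded, and -x log x ≤ n x + e^{-(n+1)} bounds the entropy
(`IsTower.entropy_lt`). For the tube, if q vanishes on the difference of two points whose orbits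
both stay near the singularity, that difference is expanded and yet bounded, hence zero. So on a
line in a cone direction at most one point stays in the future and at most one in the past. The
other points near the singularity leave on both sides, and their orbits cross the section on the way
(`IsSaddleBall.ball_subset`).

Uniformity in Y holds because these estimates use a fixed `J`, a fixed linear saddle and fixed
constants; only the coordinates depend on Y. They are built in `exists_uniform_saddleModel`: the
singularity of Y comes from a quantitative inverse function argument, its linearization is
conjugated by a map close to the identity to one commuting with `J`
(`eventually_exists_unit_conj_commute`), and the exponential map is controlled uniformly in the base
point through the geodesic spray (`exists_exp_chart`). -/

namespace SingularFlow

/-! ### Hyperbolic linear fields -/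

theorem eq_zero_of_eq_neg {V : Type*} [AddCommGroup V] [Module ℝ V] {v : V} (h : v = -v) :
    v = 0 := by
  have h1 : (2 : ℝ) • v = 0 := by
    rw [two_smul]; nth_rewrite 2 [h]; exact add_neg_cancel v
  exact (smul_eq_zero.1 h1).resolve_left two_ne_zero

section LinearFields

variable {E : Type*} [NormedAddCommGroup E] [NormedSpace ℝ E]
  {F : Type*} [NormedAddCommGroup F] [NormedSpace ℝ F]

theorem mem_stableSpace_iff {A : E →L[ℝ] E} {v : E} :
    v ∈ stableSpace A ↔ Tendsto (fun t : ℝ => (NormedSpace.exp (t • A)) v) atTop (𝓝 0) :=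
  Iff.rfl

theorem exp_conj_clm [CompleteSpace E] [CompleteSpace F] (R : E ≃L[ℝ] F) (D : F →L[ℝ] F) :
    NormedSpace.exp ((R.symm : F →L[ℝ] E) ∘L D ∘L (R : E →L[ℝ] F)) =
      (R.symm : F →L[ℝ] E) ∘L (NormedSpace.exp D) ∘L (R : E →L[ℝ] F) := by
  let _ : NormedAlgebra ℚ (F →L[ℝ] F) := NormedAlgebra.restrictScalars ℚ ℝ _
  let _ : NormedAlgebra ℚ (E →L[ℝ] E) := NormedAlgebra.restrictScalars ℚ ℝ _
  have h := NormedSpace.map_exp R.symm.conjContinuousAlgEquiv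
    R.symm.conjContinuousAlgEquiv.continuous D
  simpa [ContinuousLinearEquiv.conjContinuousAlgEquiv_apply] using h.symm

theorem mem_stableSpace_conj [CompleteSpace E] [CompleteSpace F] (R : E ≃L[ℝ] F)
    (D : F →L[ℝ] F) (v : E) :
    v ∈ stableSpace ((R.symm : F →L[ℝ] E) ∘L D ∘L (R : E →L[ℝ] F)) ↔ R v ∈ stableSpace D := by
  have key : ∀ t : ℝ, NormedSpace.exp (t • ((R.symm : F →L[ℝ] E) ∘L D ∘L (R : E →L[ℝ] F))) v =
      R.symm (NormedSpace.exp (t • D) (R v)) := by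
    intro t
    have : t • ((R.symm : F →L[ℝ] E) ∘L D ∘L (R : E →L[ℝ] F)) =
        (R.symm : F →L[ℝ] E) ∘L (t • D) ∘L (R : E →L[ℝ] F) := by
      ext w; simp
    rw [this, exp_conj_clm]; rfl
  rw [mem_stableSpace_iff, mem_stableSpace_iff]
  simp only [key]
  constructor
  · intro h
    have := (R.continuous.tendsto 0).comp h
    simpa [Function.comp_def] using this
  · intro h
    have := (R.symm.continuous.tendsto 0).comp h
    simpa [Function.comp_def] using this

theorem mem_unstableSpace_conj [CompleteSpace E] [CompleteSpace F] (R : E ≃L[ℝ] F)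
    (D : F →L[ℝ] F) (v : E) :
    v ∈ unstableSpace ((R.symm : F →L[ℝ] E) ∘L D ∘L (R : E →L[ℝ] F)) ↔
      R v ∈ unstableSpace D := by
  have : -((R.symm : F →L[ℝ] E) ∘L D ∘L (R : E →L[ℝ] F)) =
      (R.symm : F →L[ℝ] E) ∘L (-D) ∘L (R : E →L[ℝ] F) := by
    ext w; simp
  unfold unstableSpace
  rw [this, mem_stableSpace_conj]

theorem hasDerivAt_exp_apply [CompleteSpace E] (A : E →L[ℝ] E) (v : E) (t : ℝ) :
    HasDerivAt (fun s : ℝ => NormedSpace.exp (s • A) v) (NormedSpace.exp (t • A) (A v)) t := by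
  have h := (hasDerivAt_exp_smul_const (𝕂 := ℝ) A t).clm_apply (hasDerivAt_const t v)
  simpa using h

theorem exp_comm_apply [CompleteSpace E] {A B : E →L[ℝ] E} (h : ∀ v, A (B v) = B (A v)) (t : ℝ)
    (v : E) : NormedSpace.exp (t • A) (B v) = B (NormedSpace.exp (t • A) v) := by
  let _ : NormedAlgebra ℚ (E →L[ℝ] E) := NormedAlgebra.restrictScalars ℚ ℝ _
  have hc : Commute (t • A) B := by
    apply Commute.smul_left
    ext v
    exact h v
  have := congrArg (fun L : E →L[ℝ] E => L v) (Commute.exp_left hc).eq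
  simpa using this

theorem map_mem_stableSpace [CompleteSpace E] (A : E →L[ℝ] E) {v : E} (hv : v ∈ stableSpace A) :
    A v ∈ stableSpace A := by
  rw [mem_stableSpace_iff] at *
  simp only [exp_comm_apply (A := A) (B := A) (fun _ => rfl)]
  have := (A.continuous.tendsto 0).comp hv
  simpa [Function.comp_def] using this

theorem map_mem_unstableSpace [CompleteSpace E] (A : E →L[ℝ] E) {v : E}
    (hv : v ∈ unstableSpace A) : A v ∈ unstableSpace A := by
  have := neg_mem (map_mem_stableSpace (-A) hv)
  simpa [unstableSpace] using this

/-- On its stable space a linear field is uniformly contracting after some time. -/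
theorem eventually_norm_exp_comp_le [FiniteDimensional ℝ E] (A P : E →L[ℝ] E)
    (hP : ∀ v, P v ∈ stableSpace A) {ε : ℝ} (hε : 0 < ε) :
    ∀ᶠ t : ℝ in atTop, ∀ v, ‖NormedSpace.exp (t • A) (P v)‖ ≤ ε * ‖v‖ := by
  let b := Module.finBasis ℝ E
  set C : ℝ := Fintype.card (Fin (Module.finrank ℝ E)) • ‖b.equivFunL.toContinuousLinearMap‖
    with hC
  have hC0 : 0 ≤ C := by positivity
  -- The convergence is pointwise; testing it on a basis makes it uniform, at the cost of the factor
  -- `C`.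
  have h1 : ∀ᶠ t : ℝ in atTop, ∀ i, ‖NormedSpace.exp (t • A) (P (b i))‖ ≤ ε / (C + 1) := by
    rw [eventually_all]
    intro i
    have h2 := (hP (b i) : Tendsto _ _ _).norm
    rw [norm_zero] at h2
    exact (h2.eventually (gt_mem_nhds (by positivity : (0 : ℝ) < ε / (C + 1)))).mono
      fun t ht => ht.le
  filter_upwards [h1] with t ht v
  have h3 := b.opNorm_le (u := NormedSpace.exp (t • A) ∘L P) (by positivity) ht
  have h4 : C * (ε / (C + 1)) ≤ ε := by
    rw [mul_div_assoc', div_le_iff₀ (by positivity)]; nlinarith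
  calc ‖NormedSpace.exp (t • A) (P v)‖ = ‖(NormedSpace.exp (t • A) ∘L P) v‖ := rfl
    _ ≤ ‖NormedSpace.exp (t • A) ∘L P‖ * ‖v‖ := ContinuousLinearMap.le_opNorm _ _
    _ ≤ ε * ‖v‖ := by gcongr; exact h3.trans h4

end LinearFields

section Coordinates

/-- The adapted inner product is carried to Euclidean space, so that later estimates use one fixed
norm there and not a second norm on the tangent space. -/
theorem exists_euclidean_coordinates {V : Type*} [AddCommGroup V] [Module ℝ V]
    [FiniteDimensional ℝ V] (Q : LinearMap.BilinForm ℝ V) (symm : ∀ v w, Q v w = Q w v)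
    (pos : ∀ v, v ≠ 0 → 0 < Q v v) :
    ∃ R : V ≃ₗ[ℝ] EuclideanSpace ℝ (Fin (Module.finrank ℝ V)),
      ∀ v w, inner ℝ (R v) (R w) = Q v w := by
  let core : InnerProductSpace.Core ℝ V :=
    { inner := fun v w => Q v w
      conj_inner_symm := fun x y => by simpa using symm y x
      re_inner_nonneg := fun x => by
        by_cases hx : x = 0
        · simp [hx]
        · exact (pos x hx).le
      add_left := fun x y z => by simp
      smul_left := fun x y r => by simp
      definite := fun x hx => by
        by_contra h
        exact (pos x h).ne' hx }
  let _ : NormedAddCommGroup V := core.toNormedAddCommGroup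
  let _ : InnerProductSpace ℝ V := InnerProductSpace.ofCore core.toCore
  refine ⟨(stdOrthonormalBasis ℝ V).repr.toLinearEquiv, fun v w => ?_⟩
  exact (stdOrthonormalBasis ℝ V).repr.inner_map_map v w

end Coordinates

/-! ### Exponential growth estimates along a curve. -/

section Growth

variable {F : Type*} [NormedAddCommGroup F] [InnerProductSpace ℝ F]

/-- Grönwall for the squared norm: its derivative is 2⟨z, z'⟩, so e^{-2ct}‖z‖² is nonincreasing. -/
theorem norm_le_exp_mul_norm {z z' : ℝ → F} {a b c : ℝ} (hab : a ≤ b)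
    (hd : ∀ t ∈ Icc a b, HasDerivAt z (z' t) t)
    (h : ∀ t ∈ Icc a b, inner ℝ (z t) (z' t) ≤ c * ‖z t‖ ^ 2) :
    ‖z b‖ ≤ Real.exp (c * (b - a)) * ‖z a‖ := by
  have hg : ∀ t ∈ Icc a b, HasDerivAt (fun t => Real.exp (-(2 * c) * t) * ‖z t‖ ^ 2)
      (Real.exp (-(2 * c) * t) * (-(2 * c)) * ‖z t‖ ^ 2 +
        Real.exp (-(2 * c) * t) * (2 * inner ℝ (z t) (z' t))) t := by
    intro t ht
    have h1 : HasDerivAt (fun t : ℝ => Real.exp (-(2 * c) * t))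
        (Real.exp (-(2 * c) * t) * (-(2 * c))) t := by
      simpa using ((hasDerivAt_id t).const_mul (-(2 * c))).exp
    exact h1.mul (hd t ht).norm_sq
  have hanti : AntitoneOn (fun t => Real.exp (-(2 * c) * t) * ‖z t‖ ^ 2) (Icc a b) := by
    refine antitoneOn_of_deriv_nonpos (convex_Icc a b)
      (fun t ht => (hg t ht).continuousAt.continuousWithinAt)
      (fun t ht => (hg t (interior_subset ht)).differentiableAt.differentiableWithinAt)
      fun t ht => ?_
    rw [(hg t (interior_subset ht)).deriv]
    have h2 := h t (interior_subset ht)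
    have h3 := Real.exp_pos (-(2 * c) * t)
    nlinarith
  have h2 := hanti (left_mem_Icc.2 hab) (right_mem_Icc.2 hab) hab
  have h3 : ‖z b‖ ^ 2 ≤ (Real.exp (c * (b - a)) * ‖z a‖) ^ 2 := by
    have h4 : ‖z b‖ ^ 2 = Real.exp (2 * c * b) * (Real.exp (-(2 * c) * b) * ‖z b‖ ^ 2) := by
      rw [← mul_assoc, ← Real.exp_add]; ring_nf; simp
    have h5 : (Real.exp (c * (b - a)) * ‖z a‖) ^ 2 =
        Real.exp (2 * c * b) * (Real.exp (-(2 * c) * a) * ‖z a‖ ^ 2) := by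
      rw [← mul_assoc, ← Real.exp_add, mul_pow, ← Real.exp_nat_mul]; ring_nf
    rw [h4, h5]
    exact mul_le_mul_of_nonneg_left h2 (Real.exp_pos _).le
  exact abs_le_of_sq_le_sq' h3 (by positivity) |>.2

/-- The upper bound applied to t ↦ z(-t). -/
theorem exp_mul_norm_le_norm {z z' : ℝ → F} {a b c : ℝ} (hab : a ≤ b)
    (hd : ∀ t ∈ Icc a b, HasDerivAt z (z' t) t)
    (h : ∀ t ∈ Icc a b, c * ‖z t‖ ^ 2 ≤ inner ℝ (z t) (z' t)) :
    Real.exp (c * (b - a)) * ‖z a‖ ≤ ‖z b‖ := by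
  have h1 := norm_le_exp_mul_norm (z := fun t => z (-t)) (z' := fun t => -z' (-t)) (c := -c)
    (neg_le_neg hab) (fun t ht => ?_) (fun t ht => ?_)
  · simp only [neg_neg] at h1
    have h2 := mul_le_mul_of_nonneg_left h1 (Real.exp_pos (c * (b - a))).le
    rw [← mul_assoc, ← Real.exp_add] at h2
    ring_nf at h2 ⊢
    simpa using h2
  · have ht' : -t ∈ Icc a b := ⟨by linarith [ht.2], by linarith [ht.1]⟩
    have := (hd (-t) ht').scomp t (hasDerivAt_neg t)
    simpa [Function.comp_def] using this
  · have ht' : -t ∈ Icc a b := ⟨by linarith [ht.2], by linarith [ht.1]⟩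
    have := h (-t) ht'
    simp only [inner_neg_right]
    linarith

end Growth

/-! ### Reflections adapted to a hyperbolic linear field. -/

section SaddleForm

variable {F : Type*} [NormedAddCommGroup F] [InnerProductSpace ℝ F]

/-- `J` is the orthogonal reflection which is `1` on the unstable and `-1` on the stable space of
`A`, and `A` expands the quadratic form `⟪J v, v⟫` at the rate `lam`. -/
structure SaddleForm (J A : F →L[ℝ] F) (lam : ℝ) : Prop where
  invol : ∀ v, J (J v) = v
  symm : ∀ v w, inner ℝ (J v) w = inner ℝ v (J w)
  comm : ∀ v, J (A v) = A (J v)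
  coercive : ∀ v, lam * ‖v‖ ^ 2 ≤ inner ℝ (J v) (A v)

/-- Time reversal exchanges the stable and unstable spaces, so each later statement needs a proof
for only one of them. -/
theorem SaddleForm.neg {J A : F →L[ℝ] F} {lam : ℝ} (h : SaddleForm J A lam) :
    SaddleForm (-J) (-A) lam where
  invol v := by simp [h.invol]
  symm v w := by simp [h.symm]
  comm v := by simp [h.comm]
  coercive v := by simpa using h.coercive v

theorem SaddleForm.norm_map {J A : F →L[ℝ] F} {lam : ℝ} (h : SaddleForm J A lam) (v : F) :
    ‖J v‖ = ‖v‖ := by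
  have : inner ℝ (J v) (J v) = inner ℝ v v := by rw [h.symm, h.invol]
  rw [real_inner_self_eq_norm_sq, real_inner_self_eq_norm_sq] at this
  exact (sq_eq_sq₀ (norm_nonneg _) (norm_nonneg _)).1 this

variable [CompleteSpace F]

theorem SaddleForm.exp_orbit {J A : F →L[ℝ] F} {lam : ℝ} (h : SaddleForm J A lam) (v : F) :
    (∀ t : ℝ, HasDerivAt (fun t : ℝ => NormedSpace.exp (t • A) v)
      (A (NormedSpace.exp (t • A) v)) t) ∧
    ∀ t : ℝ, J (NormedSpace.exp (t • A) v) = NormedSpace.exp (t • A) (J v) := by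
  refine ⟨fun t => ?_, fun t => ?_⟩
  · have := hasDerivAt_exp_apply A v t
    rwa [exp_comm_apply (A := A) (B := A) (fun _ => rfl)] at this
  · exact (exp_comm_apply (A := A) (B := J) (fun w => (h.comm w).symm) t v).symm

/-- The orbit stays in the eigenspace of `J` for -1, where coercivity reads ⟨x, Ax⟩ ≤ -λ‖x‖²; this
gives decay at rate λ. -/
theorem SaddleForm.mem_stableSpace_of {J A : F →L[ℝ] F} {lam : ℝ} (h : SaddleForm J A lam)
    (hlam : 0 < lam) {v : F} (hv : J v = -v) : v ∈ stableSpace A := by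
  obtain ⟨hd, hJ⟩ := h.exp_orbit v
  have hb : ∀ t, 0 ≤ t → ‖NormedSpace.exp (t • A) v‖ ≤ Real.exp (-lam * t) * ‖v‖ := by
    intro t ht
    have := norm_le_exp_mul_norm (c := -lam) ht (fun s _ => hd s) (fun s _ => by
      have h2 := h.coercive (NormedSpace.exp (s • A) v)
      rw [hJ, hv, map_neg, inner_neg_left] at h2
      linarith)
    simpa using this
  rw [mem_stableSpace_iff]
  apply squeeze_zero_norm' (a := fun t => Real.exp (-lam * t) * ‖v‖)
  · filter_upwards [eventually_ge_atTop 0] with t ht using hb t ht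
  · have : Tendsto (fun t : ℝ => Real.exp (-lam * t)) atTop (𝓝 0) := by
      apply Real.tendsto_exp_atBot.comp
      exact tendsto_id.const_mul_atTop_of_neg (by linarith)
    simpa using this.mul_const ‖v‖

/-- If v decays, so does w = v + Jv, because `J` commutes with the flow. But Jw = w, so coercivity
makes the norm of the orbit of w nondecreasing, and w = 0. -/
theorem SaddleForm.mem_stableSpace_iff {J A : F →L[ℝ] F} {lam : ℝ} (h : SaddleForm J A lam)
    (hlam : 0 < lam) {v : F} : v ∈ stableSpace A ↔ J v = -v := by
  refine ⟨fun hv => ?_, h.mem_stableSpace_of hlam⟩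
  set w := v + J v with hw
  have hJw : J w = w := by rw [hw, map_add, h.invol, add_comm]
  obtain ⟨hd, hJ⟩ := h.exp_orbit w
  have hb : ∀ t : ℝ, 0 ≤ t → ‖w‖ ≤ ‖NormedSpace.exp (t • A) w‖ := by
    intro t ht
    have h1 := exp_mul_norm_le_norm (z := fun t : ℝ => NormedSpace.exp (t • A) w) (c := 0) ht (fun s _ => hd s) (fun s _ => by
      have h2 := h.coercive (NormedSpace.exp (s • A) w)
      rw [hJ, hJw] at h2
      have : 0 ≤ lam * ‖NormedSpace.exp (s • A) w‖ ^ 2 := by positivity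
      linarith)
    simpa using h1
  have hlim : Tendsto (fun t : ℝ => ‖NormedSpace.exp (t • A) w‖) atTop (𝓝 0) := by
    have h1 : Tendsto (fun t : ℝ => NormedSpace.exp (t • A) v) atTop (𝓝 0) := hv
    have h2 := (J.continuous.tendsto 0).comp h1
    have h3 := (h1.add h2).norm
    simp only [map_zero, add_zero, norm_zero] at h3
    refine h3.congr fun t => ?_
    rw [hw, map_add, Function.comp_apply, (h.exp_orbit v).2]
  have : ‖w‖ ≤ 0 := ge_of_tendsto hlim ((eventually_ge_atTop 0).mono hb)
  have hw0 : w = 0 := norm_le_zero_iff.1 this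
  exact (neg_eq_of_add_eq_zero_right hw0).symm

theorem SaddleForm.mem_unstableSpace_iff {J A : F →L[ℝ] F} {lam : ℝ} (h : SaddleForm J A lam)
    (hlam : 0 < lam) {v : F} : v ∈ unstableSpace A ↔ J v = v := by
  rw [unstableSpace, h.neg.mem_stableSpace_iff hlam]
  simp

theorem SaddleForm.isHyperbolicSaddle {J A : F →L[ℝ] F} {lam : ℝ} (h : SaddleForm J A lam)
    (hlam : 0 < lam) (hs : ∃ v, v ≠ 0 ∧ J v = -v) (hu : ∃ v, v ≠ 0 ∧ J v = v) :
    IsHyperbolicSaddle A where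
  isCompl := by
    constructor
    · rw [Submodule.disjoint_def]
      intro v h1 h2
      rw [h.mem_stableSpace_iff hlam] at h1
      rw [h.mem_unstableSpace_iff hlam] at h2
      rw [h1] at h2
      exact eq_zero_of_eq_neg h2.symm
    · rw [codisjoint_iff, eq_top_iff]
      intro v _
      rw [Submodule.mem_sup]
      refine ⟨(1 / 2 : ℝ) • (v - J v), ?_, (1 / 2 : ℝ) • (v + J v), ?_, ?_⟩
      · rw [h.mem_stableSpace_iff hlam]; simp [h.invol, ← smul_neg]
      · rw [h.mem_unstableSpace_iff hlam]; simp [h.invol, add_comm]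
      · rw [← smul_add]
        have : v - J v + (v + J v) = (2 : ℝ) • v := by rw [two_smul]; abel
        rw [this, smul_smul]; norm_num
  stable_ne_bot := by
    obtain ⟨v, hv, hv'⟩ := hs
    intro hb
    have : v ∈ stableSpace A := (h.mem_stableSpace_iff hlam).2 hv'
    rw [hb] at this
    exact hv (by simpa using this)
  unstable_ne_bot := by
    obtain ⟨v, hv, hv'⟩ := hu
    intro hb
    have : v ∈ unstableSpace A := (h.mem_unstableSpace_iff hlam).2 hv'
    rw [hb] at this
    exact hv (by simpa using this)

end SaddleForm

/-! ### Perturbation of the hyperbolic splitting -/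

section Perturbation

variable {F : Type*} [NormedAddCommGroup F] [InnerProductSpace ℝ F] [FiniteDimensional ℝ F]

/-- A field commuting with the saddle field `A` and anticommuting with the reflection vanishes. -/
theorem SaddleForm.eq_zero_of_comm {J A N : F →L[ℝ] F} {lam : ℝ} (h : SaddleForm J A lam)
    (hlam : 0 < lam) (hN : ∀ v, N (A v) = A (N v)) (hJ : ∀ v, J (N v) = -N (J v)) : N = 0 := by
  -- The stable space is defined by decay under a flow commuting with `N`, so `N` preserves it;
  -- anticommuting with `J` sends it into the unstable space. General `J` and `A` allow a second use
  -- with `-J` and `-A`.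
  have key : ∀ {J A : F →L[ℝ] F}, SaddleForm J A lam → (∀ v, N (A v) = A (N v)) →
      (∀ v, J (N v) = -N (J v)) → ∀ v, J v = -v → N v = 0 := by
    intro J A h hN hJ v hv
    have h1 : v ∈ stableSpace A := (h.mem_stableSpace_iff hlam).2 hv
    have h2 : N v ∈ stableSpace A := by
      rw [SingularFlow.mem_stableSpace_iff] at *
      simp only [exp_comm_apply (A := A) (B := N) (fun w => (hN w).symm)]
      have := (N.continuous.tendsto 0).comp h1
      simpa [Function.comp_def] using this
    rw [h.mem_stableSpace_iff hlam, hJ, hv, map_neg, neg_neg] at h2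
    exact eq_zero_of_eq_neg h2
  have hs := key h hN hJ
  have hu := key h.neg (fun v => by simp [hN]) (fun v => by simp [hJ])
  ext v
  have h1 := hs (v - J v) (by simp [h.invol])
  have h2 := hu (v + J v) (by simp [h.invol, add_comm])
  have : N v + N v = 0 := by
    have : N (v - J v) + N (v + J v) = N v + N v := by simp only [map_add, map_sub]; abel
    rw [← this, h1, h2, add_zero]
  exact eq_zero_of_eq_neg (eq_neg_of_add_eq_zero_left this)

-- Split T = DT + NT into the parts commuting and anticommuting with J. The map Ψ(T) = (1 + NT) DT
-- (1 + NT)⁻¹ has derivative T ↦ DT + [NT, A] at A. The first summand commutes with J and the second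
-- anticommutes, and [N, A] = 0 forces N = 0 for anticommuting N, so the derivative is injective.
-- Thus Ψ covers a neighbourhood of A, and if A' = Ψ(T), then U = 1 + NT conjugates A' to DT.
set_option synthInstance.maxHeartbeats 200000 in
theorem eventually_exists_unit_conj_commute {L : Type*} [NormedRing L] [NormedAlgebra ℝ L]
    [FiniteDimensional ℝ L] {J A : L} (hJJ : J * J = 1) (hJA : J * A = A * J)
    (hA : ∀ N : L, N * A = A * N → J * N = -(N * J) → N = 0) {ε : ℝ} (hε : 0 < ε) :
    ∀ᶠ A' in 𝓝 A, ∃ U : Lˣ, ‖(U : L) - 1‖ < ε ∧ ‖((U⁻¹ : Lˣ) : L) - 1‖ < ε ∧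
      ‖((U⁻¹ : Lˣ) : L) * A' * U - A‖ < ε ∧
      J * (((U⁻¹ : Lˣ) : L) * A' * U) = (((U⁻¹ : Lˣ) : L) * A' * U) * J := by
  have : CompleteSpace L := FiniteDimensional.complete ℝ L
  let conjJ : L →L[ℝ] L := ContinuousLinearMap.mulLeftRight ℝ L J J
  let D : L →L[ℝ] L := (1 / 2 : ℝ) • (ContinuousLinearMap.id ℝ L + conjJ)
  let N : L →L[ℝ] L := (1 / 2 : ℝ) • (ContinuousLinearMap.id ℝ L - conjJ)
  have hconj : ∀ T, conjJ T = J * T * J := fun T => rfl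
  have hDN : ∀ T, D T + N T = T := by
    intro T
    change (1 / 2 : ℝ) • (T + conjJ T) + (1 / 2 : ℝ) • (T - conjJ T) = T
    rw [← smul_add, add_add_sub_cancel, ← two_smul ℝ, smul_smul]; norm_num
  have hDJ : ∀ T, J * D T = D T * J := by
    intro T
    change J * ((1 / 2 : ℝ) • (T + J * T * J)) = ((1 / 2 : ℝ) • (T + J * T * J)) * J
    rw [mul_smul_comm, smul_mul_assoc, mul_add, add_mul, mul_assoc (J * T), hJJ, ← mul_assoc J,
      ← mul_assoc J, hJJ, one_mul, mul_one, add_comm]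
  have hNJ : ∀ T, J * N T = -(N T * J) := by
    intro T
    change J * ((1 / 2 : ℝ) • (T - J * T * J)) = -(((1 / 2 : ℝ) • (T - J * T * J)) * J)
    rw [mul_smul_comm, smul_mul_assoc, mul_sub, sub_mul, mul_assoc (J * T), hJJ, ← mul_assoc J,
      ← mul_assoc J, hJJ, one_mul, mul_one, ← smul_neg, neg_sub]
  have hDA : D A = A := by
    change (1 / 2 : ℝ) • (A + J * A * J) = A
    rw [hJA, mul_assoc, hJJ, mul_one, ← two_smul ℝ, smul_smul]; norm_num
  have hNA : N A = 0 := by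
    have := hDN A
    rwa [hDA, add_eq_left] at this
  let Ψ : L → L := fun T => (1 + N T) * D T * Ring.inverse (1 + N T)
  have hN1 : HasStrictFDerivAt (fun T => 1 + N T) N A := N.hasStrictFDerivAt.const_add 1
  have hinv : HasStrictFDerivAt (fun T : L => Ring.inverse (1 + N T)) (-N) A := by
    have h1 := hasStrictFDerivAt_ringInverse (𝕜 := ℝ) (1 : Lˣ)
    have h2 : ((1 : Lˣ) : L) = 1 + N A := by simp [hNA]
    rw [h2] at h1
    refine (h1.comp A hN1).congr_fderiv ?_
    ext T : 1
    simp
  let Ψ' : L →L[ℝ] L := D + ((ContinuousLinearMap.mul ℝ L).flip A - ContinuousLinearMap.mul ℝ L A) ∘L N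
  have hΨ : HasStrictFDerivAt Ψ Ψ' A := by
    refine ((hN1.mul' D.hasStrictFDerivAt).mul' hinv).congr_fderiv ?_
    ext T : 1
    simp [Ψ', hNA, hDA]
    abel
  have hinj : Function.Injective Ψ' := by
    rw [injective_iff_map_eq_zero]
    intro T hT
    have hT' : D T + (N T * A - A * N T) = 0 := hT
    set K := N T * A - A * N T with hK
    have hKJ : J * K = -(K * J) := by
      rw [hK, mul_sub, ← mul_assoc, hNJ, ← mul_assoc, hJA, mul_assoc A, hNJ, sub_mul, mul_assoc _ A,
        ← hJA, neg_mul, mul_assoc, mul_neg, mul_assoc A]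
      abel
    have hD0 : D T = -K := eq_neg_of_add_eq_zero_left hT'
    have h1 := hDJ T
    rw [hD0, mul_neg, hKJ, neg_neg, neg_mul] at h1
    have h2 : K * J = 0 := eq_zero_of_eq_neg h1
    have hK0 : K = 0 := by
      calc K = K * J * J := by rw [mul_assoc, hJJ, mul_one]
        _ = 0 := by rw [h2, zero_mul]
    have hN0 : N T = 0 := by
      exact hA _ (sub_eq_zero.1 (hK ▸ hK0)) (hNJ T)
    rw [← hDN T, hD0, hN0, hK0]; simp
  -- Finite dimension turns injectivity into surjectivity, and a strictly differentiable map with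
  -- surjective derivative is open at the point.
  have hrange : (Ψ' : L →ₗ[ℝ] L).range = ⊤ :=
    LinearMap.range_eq_top.2 (LinearMap.injective_iff_surjective.1 hinj)
  have hmap := hΨ.map_nhds_eq_of_surj hrange
  have hΨA : Ψ A = A := by simp [Ψ, hNA, hDA]
  rw [hΨA] at hmap
  have hcN : ContinuousAt (fun T => 1 + N T) A := hN1.continuousAt
  have e1 : ∀ᶠ T in 𝓝 A, ‖(1 + N T) - 1‖ < ε := by
    have h1 : Tendsto (fun T => ‖(1 + N T) - 1‖) (𝓝 A) (𝓝 0) := by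
      have h0 := (hcN.tendsto.sub_const 1).norm
      simpa only [hNA, add_zero, sub_self, norm_zero] using h0
    exact h1.eventually (gt_mem_nhds hε)
  have e2 : ∀ᶠ T in 𝓝 A, ‖Ring.inverse (1 + N T) - 1‖ < ε := by
    have h1 : Tendsto (fun T => ‖Ring.inverse (1 + N T) - 1‖) (𝓝 A) (𝓝 0) := by
      have h0 := (hinv.continuousAt.tendsto.sub_const 1).norm
      simpa only [hNA, add_zero, Ring.inverse_one, sub_self, norm_zero] using h0
    exact h1.eventually (gt_mem_nhds hε)
  have e3 : ∀ᶠ T in 𝓝 A, ‖D T - A‖ < ε := by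
    have h1 : Tendsto (fun T => ‖D T - A‖) (𝓝 A) (𝓝 0) := by
      have h0 := ((D.continuous.tendsto A).sub_const A).norm
      simpa only [hDA, sub_self, norm_zero] using h0
    exact h1.eventually (gt_mem_nhds hε)
  have e4 : ∀ᶠ T in 𝓝 A, IsUnit (1 + N T) := by
    apply hcN.eventually
    apply Units.isOpen.mem_nhds
    simp [hNA]
  have hall : ∀ᶠ A' in Filter.map Ψ (𝓝 A), ∃ U : Lˣ, ‖(U : L) - 1‖ < ε ∧
      ‖((U⁻¹ : Lˣ) : L) - 1‖ < ε ∧ ‖((U⁻¹ : Lˣ) : L) * A' * U - A‖ < ε ∧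
      J * (((U⁻¹ : Lˣ) : L) * A' * U) = (((U⁻¹ : Lˣ) : L) * A' * U) * J := by
    rw [eventually_map]
    filter_upwards [e1, e2, e3, e4] with T h1 h2 h3 h4
    obtain ⟨U, hU⟩ := h4
    have hUinv : Ring.inverse (1 + N T) = ((U⁻¹ : Lˣ) : L) := by rw [← hU, Ring.inverse_unit]
    have hconjP : ((U⁻¹ : Lˣ) : L) * Ψ T * U = D T := by
      change ((U⁻¹ : Lˣ) : L) * ((1 + N T) * D T * Ring.inverse (1 + N T)) * (U : L) = D T
      rw [hUinv, ← hU]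
      simp [mul_assoc]
    refine ⟨U, ?_, ?_, ?_, ?_⟩
    · rwa [hU]
    · rwa [← hUinv]
    · rwa [hconjP]
    · rw [hconjP]; exact hDJ T
  rwa [hmap] at hall

theorem SaddleForm.eventually_exists_blockDiagonal {J A : F →L[ℝ] F} {lam : ℝ}
    (h : SaddleForm J A lam) (hlam : 0 < lam) {ε : ℝ} (hε : 0 < ε) :
    ∀ᶠ A' in 𝓝 A, ∃ P : F ≃L[ℝ] F, ‖(P : F →L[ℝ] F) - 1‖ < ε ∧
      ‖(P.symm : F →L[ℝ] F) - 1‖ < ε ∧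
      ‖(P.symm : F →L[ℝ] F) ∘L A' ∘L (P : F →L[ℝ] F) - A‖ < ε ∧
      ∀ v, J (P.symm (A' (P v))) = P.symm (A' (P (J v))) := by
  have hJJ : J * J = 1 := by ext v; simp [h.invol v]
  have hJA : J * A = A * J := by ext v; simp [h.comm v]
  have hA : ∀ N : F →L[ℝ] F, N * A = A * N → J * N = -(N * J) → N = 0 := fun N h1 h2 =>
    h.eq_zero_of_comm hlam (fun v => congrArg (fun B : F →L[ℝ] F => B v) h1)
      (fun v => congrArg (fun B : F →L[ℝ] F => B v) h2)
  filter_upwards [eventually_exists_unit_conj_commute hJJ hJA hA hε] with A' hA'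
  obtain ⟨U, h1, h2, h3, h4⟩ := hA'
  exact ⟨ContinuousLinearEquiv.unitsEquiv ℝ F U, h1, h2, h3,
    fun v => congrArg (fun B : F →L[ℝ] F => B v) h4⟩

end Perturbation

end SingularFlow

namespace SingularFlow

/-! ### An inner product adapted to a hyperbolic linear field. -/

section AdaptedInner

theorem exists_pos_mul_sq_norm_le {F : Type*} [NormedAddCommGroup F] [InnerProductSpace ℝ F]
    [FiniteDimensional ℝ F] [Nontrivial F] (B C : F →L[ℝ] F)
    (h : ∀ v, v ≠ 0 → 0 < inner ℝ (B v) (C v)) :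
    ∃ lam : ℝ, 0 < lam ∧ ∀ v, lam * ‖v‖ ^ 2 ≤ inner ℝ (B v) (C v) := by
  have hcont : Continuous fun v => inner ℝ (B v) (C v) := B.continuous.inner C.continuous
  obtain ⟨x, hx, hmin⟩ := (isCompact_sphere (0 : F) 1).exists_isMinOn
    (NormedSpace.sphere_nonempty.2 zero_le_one) hcont.continuousOn
  have hx0 : x ≠ 0 := by
    rintro rfl
    simp at hx
  refine ⟨_, h x hx0, fun v => ?_⟩
  by_cases hv : v = 0
  · simp [hv]
  have hn : ‖v‖ ≠ 0 := norm_ne_zero_iff.2 hv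
  have h1 : ‖v‖⁻¹ • v ∈ Metric.sphere (0 : F) 1 := by simp [norm_smul, hn]
  have h2 : inner ℝ (B x) (C x) ≤ inner ℝ (B (‖v‖⁻¹ • v)) (C (‖v‖⁻¹ • v)) := hmin h1
  simp only [map_smul, inner_smul_left, inner_smul_right, conj_trivial] at h2
  calc inner ℝ (B x) (C x) * ‖v‖ ^ 2
      ≤ ‖v‖⁻¹ * (‖v‖⁻¹ * inner ℝ (B v) (C v)) * ‖v‖ ^ 2 := by gcongr
    _ = inner ℝ (B v) (C v) := by field_simp

variable {E : Type*} [NormedAddCommGroup E] [NormedSpace ℝ E]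

/-- The integrals over `[0, T]` of the inner products along two linear flows, as a bilinear form. -/
theorem exists_bilinForm_integral {G : Type*} [NormedAddCommGroup G] [InnerProductSpace ℝ G]
    (a b : ℝ → E →L[ℝ] G) (ha : ∀ v, Continuous fun t => a t v)
    (hb : ∀ v, Continuous fun t => b t v) (T : ℝ) :
    ∃ Q : LinearMap.BilinForm ℝ E, ∀ v w, Q v w =
      ∫ t in (0 : ℝ)..T, (inner ℝ (a t v) (a t w) + inner ℝ (b t v) (b t w)) := by
  have hi : ∀ v w, IntervalIntegrable
      (fun t => inner ℝ (a t v) (a t w) + inner ℝ (b t v) (b t w)) volume 0 T := fun v w =>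
    (((ha v).inner (ha w)).add ((hb v).inner (hb w))).intervalIntegrable _ _
  refine ⟨LinearMap.mk₂ ℝ (fun v w =>
    ∫ t in (0 : ℝ)..T, (inner ℝ (a t v) (a t w) + inner ℝ (b t v) (b t w))) ?_ ?_ ?_ ?_,
    fun v w => rfl⟩
  · intro u v w
    rw [← intervalIntegral.integral_add (hi u w) (hi v w)]
    congr 1; ext t
    simp only [map_add, inner_add_left]; ring
  · intro c v w
    rw [smul_eq_mul, ← intervalIntegral.integral_const_mul]
    congr 1; ext t
    simp only [map_smul, real_inner_smul_left]; ring
  · intro u v w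
    rw [← intervalIntegral.integral_add (hi u v) (hi u w)]
    congr 1; ext t
    simp only [map_add, inner_add_right]; ring
  · intro c v w
    rw [smul_eq_mul, ← intervalIntegral.integral_const_mul]
    congr 1; ext t
    simp only [map_smul, real_inner_smul_right]; ring

variable [FiniteDimensional ℝ E]

/-- Here `c` is the distortion of the norm by `e`; it is absorbed by waiting longer. -/
theorem eventually_norm_comp_exp_le_half {G : Type*} [NormedAddCommGroup G] [NormedSpace ℝ G]
    (e : E ≃L[ℝ] G) (A P : E →L[ℝ] E) (hP : ∀ v, P v ∈ stableSpace A) (hPP : ∀ v, P (P v) = P v) :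
    ∀ᶠ t : ℝ in atTop, ∀ v, ‖e (NormedSpace.exp (t • A) (P v))‖ ≤ 1 / 2 * ‖e (P v)‖ := by
  set c := ‖(e : E →L[ℝ] G)‖ * ‖(e.symm : G →L[ℝ] E)‖ with hc
  have hc0 : 0 ≤ c := by positivity
  filter_upwards [eventually_norm_exp_comp_le A P hP (by positivity : 0 < 1 / (2 * (c + 1)))]
    with t ht v
  have h1 := ht (P v)
  rw [hPP] at h1
  have h2 : ‖P v‖ ≤ ‖(e.symm : G →L[ℝ] E)‖ * ‖e (P v)‖ := by
    simpa using (e.symm : G →L[ℝ] E).le_opNorm (e (P v))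
  calc ‖e (NormedSpace.exp (t • A) (P v))‖
      ≤ ‖(e : E →L[ℝ] G)‖ * ‖NormedSpace.exp (t • A) (P v)‖ := (e : E →L[ℝ] G).le_opNorm _
    _ ≤ ‖(e : E →L[ℝ] G)‖ * (1 / (2 * (c + 1)) * (‖(e.symm : G →L[ℝ] E)‖ * ‖e (P v)‖)) := by
        gcongr; exact h1.trans (by gcongr)
    _ = c / (c + 1) * (1 / 2 * ‖e (P v)‖) := by rw [hc]; field_simp
    _ ≤ 1 / 2 * ‖e (P v)‖ := by
        apply mul_le_of_le_one_left (by positivity)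
        rw [div_le_one (by positivity)]; linarith

/-- `Q` is the integral over [0, T] of the inner products of e^{tA}v^s and of e^{-tA}v^u, read
through `e`. Then Q(J₀v, Av) integrates an exact derivative and equals half the decrease of
‖e^{tA}v^s‖² + ‖e^{-tA}v^u‖² from t = 0 to t = T, which is positive once T halves both norms.
Compactness of the unit sphere turns positivity into a rate `lam`. -/
theorem exists_saddleForm {A : E →L[ℝ] E} (h : IsHyperbolicSaddle A) :
    ∃ (R : E ≃L[ℝ] EuclideanSpace ℝ (Fin (Module.finrank ℝ E)))
      (J : EuclideanSpace ℝ (Fin (Module.finrank ℝ E)) →L[ℝ]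
        EuclideanSpace ℝ (Fin (Module.finrank ℝ E))) (lam : ℝ), 0 < lam ∧
      SaddleForm J ((R : E →L[ℝ] _) ∘L A ∘L (R.symm : _ →L[ℝ] E)) lam ∧
      (∃ v, v ≠ 0 ∧ J v = -v) ∧ ∃ v, v ≠ 0 ∧ J v = v := by
  have : CompleteSpace E := FiniteDimensional.complete ℝ E
  let Ps : E →L[ℝ] E :=
    LinearMap.toContinuousLinearMap ((stableSpace A).projection (unstableSpace A) h.isCompl)
  let Pu : E →L[ℝ] E :=
    LinearMap.toContinuousLinearMap ((unstableSpace A).projection (stableSpace A) h.isCompl.symm)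
  have hPs : ∀ v, Ps v ∈ stableSpace A := fun v => Submodule.projection_apply_mem _ v
  have hPu : ∀ v, Pu v ∈ unstableSpace A := fun v => Submodule.projection_apply_mem _ v
  have hPs1 : ∀ v ∈ stableSpace A, Ps v = v := fun v hv =>
    Submodule.projection_apply_of_mem_left h.isCompl hv
  have hPu1 : ∀ v ∈ unstableSpace A, Pu v = v := fun v hv =>
    Submodule.projection_apply_of_mem_left h.isCompl.symm hv
  have hPs0 : ∀ v ∈ unstableSpace A, Ps v = 0 := fun v hv =>
    (Submodule.projection_apply_eq_zero_iff h.isCompl).2 hv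
  have hPu0 : ∀ v ∈ stableSpace A, Pu v = 0 := fun v hv =>
    (Submodule.projection_apply_eq_zero_iff h.isCompl.symm).2 hv
  have hadd : ∀ v, Ps v + Pu v = v := fun v =>
    Submodule.projection_add_projection_eq_self h.isCompl v
  have hPsA : ∀ v, Ps (A v) = A (Ps v) := by
    intro v
    conv_lhs => rw [← hadd v, map_add, map_add, hPs1 _ (map_mem_stableSpace A (hPs v)),
      hPs0 _ (map_mem_unstableSpace A (hPu v)), add_zero]
  have hPuA : ∀ v, Pu (A v) = A (Pu v) := by
    intro v
    conv_lhs => rw [← hadd v, map_add, map_add, hPu0 _ (map_mem_stableSpace A (hPs v)),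
      hPu1 _ (map_mem_unstableSpace A (hPu v)), zero_add]
  let e : E ≃L[ℝ] EuclideanSpace ℝ (Fin (Module.finrank ℝ E)) := toEuclidean
  let a : ℝ → E →L[ℝ] EuclideanSpace ℝ (Fin (Module.finrank ℝ E)) := fun t =>
    (e : E →L[ℝ] _) ∘L NormedSpace.exp (t • A) ∘L Ps
  let b : ℝ → E →L[ℝ] EuclideanSpace ℝ (Fin (Module.finrank ℝ E)) := fun t =>
    (e : E →L[ℝ] _) ∘L NormedSpace.exp (t • (-A)) ∘L Pu
  have ha : ∀ v t, HasDerivAt (fun t => a t v) (a t (A v)) t := by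
    intro v t
    have h1 := hasDerivAt_exp_apply A (Ps v) t
    have h2 := (e : E →L[ℝ] EuclideanSpace ℝ (Fin (Module.finrank ℝ E))).hasFDerivAt.comp_hasDerivAt
      t h1
    change HasDerivAt _ (e (NormedSpace.exp (t • A) (Ps (A v)))) t
    rw [hPsA]; exact h2
  have hb : ∀ v t, HasDerivAt (fun t => b t v) (-(b t (A v))) t := by
    intro v t
    have h1 := hasDerivAt_exp_apply (-A) (Pu v) t
    have h2 := (e : E →L[ℝ] EuclideanSpace ℝ (Fin (Module.finrank ℝ E))).hasFDerivAt.comp_hasDerivAt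
      t h1
    change HasDerivAt _ (-(e (NormedSpace.exp (t • (-A)) (Pu (A v))))) t
    rw [hPuA]
    refine h2.congr_deriv ?_
    simp
  have hac : ∀ v, Continuous fun t => a t v := fun v =>
    continuous_iff_continuousAt.2 fun t => (ha v t).continuousAt
  have hbc : ∀ v, Continuous fun t => b t v := fun v =>
    continuous_iff_continuousAt.2 fun t => (hb v t).continuousAt
  obtain ⟨T, hT0, hTs, hTu⟩ := ((eventually_gt_atTop (0 : ℝ)).and
    ((eventually_norm_comp_exp_le_half e A Ps hPs fun v => hPs1 _ (hPs v)).and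
    (eventually_norm_comp_exp_le_half e (-A) Pu hPu fun v => hPu1 _ (hPu v)))).exists
  obtain ⟨Q, hQ⟩ := exists_bilinForm_integral a b hac hbc T
  have ha0 : ∀ v, a 0 v = e (Ps v) := fun v => by simp [a]
  have hb0 : ∀ v, b 0 v = e (Pu v) := fun v => by simp [b]
  have hpos0 : ∀ v, v ≠ 0 → 0 < ‖a 0 v‖ ^ 2 + ‖b 0 v‖ ^ 2 := by
    intro v hv
    rw [ha0, hb0]
    by_contra hcon
    have h1 : ‖e (Ps v)‖ ^ 2 = 0 := by nlinarith [sq_nonneg ‖e (Ps v)‖, sq_nonneg ‖e (Pu v)‖]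
    have h2 : ‖e (Pu v)‖ ^ 2 = 0 := by nlinarith [sq_nonneg ‖e (Ps v)‖, sq_nonneg ‖e (Pu v)‖]
    simp only [ne_eq, OfNat.ofNat_ne_zero, not_false_eq_true, pow_eq_zero_iff, norm_eq_zero,
      map_eq_zero_iff e e.injective] at h1 h2
    exact hv (by rw [← hadd v, h1, h2, add_zero])
  have hQsymm : ∀ v w, Q v w = Q w v := by
    intro v w
    rw [hQ, hQ]
    congr 1; ext t
    rw [real_inner_comm, real_inner_comm (b t v)]
  have hQpos : ∀ v, v ≠ 0 → 0 < Q v v := by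
    intro v hv
    rw [hQ]
    apply intervalIntegral.integral_pos hT0
    · exact (((hac v).inner (hac v)).add ((hbc v).inner (hbc v))).continuousOn
    · intro t _
      exact add_nonneg real_inner_self_nonneg real_inner_self_nonneg
    · refine ⟨0, left_mem_Icc.2 hT0.le, ?_⟩
      rw [real_inner_self_eq_norm_sq, real_inner_self_eq_norm_sq]
      exact hpos0 v hv
  let J₀ : E →L[ℝ] E := Pu - Ps
  have haJ : ∀ t v, a t (J₀ v) = -a t v := by
    intro t v
    simp [a, J₀, hPs1 _ (hPs v), hPs0 _ (hPu v)]
  have hbJ : ∀ t v, b t (J₀ v) = b t v := by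
    intro t v
    simp [b, J₀, hPu1 _ (hPu v), hPu0 _ (hPs v)]
  have hJA : ∀ v, v ≠ 0 → 0 < Q (J₀ v) (A v) := by
    intro v hv
    -- Both signs agree: `J₀` changes the sign of `a t`, while differentiating `b t` brings a minus
    -- sign of its own.
    have hd : ∀ t, HasDerivAt (fun t => -(1 / 2 : ℝ) * (‖a t v‖ ^ 2 + ‖b t v‖ ^ 2))
        (inner ℝ (a t (J₀ v)) (a t (A v)) + inner ℝ (b t (J₀ v)) (b t (A v))) t := by
      intro t
      refine (((ha v t).norm_sq.add (hb v t).norm_sq).const_mul (-(1 / 2 : ℝ))).congr_deriv ?_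
      rw [haJ, hbJ, inner_neg_left, inner_neg_right]; ring
    rw [hQ, intervalIntegral.integral_eq_sub_of_hasDerivAt (fun t _ => hd t)
      ((((hac _).inner (hac _)).add ((hbc _).inner (hbc _))).intervalIntegrable _ _)]
    have h0 := hpos0 v hv
    have h1 : ‖a T v‖ ≤ 1 / 2 * ‖a 0 v‖ := by rw [ha0]; exact hTs v
    have h2 : ‖b T v‖ ≤ 1 / 2 * ‖b 0 v‖ := by rw [hb0]; exact hTu v
    have h3 : ‖a T v‖ ^ 2 ≤ (1 / 2 * ‖a 0 v‖) ^ 2 := by gcongr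
    have h4 : ‖b T v‖ ^ 2 ≤ (1 / 2 * ‖b 0 v‖) ^ 2 := by gcongr
    nlinarith
  obtain ⟨R₀, hR₀⟩ := exists_euclidean_coordinates Q hQsymm hQpos
  let R : E ≃L[ℝ] EuclideanSpace ℝ (Fin (Module.finrank ℝ E)) := R₀.toContinuousLinearEquiv
  have hR : ∀ v w, inner ℝ (R v) (R w) = Q v w := hR₀
  let J : EuclideanSpace ℝ (Fin (Module.finrank ℝ E)) →L[ℝ]
    EuclideanSpace ℝ (Fin (Module.finrank ℝ E)) := (R : E →L[ℝ] _) ∘L J₀ ∘L (R.symm : _ →L[ℝ] E)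
  have hJ : ∀ v, J v = R (J₀ (R.symm v)) := fun v => rfl
  obtain ⟨s, hs, hs0⟩ := Submodule.exists_mem_ne_zero_of_ne_bot h.stable_ne_bot
  obtain ⟨u, hu, hu0⟩ := Submodule.exists_mem_ne_zero_of_ne_bot h.unstable_ne_bot
  have : Nontrivial (EuclideanSpace ℝ (Fin (Module.finrank ℝ E))) :=
    ⟨⟨R s, 0, by simpa using hs0⟩⟩
  obtain ⟨lam, hlam, hlam'⟩ := exists_pos_mul_sq_norm_le J
    ((R : E →L[ℝ] _) ∘L A ∘L (R.symm : _ →L[ℝ] E)) (fun v hv => by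
      change 0 < inner ℝ (R (J₀ (R.symm v))) (R (A (R.symm v)))
      rw [hR]
      exact hJA _ (by simpa using hv))
  refine ⟨R, J, lam, hlam, ⟨fun v => ?_, fun v w => ?_, fun v => ?_, hlam'⟩,
    ⟨R s, by simpa using hs0, ?_⟩, ⟨R u, by simpa using hu0, ?_⟩⟩
  · rw [hJ, hJ, R.symm_apply_apply]
    have : J₀ (J₀ (R.symm v)) = R.symm v := by
      simp only [J₀, sub_apply, map_sub, hPs1 _ (hPs _), hPs0 _ (hPu _),
        hPu1 _ (hPu _), hPu0 _ (hPs _), sub_zero, zero_sub, sub_neg_eq_add]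
      rw [add_comm, hadd]
    rw [this, R.apply_symm_apply]
  · have h1 : inner ℝ (J v) w = Q (J₀ (R.symm v)) (R.symm w) := by
      rw [← hR, R.apply_symm_apply]; rfl
    have h2 : inner ℝ v (J w) = Q (R.symm v) (J₀ (R.symm w)) := by
      rw [← hR, R.apply_symm_apply]; rfl
    rw [h1, h2, hQ, hQ]
    congr 1; ext t
    rw [haJ, hbJ, haJ, hbJ, inner_neg_left, inner_neg_right]
  · change R (J₀ (R.symm (R (A (R.symm v))))) = R (A (R.symm (R (J₀ (R.symm v)))))
    rw [R.symm_apply_apply, R.symm_apply_apply]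
    congr 1
    simp only [J₀, sub_apply, map_sub, hPsA, hPuA]
  · rw [hJ, R.symm_apply_apply]
    simp [J₀, hPs1 _ hs, hPu0 _ hs]
  · rw [hJ, R.symm_apply_apply]
    simp [J₀, hPu1 _ hu, hPs0 _ hu]

end AdaptedInner

end SingularFlow

namespace SingularFlow

/-! ### The Euler-Lagrange equation of the energy -/

section EulerLagrange

variable {E : Type*} [NormedAddCommGroup E] [NormedSpace ℝ E]

/-- The defect, tested against `w`, of the Euler-Lagrange equation of the energy of the metric `G`
for position `z`, velocity `c` and acceleration `a`. -/
noncomputable def energyDefect (G : E → E →L[ℝ] E →L[ℝ] ℝ) (z c a w : E) : ℝ :=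
  G z a w + fderiv ℝ G z c c w - (1 / 2) * fderiv ℝ G z w c c

set_option synthInstance.maxHeartbeats 200000 in
theorem hasDerivAt_energy_momentum {G : E → E →L[ℝ] E →L[ℝ] ℝ} {u c : ℝ → E} {a : E} {t : ℝ}
    (hG : DifferentiableAt ℝ G (u t)) (hu : HasDerivAt u (c t) t) (hc : HasDerivAt c a t) (w : E) :
    HasDerivAt (fun s => G (u s) (c s) w) (G (u t) a w + fderiv ℝ G (u t) (c t) (c t) w) t := by
  have h1 : HasDerivAt (fun s => G (u s)) (fderiv ℝ G (u t) (c t)) t :=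
    HasFDerivAt.comp_hasDerivAt (F := E) (E := E →L[ℝ] E →L[ℝ] ℝ) (l := G)
      (l' := fderiv ℝ G (u t)) t hG.hasFDerivAt hu
  have h2 := (h1.clm_apply hc).clm_apply (hasDerivAt_const t w)
  refine h2.congr_deriv ?_
  simp [add_comm]

theorem fderiv_energy {G : E → E →L[ℝ] E →L[ℝ] ℝ} {z : E} (hG : DifferentiableAt ℝ G z) (c w : E) :
    fderiv ℝ (fun y => G y c c) z w = fderiv ℝ G z w c c := by
  have h := (hG.hasFDerivAt.clm_apply (hasFDerivAt_const c z)).clm_apply (hasFDerivAt_const c z)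
  rw [h.fderiv]
  simp

/-- Turns the derivative condition in `IsGeodesicOn` into an algebraic equation in position,
velocity and acceleration, on which a change of chart can act. -/
theorem energyDefect_eq_zero_iff {G : E → E →L[ℝ] E →L[ℝ] ℝ} {u : ℝ → E} {t : ℝ}
    (hG : DifferentiableAt ℝ G (u t)) (hu : DifferentiableAt ℝ u t)
    (hc : DifferentiableAt ℝ (deriv u) t) (w : E) :
    HasDerivAt (fun s => G (u s) (deriv u s) w)
      ((1 / 2) * fderiv ℝ (fun z => G z (deriv u t) (deriv u t)) (u t) w) t ↔
    energyDefect G (u t) (deriv u t) (deriv (deriv u) t) w = 0 := by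
  have h1 := hasDerivAt_energy_momentum hG hu.hasDerivAt hc.hasDerivAt w
  rw [fderiv_energy hG, energyDefect, sub_eq_zero]
  constructor
  · intro h
    exact h1.unique h
  · intro h
    exact h1.congr_deriv h

set_option synthInstance.maxHeartbeats 200000 in
/-- The Euler-Lagrange defect is a covector: it does not depend on the coordinates. -/
theorem energyDefect_comp {G G' : E → E →L[ℝ] E →L[ℝ] ℝ} {ψ : E → E} {z : E}
    (hψ : ContDiffAt ℝ 2 ψ z) (hG : DifferentiableAt ℝ G (ψ z))
    (hsymm : ∀ v w, G (ψ z) v w = G (ψ z) w v)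
    (hG' : ∀ᶠ y in 𝓝 z, ∀ v w, G' y v w = G (ψ y) (fderiv ℝ ψ y v) (fderiv ℝ ψ y w))
    (hdG' : DifferentiableAt ℝ G' z) (c a w : E) :
    energyDefect G' z c a w =
      energyDefect G (ψ z) (fderiv ℝ ψ z c)
        (fderiv ℝ ψ z a + fderiv ℝ (fderiv ℝ ψ) z c c) (fderiv ℝ ψ z w) := by
  have h2 : DifferentiableAt ℝ (fderiv ℝ ψ) z :=
    (hψ.fderiv_right (m := 1) (by norm_num)).differentiableAt one_ne_zero
  have hψ1 : DifferentiableAt ℝ ψ z := hψ.differentiableAt two_ne_zero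
  have key : ∀ x v w, fderiv ℝ G' z x v w =
      fderiv ℝ G (ψ z) (fderiv ℝ ψ z x) (fderiv ℝ ψ z v) (fderiv ℝ ψ z w) +
      G (ψ z) (fderiv ℝ (fderiv ℝ ψ) z x v) (fderiv ℝ ψ z w) +
      G (ψ z) (fderiv ℝ ψ z v) (fderiv ℝ (fderiv ℝ ψ) z x w) := by
    intro x v w
    have e1 : HasFDerivAt (fun y => G' y v w) _ z :=
      (hdG'.hasFDerivAt.clm_apply (hasFDerivAt_const v z)).clm_apply (hasFDerivAt_const w z)
    have e2 : HasFDerivAt (fun y => G (ψ y) (fderiv ℝ ψ y v) (fderiv ℝ ψ y w)) _ z :=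
      ((hG.hasFDerivAt.comp z hψ1.hasFDerivAt).clm_apply
        (h2.hasFDerivAt.clm_apply (hasFDerivAt_const v z))).clm_apply
        (h2.hasFDerivAt.clm_apply (hasFDerivAt_const w z))
    have e3 := e1.unique (e2.congr_of_eventuallyEq (hG'.mono fun y hy => hy v w))
    have e4 := congrArg (fun L : E →L[ℝ] ℝ => L x) e3
    simp at e4
    rw [e4]; ring
  -- Symmetry of D²ψ cancels the terms g(Dψ c, D²ψ(c, w)); the remaining term g(D²ψ(c, c), Dψ w) is
  -- the correction of the acceleration.
  have hs : fderiv ℝ (fderiv ℝ ψ) z c w = fderiv ℝ (fderiv ℝ ψ) z w c := by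
    have := hψ.isSymmSndFDerivAt (by simp)
    exact this.eq c w
  unfold energyDefect
  rw [key, key, hG'.self_of_nhds, map_add, add_apply, hs,
    hsymm (fderiv ℝ (fderiv ℝ ψ) z w c) (fderiv ℝ ψ z c)]
  ring

end EulerLagrange

/-! ### Charts -/

section Charts

variable {E : Type*} [NormedAddCommGroup E] [NormedSpace ℝ E]
  {M : Type*} [MetricSpace M] [ChartedSpace E M]

theorem eventually_mem_source_symm {p q x : M} (hp : x ∈ (extChartAt 𝓘(ℝ, E) p).source)
    (hq : x ∈ (extChartAt 𝓘(ℝ, E) q).source) :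
    ∀ᶠ z in 𝓝 (extChartAt 𝓘(ℝ, E) p x), z ∈ (extChartAt 𝓘(ℝ, E) p).target ∧
      (extChartAt 𝓘(ℝ, E) p).symm z ∈ (extChartAt 𝓘(ℝ, E) q).source := by
  have hc := continuousAt_extChartAt_symm' (I := 𝓘(ℝ, E)) hp
  have hn : (extChartAt 𝓘(ℝ, E) q).source ∈
      𝓝 ((extChartAt 𝓘(ℝ, E) p).symm (extChartAt 𝓘(ℝ, E) p x)) := by
    rw [(extChartAt 𝓘(ℝ, E) p).left_inv hp]
    exact (isOpen_extChartAt_source q).mem_nhds hq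
  filter_upwards [extChartAt_target_mem_nhds' (I := 𝓘(ℝ, E))
    ((extChartAt 𝓘(ℝ, E) p).map_source hp), hc.eventually_mem hn] with z h1 h2 using ⟨h1, h2⟩

variable [IsManifold 𝓘(ℝ, E) ∞ M]

theorem symmL_trivializationAt_tangentCoordChange {p q x : M}
    (hp : x ∈ (extChartAt 𝓘(ℝ, E) p).source) (hq : x ∈ (extChartAt 𝓘(ℝ, E) q).source) (v : E) :
    (trivializationAt E (TangentSpace 𝓘(ℝ, E) : M → Type _) p).symmL ℝ x
      (tangentCoordChange 𝓘(ℝ, E) q p x v) =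
    (trivializationAt E (TangentSpace 𝓘(ℝ, E) : M → Type _) q).symmL ℝ x v := by
  have hp' : x ∈ (chartAt E p).source := by simpa using hp
  have hq' : x ∈ (chartAt E q).source := by simpa using hq
  rw [TangentBundle.symmL_trivializationAt_eq_core hp',
    TangentBundle.symmL_trivializationAt_eq_core hq']
  exact tangentCoordChange_comp (E := E) (I := 𝓘(ℝ, E)) (w := q) (x := p) (y := x) (z := x)
    (v := v) ⟨⟨hq, hp⟩, mem_extChartAt_source x⟩

theorem trivializationAt_snd_eq (p x : M) (v : TangentSpace 𝓘(ℝ, E) x) :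
    (trivializationAt E (TangentSpace 𝓘(ℝ, E) : M → Type _) p ⟨x, v⟩).2 =
      tangentCoordChange 𝓘(ℝ, E) x p x v :=
  rfl

theorem hasFDerivAt_transition {p q x : M} (hp : x ∈ (extChartAt 𝓘(ℝ, E) p).source)
    (hq : x ∈ (extChartAt 𝓘(ℝ, E) q).source) :
    HasFDerivAt (extChartAt 𝓘(ℝ, E) q ∘ (extChartAt 𝓘(ℝ, E) p).symm)
      (tangentCoordChange 𝓘(ℝ, E) p q x) (extChartAt 𝓘(ℝ, E) p x) := by
  have := hasFDerivWithinAt_tangentCoordChange (I := 𝓘(ℝ, E)) ⟨hp, hq⟩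
  rwa [modelWithCornersSelf_coe, range_id, hasFDerivWithinAt_univ] at this

theorem contDiffAt_transition {p q x : M} (hp : x ∈ (extChartAt 𝓘(ℝ, E) p).source)
    (hq : x ∈ (extChartAt 𝓘(ℝ, E) q).source) :
    ContDiffAt ℝ ∞ (extChartAt 𝓘(ℝ, E) q ∘ (extChartAt 𝓘(ℝ, E) p).symm)
      (extChartAt 𝓘(ℝ, E) p x) := by
  have h1 : ContMDiffAt 𝓘(ℝ, E) 𝓘(ℝ, E) ∞ (extChartAt 𝓘(ℝ, E) p).symm (extChartAt 𝓘(ℝ, E) p x) :=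
    (contMDiffOn_extChartAt_symm p).contMDiffAt
      (extChartAt_target_mem_nhds' ((extChartAt 𝓘(ℝ, E) p).map_source hp))
  have h2 : ContMDiffAt 𝓘(ℝ, E) 𝓘(ℝ, E) ∞ (extChartAt 𝓘(ℝ, E) q)
      ((extChartAt 𝓘(ℝ, E) p).symm (extChartAt 𝓘(ℝ, E) p x)) := by
    rw [(extChartAt 𝓘(ℝ, E) p).left_inv hp]
    exact contMDiffAt_extChartAt' (by simpa using hq)
  exact contMDiffAt_iff_contDiffAt.1 (h2.comp _ h1)

theorem tangentCoordChange_inv {p q x : M} (hp : x ∈ (extChartAt 𝓘(ℝ, E) p).source)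
    (hq : x ∈ (extChartAt 𝓘(ℝ, E) q).source) (v : E) :
    tangentCoordChange 𝓘(ℝ, E) q p x (tangentCoordChange 𝓘(ℝ, E) p q x v) = v := by
  rw [tangentCoordChange_comp (I := 𝓘(ℝ, E)) ⟨⟨hp, hq⟩, hp⟩, tangentCoordChange_self hp]

/-- The derivative at `x` of the transition from the chart at `p` to the chart at `q`. -/
noncomputable def transitionEquiv {p q x : M} (hp : x ∈ (extChartAt 𝓘(ℝ, E) p).source)
    (hq : x ∈ (extChartAt 𝓘(ℝ, E) q).source) : E ≃L[ℝ] E :=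
  ContinuousLinearEquiv.equivOfInverse (tangentCoordChange 𝓘(ℝ, E) p q x)
    (tangentCoordChange 𝓘(ℝ, E) q p x) (tangentCoordChange_inv hp hq) (tangentCoordChange_inv hq hp)

end Charts

section MetricForm

variable {E : Type*} [NormedAddCommGroup E] [NormedSpace ℝ E]
  {M : Type*} [MetricSpace M] [ChartedSpace E M] [IsManifold 𝓘(ℝ, E) ∞ M]
  [RiemannianBundle (fun x : M => TangentSpace 𝓘(ℝ, E) x)]

theorem metricRep_tangentCoordChange {p q x : M} (hp : x ∈ (extChartAt 𝓘(ℝ, E) p).source)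
    (hq : x ∈ (extChartAt 𝓘(ℝ, E) q).source) (v w : E) :
    metricRep q (extChartAt 𝓘(ℝ, E) q x) v w = metricRep p (extChartAt 𝓘(ℝ, E) p x)
      (tangentCoordChange 𝓘(ℝ, E) q p x v) (tangentCoordChange 𝓘(ℝ, E) q p x w) := by
  unfold metricRep
  rw [(extChartAt 𝓘(ℝ, E) q).left_inv hq, (extChartAt 𝓘(ℝ, E) p).left_inv hp]
  simp only [symmL_trivializationAt_tangentCoordChange hp hq]

/-- The metric in the chart at `p`, as a continuous bilinear form. -/
noncomputable def metricForm (p : M) (z : E) : E →L[ℝ] E →L[ℝ] ℝ :=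
  let e := trivializationAt E (TangentSpace 𝓘(ℝ, E) : M → Type _) p
  let x := (extChartAt 𝓘(ℝ, E) p).symm z
  (innerSL ℝ (E := TangentSpace 𝓘(ℝ, E) x)).bilinearComp (e.symmL ℝ x) (e.symmL ℝ x)

theorem metricForm_apply (p : M) (z v w : E) : metricForm p z v w = metricRep p z v w := rfl

theorem metricForm_symm (p : M) (z v w : E) : metricForm p z v w = metricForm p z w v :=
  real_inner_comm (F := TangentSpace 𝓘(ℝ, E) ((extChartAt 𝓘(ℝ, E) p).symm z)) _ _

theorem metricForm_pos {p : M} {z : E} (hz : z ∈ (extChartAt 𝓘(ℝ, E) p).target) {v : E}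
    (hv : v ≠ 0) : 0 < metricForm p z v v := by
  have hx : (extChartAt 𝓘(ℝ, E) p).symm z ∈
      (trivializationAt E (TangentSpace 𝓘(ℝ, E) : M → Type _) p).baseSet := by
    have := (extChartAt 𝓘(ℝ, E) p).map_target hz
    simpa using this
  refine (real_inner_self_pos (F := TangentSpace 𝓘(ℝ, E) ((extChartAt 𝓘(ℝ, E) p).symm z))).2
    fun h => hv ?_
  have := (trivializationAt E (TangentSpace 𝓘(ℝ, E) : M → Type _) p).continuousLinearMapAt_symmL
    (R := ℝ) hx v
  refine this.symm.trans (Eq.trans (congrArg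
    ((trivializationAt E (TangentSpace 𝓘(ℝ, E) : M → Type _) p).continuousLinearMapAt ℝ
      ((extChartAt 𝓘(ℝ, E) p).symm z)) h) (map_zero _))

variable [IsContMDiffRiemannianBundle 𝓘(ℝ, E) ∞ E (fun x : M => TangentSpace 𝓘(ℝ, E) x)]

theorem contDiffOn_metricRep (p : M) (v w : E) :
    ContDiffOn ℝ ∞ (fun z => metricRep p z v w) (extChartAt 𝓘(ℝ, E) p).target := by
  rw [← contMDiffOn_iff_contDiffOn]
  have h0 : ∀ v : E, ContMDiffOn 𝓘(ℝ, E) (𝓘(ℝ, E).prod 𝓘(ℝ, E)) ∞ (fun z : E =>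
      (⟨(extChartAt 𝓘(ℝ, E) p).symm z,
        (trivializationAt E (TangentSpace 𝓘(ℝ, E) : M → Type _) p).symmL ℝ
          ((extChartAt 𝓘(ℝ, E) p).symm z) v⟩ : TangentBundle 𝓘(ℝ, E) M))
      (extChartAt 𝓘(ℝ, E) p).target := by
    intro v
    have : IsManifold 𝓘(ℝ, E) ((∞ : WithTop ℕ∞) + 1) M := by
      simpa using (inferInstance : IsManifold 𝓘(ℝ, E) ∞ M)
    have h1 : ContMDiffOn 𝓘(ℝ, E) 𝓘(ℝ, E) ∞ (extChartAt 𝓘(ℝ, E) p).symm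
      (extChartAt 𝓘(ℝ, E) p).target := contMDiffOn_extChartAt_symm p
    have hx : ∀ y ∈ (extChartAt 𝓘(ℝ, E) p).target, (extChartAt 𝓘(ℝ, E) p).symm y ∈
        (trivializationAt E (TangentSpace 𝓘(ℝ, E) : M → Type _) p).baseSet := by
      intro y hy
      have := (extChartAt 𝓘(ℝ, E) p).map_target hy
      simpa using this
    have hv : ∀ y ∈ (extChartAt 𝓘(ℝ, E) p).target,
        (trivializationAt E (TangentSpace 𝓘(ℝ, E) : M → Type _) p
          ⟨(extChartAt 𝓘(ℝ, E) p).symm y,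
            (trivializationAt E (TangentSpace 𝓘(ℝ, E) : M → Type _) p).symmL ℝ
              ((extChartAt 𝓘(ℝ, E) p).symm y) v⟩).2 = v := by
      intro y hy
      rw [Trivialization.symmL_apply _ (hx y hy)]
      exact congrArg Prod.snd ((trivializationAt E (TangentSpace 𝓘(ℝ, E) : M → Type _)
        p).apply_mk_symm (hx y hy) v)
    intro z hz
    rw [(trivializationAt E (TangentSpace 𝓘(ℝ, E) : M → Type _) p).contMDiffWithinAt_iff]
    · exact ⟨h1 z hz, (contMDiffWithinAt_const (c := v)).congr hv (hv z hz)⟩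
    · rw [Trivialization.mem_source]; exact hx z hz
  intro z hz
  exact ContMDiffWithinAt.inner_bundle (h0 v z hz) (h0 w z hz)

variable [FiniteDimensional ℝ E]

theorem contDiffOn_metricForm (p : M) :
    ContDiffOn ℝ ∞ (metricForm p) (extChartAt 𝓘(ℝ, E) p).target := by
  rw [contDiffOn_clm_apply]
  intro v
  rw [contDiffOn_clm_apply]
  exact contDiffOn_metricRep p v

theorem contDiffAt_metricForm {p : M} {z : E} (hz : z ∈ (extChartAt 𝓘(ℝ, E) p).target) :
    ContDiffAt ℝ ∞ (metricForm p) z :=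
  (contDiffOn_metricForm p).contDiffAt ((isOpen_extChartAt_target p).mem_nhds hz)

theorem differentiableAt_metricForm {p : M} {z : E} (hz : z ∈ (extChartAt 𝓘(ℝ, E) p).target) :
    DifferentiableAt ℝ (metricForm p) z :=
  (contDiffAt_metricForm hz).differentiableAt (by simp)

/-- The geodesic equation at one time may be tested in any chart. -/
theorem geodesic_equation_iff {p q : M} {γ : ℝ → M} {t : ℝ}
    (hp : γ t ∈ (extChartAt 𝓘(ℝ, E) p).source) (hq : γ t ∈ (extChartAt 𝓘(ℝ, E) q).source)
    (hγ : ContMDiffAt 𝓘(ℝ, ℝ) 𝓘(ℝ, E) 2 γ t) :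
    (∀ w, energyDefect (metricForm p) (extChartAt 𝓘(ℝ, E) p (γ t))
      (deriv (fun s => extChartAt 𝓘(ℝ, E) p (γ s)) t)
      (deriv (deriv fun s => extChartAt 𝓘(ℝ, E) p (γ s)) t) w = 0) ↔
    ∀ w, energyDefect (metricForm q) (extChartAt 𝓘(ℝ, E) q (γ t))
      (deriv (fun s => extChartAt 𝓘(ℝ, E) q (γ s)) t)
      (deriv (deriv fun s => extChartAt 𝓘(ℝ, E) q (γ s)) t) w = 0 := by
  set ψ := extChartAt 𝓘(ℝ, E) q ∘ (extChartAt 𝓘(ℝ, E) p).symm with hψdef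
  set u : ℝ → E := fun s => extChartAt 𝓘(ℝ, E) p (γ s) with hu
  set y : ℝ → E := fun s => extChartAt 𝓘(ℝ, E) q (γ s) with hy
  have hψ : ContDiffAt ℝ ∞ ψ (u t) := contDiffAt_transition hp hq
  have hψ2 : ContDiffAt ℝ 2 ψ (u t) := hψ.of_le (by decide)
  have hψt : ψ (u t) = y t := by
    simp only [hψdef, hu, hy, Function.comp_apply, (extChartAt 𝓘(ℝ, E) p).left_inv hp]
  have hu2 : ContDiffAt ℝ 2 u t := by
    rw [← contMDiffAt_iff_contDiffAt]
    exact ContMDiffAt.comp t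
      ((contMDiffAt_extChartAt' (I := 𝓘(ℝ, E)) (n := 2) (x := p) (by simpa using hp))) hγ
  have hc2 : ContDiffAt ℝ 1 (deriv u) t := by
    have h1 : ContDiffAt ℝ 1 (fderiv ℝ u) t := hu2.fderiv_right (by norm_num)
    have h2 := h1.clm_apply (contDiffAt_const (c := (1 : ℝ)))
    exact h2
  have hev : ∀ᶠ s in 𝓝 t, y s = ψ (u s) := by
    have := hγ.continuousAt.eventually_mem ((isOpen_extChartAt_source (I := 𝓘(ℝ, E)) p).mem_nhds hp)
    filter_upwards [this] with s hs
    simp only [hψdef, hu, hy, Function.comp_apply, (extChartAt 𝓘(ℝ, E) p).left_inv hs]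
  have hd1 : ∀ᶠ s in 𝓝 t, deriv y s = fderiv ℝ ψ (u s) (deriv u s) := by
    have e1 : ∀ᶠ s in 𝓝 t, DifferentiableAt ℝ u s :=
      (hu2.eventually (by simp)).mono fun s hs => hs.differentiableAt two_ne_zero
    have e2 : ∀ᶠ s in 𝓝 t, DifferentiableAt ℝ ψ (u s) :=
      hu2.continuousAt.eventually
        ((hψ2.eventually (by simp)).mono fun s hs => hs.differentiableAt two_ne_zero)
    filter_upwards [e1, e2, hev.eventually_nhds] with s h1 h2 h3
    have h4 : HasDerivAt (fun s => ψ (u s)) (fderiv ℝ ψ (u s) (deriv u s)) s :=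
      h2.hasFDerivAt.comp_hasDerivAt s h1.hasDerivAt
    exact (h4.congr_of_eventuallyEq h3).deriv
  have hd2 : deriv (deriv y) t =
      fderiv ℝ ψ (u t) (deriv (deriv u) t) + fderiv ℝ (fderiv ℝ ψ) (u t) (deriv u t) (deriv u t) := by
    have e1 : HasFDerivAt (fderiv ℝ ψ) (fderiv ℝ (fderiv ℝ ψ) (u t)) (u t) :=
      ((hψ2.fderiv_right (m := 1) (by norm_num)).differentiableAt one_ne_zero).hasFDerivAt
    have e2 := (e1.comp_hasDerivAt t (hu2.differentiableAt two_ne_zero).hasDerivAt).clm_apply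
      (hc2.differentiableAt one_ne_zero).hasDerivAt
    rw [(e2.congr_of_eventuallyEq hd1).deriv, add_comm, Function.comp_apply]
  have hT : fderiv ℝ ψ (u t) = tangentCoordChange 𝓘(ℝ, E) p q (γ t) :=
    (hasFDerivAt_transition hp hq).fderiv
  have hmet : ∀ᶠ z in 𝓝 (u t), ∀ v w, metricForm p z v w =
      metricForm q (ψ z) (fderiv ℝ ψ z v) (fderiv ℝ ψ z w) := by
    filter_upwards [eventually_mem_source_symm hp hq] with z hz v w
    have h1 := (extChartAt 𝓘(ℝ, E) p).map_target hz.1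
    have h2 := hasFDerivAt_transition h1 hz.2
    have h3 := metricRep_tangentCoordChange hz.2 h1 v w
    rw [(extChartAt 𝓘(ℝ, E) p).right_inv hz.1] at h2 h3
    rw [metricForm_apply, h3, metricForm_apply, h2.fderiv]
    rfl
  have hmain := fun w => energyDefect_comp (G := metricForm q) (G' := metricForm p) hψ2
    (by rw [hψt]; exact differentiableAt_metricForm ((extChartAt 𝓘(ℝ, E) q).map_source hq))
    (metricForm_symm _ _) hmet
    (differentiableAt_metricForm ((extChartAt 𝓘(ℝ, E) p).map_source hp)) (deriv u t)
    (deriv (deriv u) t) w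
  change (∀ w, energyDefect (metricForm p) (u t) (deriv u t) (deriv (deriv u) t) w = 0) ↔
    ∀ w, energyDefect (metricForm q) (y t) (deriv y t) (deriv (deriv y) t) w = 0
  rw [hd2, hd1.self_of_nhds]
  simp only [hmain, hψt]
  -- The derivative of the transition is invertible, so test vectors in one chart are exactly the
  -- images of test vectors in the other.
  constructor
  · intro h w
    have := h (tangentCoordChange 𝓘(ℝ, E) q p (γ t) w)
    rwa [hT, tangentCoordChange_inv hq hp, ← hT] at this
  · intro h w
    exact h _

/-- The definition uses the chart at the moving point `γ t`; in one fixed chart the condition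
becomes an ordinary differential equation. -/
theorem isGeodesicOn_iff {q : M} {γ : ℝ → M} {J : Set ℝ} (hJ : IsOpen J)
    (hq : ∀ t ∈ J, γ t ∈ (extChartAt 𝓘(ℝ, E) q).source) (hγ : ContMDiffOn 𝓘(ℝ, ℝ) 𝓘(ℝ, E) 2 γ J) :
    IsGeodesicOn (E := E) γ J ↔
      ∀ t ∈ J, ∀ w, energyDefect (metricForm q) (extChartAt 𝓘(ℝ, E) q (γ t))
        (deriv (fun s => extChartAt 𝓘(ℝ, E) q (γ s)) t)
        (deriv (deriv fun s => extChartAt 𝓘(ℝ, E) q (γ s)) t) w = 0 := by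
  unfold IsGeodesicOn
  rw [and_iff_right hγ]
  refine forall₂_congr fun t ht => ?_
  have hγt : ContMDiffAt 𝓘(ℝ, ℝ) 𝓘(ℝ, E) 2 γ t := hγ.contMDiffAt (hJ.mem_nhds ht)
  rw [← geodesic_equation_iff (mem_extChartAt_source (I := 𝓘(ℝ, E)) (γ t)) (hq t ht) hγt]
  refine forall_congr' fun w => ?_
  have hu2 : ContDiffAt ℝ 2 (fun s => extChartAt 𝓘(ℝ, E) (γ t) (γ s)) t := by
    rw [← contMDiffAt_iff_contDiffAt]
    exact ContMDiffAt.comp t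
      ((contMDiffAt_extChartAt' (I := 𝓘(ℝ, E)) (n := 2) (x := γ t) (by simp))) hγt
  have hc2 : ContDiffAt ℝ 1 (deriv fun s => extChartAt 𝓘(ℝ, E) (γ t) (γ s)) t := by
    have h1 : ContDiffAt ℝ 1 (fderiv ℝ fun s => extChartAt 𝓘(ℝ, E) (γ t) (γ s)) t :=
      hu2.fderiv_right (by norm_num)
    exact h1.clm_apply (contDiffAt_const (c := (1 : ℝ)))
  exact energyDefect_eq_zero_iff (G := metricForm (γ t))
    (differentiableAt_metricForm (mem_extChartAt_target _))
    (hu2.differentiableAt two_ne_zero) (hc2.differentiableAt one_ne_zero) w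

end MetricForm

end SingularFlow

namespace SingularFlow

/-! ### Second order equations with quadratic right-hand side -/

section QuadraticODE

variable {E : Type*} [NormedAddCommGroup E] [NormedSpace ℝ E]

/-- `Γ` is quadratic in the velocity, and Lipschitz near `z₀`, with the natural scaling. -/
structure IsSpray (Γ : E → E → E) (z₀ : E) (ρ K : ℝ) : Prop where
  pos : 0 < ρ
  le_one : ρ ≤ 1
  nonneg : 0 ≤ K
  homogeneous : ∀ (c : ℝ) (z v : E), Γ z (c • v) = c ^ 2 • Γ z v
  lipschitz : ∀ η > 0, ∀ z ∈ Metric.closedBall z₀ ρ, ∀ z' ∈ Metric.closedBall z₀ ρ, ∀ v v',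
    ‖v‖ ≤ η → ‖v'‖ ≤ η → ‖Γ z v - Γ z' v'‖ ≤ K * η ^ 2 * ‖z - z'‖ + K * η * ‖v - v'‖

/-- Homogeneity reduces speeds up to η to speeds up to a fixed `r`, where C¹ regularity gives one
Lipschitz constant. Undoing the scaling produces the factors η² and η. -/
theorem exists_isSpray {Γ : E → E → E} {z₀ : E}
    (hh : ∀ (c : ℝ) (z v : E), Γ z (c • v) = c ^ 2 • Γ z v)
    (hΓ : ContDiffAt ℝ 1 (fun x : E × E => Γ x.1 x.2) (z₀, 0)) :
    ∃ ρ₀ > 0, ∃ K, ∀ ρ, 0 < ρ → ρ ≤ ρ₀ → IsSpray Γ z₀ ρ K := by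
  obtain ⟨K, s, hs, hL⟩ := hΓ.exists_lipschitzOnWith
  obtain ⟨r, hr, hrs⟩ := Metric.nhds_basis_closedBall.mem_iff.1 hs
  set K' : ℝ := K / r ^ 2 + K / r with hK'
  have hK0 : 0 ≤ K' := by positivity
  refine ⟨min r 1, by positivity, K', fun ρ hρ hρ' => ⟨hρ, hρ'.trans (min_le_right _ _), hK0, hh, ?_⟩⟩
  intro η hη z hz z' hz' v v' hv hv'
  have hsc : ∀ v : E, Γ z v = (η / r) ^ 2 • Γ z ((r / η) • v) ∧
      Γ z' v = (η / r) ^ 2 • Γ z' ((r / η) • v) := by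
    intro v
    rw [hh, hh, smul_smul, smul_smul, ← mul_pow]
    have : η / r * (r / η) = 1 := by field_simp
    simp [this]
  have hmem : ∀ z ∈ Metric.closedBall z₀ ρ, ∀ v : E, ‖v‖ ≤ η → (z, (r / η) • v) ∈ s := by
    intro z hz v hv
    apply hrs
    rw [Metric.mem_closedBall, Prod.dist_eq]
    refine max_le (le_trans hz (hρ'.trans (min_le_left _ _))) ?_
    simp only [dist_zero_right, norm_smul, norm_div, Real.norm_eq_abs, abs_of_pos hr, abs_of_pos hη]
    rw [div_mul_eq_mul_div, div_le_iff₀ hη]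
    gcongr
  have h1 := hL.dist_le_mul _ (hmem z hz v hv) _ (hmem z' hz' v' hv')
  rw [(hsc v).1, (hsc v').2, ← smul_sub, norm_smul]
  rw [dist_eq_norm, Prod.dist_eq, dist_eq_norm, dist_eq_norm, ← smul_sub, norm_smul] at h1
  have h2 : max ‖z - z'‖ (‖r / η‖ * ‖v - v'‖) ≤ ‖z - z'‖ + r / η * ‖v - v'‖ := by
    have : ‖r / η‖ = r / η := by rw [Real.norm_eq_abs, abs_of_pos (by positivity)]
    rw [this]
    exact max_le (le_add_of_nonneg_right (by positivity)) (le_add_of_nonneg_left (by positivity))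
  have h3 : ‖(η / r) ^ 2‖ = (η / r) ^ 2 := by rw [Real.norm_eq_abs, abs_of_pos (by positivity)]
  rw [h3]
  calc (η / r) ^ 2 * ‖Γ z ((r / η) • v) - Γ z' ((r / η) • v')‖
      ≤ (η / r) ^ 2 * (K * (‖z - z'‖ + r / η * ‖v - v'‖)) := by
        gcongr; exact h1.trans (by gcongr)
    _ = K / r ^ 2 * η ^ 2 * ‖z - z'‖ + K / r * η * ‖v - v'‖ := by field_simp
    _ ≤ K' * η ^ 2 * ‖z - z'‖ + K' * η * ‖v - v'‖ := by
        have e1 : (K : ℝ) / r ^ 2 ≤ K' := by rw [hK']; simp; positivity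
        have e2 : (K : ℝ) / r ≤ K' := by rw [hK']; simp; positivity
        gcongr

variable {Γ : E → E → E} {z₀ : E} {ρ K : ℝ}

theorem IsSpray.norm_le (h : IsSpray Γ z₀ ρ K) {η : ℝ} (hη : 0 < η) {z v : E}
    (hz : z ∈ Metric.closedBall z₀ ρ) (hv : ‖v‖ ≤ η) : ‖Γ z v‖ ≤ K * η * ‖v‖ := by
  have h0 : Γ z 0 = 0 := by simpa using h.homogeneous 0 z 0
  have := h.lipschitz η hη z hz z hz v 0 hv (by simpa using hη.le)
  simpa [h0] using this

/-- `u` is a solution of `u'' = Γ(u, u')` on `J` with velocity `c`, near `z₀` and of speed at most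
`2 η`. -/
def IsSlowSolution (Γ : E → E → E) (z₀ : E) (ρ η : ℝ) (u c : ℝ → E) (J : Set ℝ) : Prop :=
  ∀ t ∈ J, HasDerivAt u (c t) t ∧ HasDerivAt c (Γ (u t) (c t)) t ∧
    u t ∈ Metric.closedBall z₀ ρ ∧ ‖c t‖ ≤ 2 * η

theorem IsSlowSolution.mono {η : ℝ} {u c : ℝ → E} {J J' : Set ℝ}
    (h : IsSlowSolution Γ z₀ ρ η u c J) (hJ : J' ⊆ J) : IsSlowSolution Γ z₀ ρ η u c J' :=
  fun t ht => h t (hJ ht)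

/-- With the velocity written as δ x₂, δ = 2η/ρ, the system is δ times a bounded Lipschitz field on
the ball of radius ρ, and the initial point lies in the ball of radius ρ/2. Small η makes the motion
slow enough to stay in the larger ball on (-2, 2), an open interval containing [0, 1]. -/
theorem IsSpray.exists_solution [CompleteSpace E] (h : IsSpray Γ z₀ ρ K) {η : ℝ} (hη : 0 < η)
    (hη' : η ≤ ρ ^ 2 / (8 * (1 + K))) {p v : E} (hp : p ∈ Metric.closedBall z₀ (ρ / 2))
    (hv : ‖v‖ ≤ η) :
    ∃ u c : ℝ → E, u 0 = p ∧ c 0 = v ∧ IsSlowSolution Γ z₀ ρ η u c (Ioo (-2) 2) := by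
  have hρ := h.pos
  have hK := h.nonneg
  set δ : ℝ := 2 * η / ρ with hδ
  have hδ0 : 0 < δ := by positivity
  have hδρ : δ * ρ = 2 * η := by rw [hδ]; field_simp
  let X : E × E → E × E := fun x => (δ • x.2, δ • Γ x.1 x.2)
  have hball : ∀ x ∈ Metric.closedBall ((z₀, 0) : E × E) ρ,
      x.1 ∈ Metric.closedBall z₀ ρ ∧ ‖x.2‖ ≤ ρ := by
    intro x hx
    rw [Metric.mem_closedBall, Prod.dist_eq, max_le_iff] at hx
    exact ⟨hx.1, by simpa using hx.2⟩
  have hLip : ∀ x ∈ Metric.closedBall ((z₀, 0) : E × E) ρ,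
      ∀ y ∈ Metric.closedBall ((z₀, 0) : E × E) ρ, ‖X x - X y‖ ≤ δ * (1 + 2 * K) * ‖x - y‖ := by
    intro x hx y hy
    have e1 : ‖x.1 - y.1‖ ≤ ‖x - y‖ := norm_fst_le (x - y)
    have e2 : ‖x.2 - y.2‖ ≤ ‖x - y‖ := norm_snd_le (x - y)
    have e3 := h.lipschitz ρ hρ _ (hball x hx).1 _ (hball y hy).1 _ _ (hball x hx).2 (hball y hy).2
    have e4 : K * ρ ^ 2 * ‖x.1 - y.1‖ ≤ K * 1 * ‖x - y‖ := by
      gcongr; exact pow_le_one₀ hρ.le h.le_one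
    have e5 : K * ρ * ‖x.2 - y.2‖ ≤ K * 1 * ‖x - y‖ := by
      gcongr; exact h.le_one
    rw [Prod.norm_def]
    refine max_le ?_ ?_
    · change ‖δ • x.2 - δ • y.2‖ ≤ _
      rw [← smul_sub, norm_smul, Real.norm_eq_abs, abs_of_pos hδ0]
      nlinarith [mul_nonneg hδ0.le (sub_nonneg.2 e2), norm_nonneg (x - y),
        mul_nonneg (mul_nonneg hδ0.le hK) (norm_nonneg (x - y))]
    · change ‖δ • Γ x.1 x.2 - δ • Γ y.1 y.2‖ ≤ _
      rw [← smul_sub, norm_smul, Real.norm_eq_abs, abs_of_pos hδ0, mul_assoc]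
      gcongr
      linarith [norm_nonneg (x - y)]
  have hX0 : X (z₀, 0) = 0 := by
    have h0 : Γ z₀ 0 = 0 := by simpa using h.homogeneous 0 z₀ 0
    simp [X, h0]
  have hbound : ∀ x ∈ Metric.closedBall ((z₀, 0) : E × E) ρ, ‖X x‖ ≤ δ * (1 + K) * ρ := by
    intro x hx
    have e1 := h.norm_le hρ (hball x hx).1 (hball x hx).2
    have e2 : K * ρ * ‖x.2‖ ≤ K * 1 * ρ := by
      gcongr
      · exact h.le_one
      · exact (hball x hx).2
    rw [Prod.norm_def]
    refine max_le ?_ ?_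
    · change ‖δ • x.2‖ ≤ _
      rw [norm_smul, Real.norm_eq_abs, abs_of_pos hδ0, mul_assoc]
      gcongr
      nlinarith [(hball x hx).2]
    · change ‖δ • Γ x.1 x.2‖ ≤ _
      rw [norm_smul, Real.norm_eq_abs, abs_of_pos hδ0, mul_assoc]
      gcongr
      nlinarith
  have hPL : IsPicardLindelof (fun _ => X) (tmin := -2) (tmax := 2) ⟨0, by norm_num⟩
      ((z₀, 0) : E × E) (Real.toNNReal ρ) (Real.toNNReal (ρ / 2))
      (Real.toNNReal (δ * (1 + K) * ρ)) (Real.toNNReal (δ * (1 + 2 * K))) := by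
    apply IsPicardLindelof.of_time_independent
    · intro x hx
      rw [Real.coe_toNNReal _ hρ.le] at hx
      rw [Real.coe_toNNReal _ (by positivity)]
      exact hbound x hx
    · rw [Real.coe_toNNReal _ hρ.le]
      apply LipschitzOnWith.of_dist_le_mul
      intro x hx y hy
      rw [Real.coe_toNNReal _ (by positivity), dist_eq_norm, dist_eq_norm]
      exact hLip x hx y hy
    · rw [Real.coe_toNNReal _ hρ.le, Real.coe_toNNReal _ (by positivity),
        Real.coe_toNNReal _ (by positivity)]
      have : δ * (1 + K) * ρ ≤ ρ ^ 2 / 4 := by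
        rw [le_div_iff₀ (by positivity)] at hη'
        have : δ * (1 + K) * ρ = 2 * η * (1 + K) := by rw [← hδρ]; ring
        rw [this]; nlinarith
      have h2 : ρ ^ 2 ≤ ρ := by nlinarith [h.le_one]
      norm_num
      linarith
  have hx₀ : ((p, δ⁻¹ • v) : E × E) ∈
      Metric.closedBall ((z₀, 0) : E × E) (Real.toNNReal (ρ / 2)) := by
    rw [Real.coe_toNNReal _ (by positivity), Metric.mem_closedBall, Prod.dist_eq]
    refine max_le hp ?_
    simp only [dist_zero_right, norm_smul, norm_inv, Real.norm_eq_abs, abs_of_pos hδ0]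
    rw [inv_mul_le_iff₀ hδ0]
    linarith
  obtain ⟨α, hα⟩ := ODE.FunSpace.exists_isFixedPt_next hPL hx₀
  have hmem : ∀ t, α.compProj t ∈ Metric.closedBall ((z₀, 0) : E × E) ρ := by
    intro t
    have := α.compProj_mem_closedBall hPL.mul_max_le (t := t)
    rwa [Real.coe_toNNReal _ hρ.le] at this
  obtain ⟨β, hβ0, hd, hβmem⟩ : ∃ β : ℝ → E × E, β 0 = (p, δ⁻¹ • v) ∧
      (∀ t ∈ Ioo (-2 : ℝ) 2, HasDerivAt β (X (β t)) t) ∧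
      ∀ t, β t ∈ Metric.closedBall ((z₀, 0) : E × E) ρ := by
    refine ⟨α.compProj, ?_, fun t ht => ?_, hmem⟩
    · have := α.compProj_val (t := ⟨0, by norm_num⟩)
      rw [this, ← hα, ODE.FunSpace.next_apply₀]
    · have ht' : t ∈ Icc (-2 : ℝ) 2 := Ioo_subset_Icc_self ht
      have h1 : HasDerivWithinAt α.compProj (X (α.compProj t)) (Icc (-2) 2) t := by
        apply (ODE.hasDerivWithinAt_picard_Icc (t₀ := (0 : ℝ)) (by norm_num)
          hPL.continuousOn_uncurry α.continuous_compProj.continuousOn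
          (fun _ _ => α.compProj_mem_closedBall hPL.mul_max_le) (p, δ⁻¹ • v)
          ht').congr_of_mem _ ht'
        intro t' ht'
        rw [ODE.FunSpace.compProj_of_mem ht']
        nth_rw 1 [← hα]
        rfl
      exact h1.hasDerivAt (Icc_mem_nhds ht.1 ht.2)
  refine ⟨fun t => (β t).1, fun t => δ • (β t).2, ?_, ?_, fun t ht => ?_⟩
  · simp [hβ0]
  · simp [hβ0, smul_smul, hδ0.ne']
  · have h1 := hd t ht
    have e1 : HasDerivAt (fun t => (β t).1) (δ • (β t).2) t :=
      (ContinuousLinearMap.fst ℝ E E).hasFDerivAt.comp_hasDerivAt t h1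
    have e2 : HasDerivAt (fun t => (β t).2) (δ • Γ (β t).1 (β t).2) t :=
      (ContinuousLinearMap.snd ℝ E E).hasFDerivAt.comp_hasDerivAt t h1
    refine ⟨e1, ?_, (hball _ (hβmem t)).1, ?_⟩
    · rw [h.homogeneous]
      refine (e2.const_smul δ).congr_deriv ?_
      rw [smul_smul, sq]
    · rw [norm_smul, Real.norm_eq_abs, abs_of_pos hδ0, ← hδρ]
      gcongr
      exact (hball _ (hβmem t)).2

/-- Two slow solutions with the same initial point differ, up to a small relative error, by the
difference of the initial velocities. -/
theorem IsSpray.norm_sub_le (h : IsSpray Γ z₀ ρ K) {η : ℝ} (hη : 0 < η) (hη1 : η ≤ 1 / 4)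
    (hKη : 6 * K * η ≤ 1) {τ : ℝ} (hτ : 0 ≤ τ) (hτ1 : τ ≤ 1) {u c u' c' : ℝ → E}
    (hu : IsSlowSolution Γ z₀ ρ η u c (Icc 0 τ)) (hu' : IsSlowSolution Γ z₀ ρ η u' c' (Icc 0 τ))
    (h0 : u 0 = u' 0) :
    ∀ t ∈ Icc 0 τ, ‖c t - c' t - (c 0 - c' 0)‖ ≤ 6 * K * η * ‖c 0 - c' 0‖ ∧
      ‖u t - u' t - t • (c 0 - c' 0)‖ ≤ 6 * K * η * ‖c 0 - c' 0‖ := by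
  have hK := h.nonneg
  have hcont : ContinuousOn (fun t => ‖c t - c' t‖) (Icc 0 τ) := by
    intro t ht
    exact ((hu t ht).2.1.continuousAt.sub (hu' t ht).2.1.continuousAt).norm.continuousWithinAt
  -- Let `S` be the largest difference of velocities. It bounds the difference of positions, hence
  -- that of accelerations by 3KηS; since 3Kη ≤ 1/2, integration gives S ≤ 2‖c 0 - c' 0‖, which
  -- closes the estimate.
  obtain ⟨m, hm, hmax⟩ := isCompact_Icc.exists_isMaxOn (nonempty_Icc.2 hτ) hcont
  set S := ‖c m - c' m‖ with hS
  have hS0 : 0 ≤ S := norm_nonneg _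
  have hSb : ∀ t ∈ Icc 0 τ, ‖c t - c' t‖ ≤ S := fun t ht => hmax ht
  have hpos : ∀ t ∈ Icc 0 τ, ‖u t - u' t‖ ≤ S := by
    intro t ht
    have := norm_image_sub_le_of_norm_deriv_le_segment' (f := fun t => u t - u' t) (C := S)
      (fun s hs => ((hu s hs).1.sub (hu' s hs).1).hasDerivWithinAt)
      (fun s hs => hSb s (Ico_subset_Icc_self hs)) t ht
    simp only [h0, sub_self, sub_zero] at this
    exact this.trans (mul_le_of_le_one_right hS0 (ht.2.trans hτ1))
  have hacc : ∀ t ∈ Icc 0 τ, ‖Γ (u t) (c t) - Γ (u' t) (c' t)‖ ≤ 3 * K * η * S := by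
    intro t ht
    refine (h.lipschitz (2 * η) (by positivity) _ (hu t ht).2.2.1 _ (hu' t ht).2.2.1 _ _
      (hu t ht).2.2.2 (hu' t ht).2.2.2).trans ?_
    have e1 : K * (2 * η) ^ 2 * ‖u t - u' t‖ ≤ K * η * S := by
      have : K * (2 * η) ^ 2 ≤ K * η := by
        have : (2 * η) ^ 2 ≤ η := by nlinarith
        gcongr
      exact mul_le_mul this (hpos t ht) (norm_nonneg _) (by positivity)
    have e2 : K * (2 * η) * ‖c t - c' t‖ ≤ K * (2 * η) * S := by
      gcongr; exact hSb t ht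
    linarith
  have hvel : ∀ t ∈ Icc 0 τ, ‖c t - c' t - (c 0 - c' 0)‖ ≤ 3 * K * η * S := by
    intro t ht
    have := norm_image_sub_le_of_norm_deriv_le_segment' (f := fun t => c t - c' t)
      (C := 3 * K * η * S)
      (fun s hs => ((hu s hs).2.1.sub (hu' s hs).2.1).hasDerivWithinAt)
      (fun s hs => hacc s (Ico_subset_Icc_self hs)) t ht
    rw [sub_zero] at this
    exact this.trans (mul_le_of_le_one_right (by positivity) (ht.2.trans hτ1))
  have hSle : S ≤ 2 * ‖c 0 - c' 0‖ := by
    have e1 := hvel m hm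
    have e2 : S ≤ ‖c m - c' m - (c 0 - c' 0)‖ + ‖c 0 - c' 0‖ := by
      have := norm_add_le (c m - c' m - (c 0 - c' 0)) (c 0 - c' 0)
      rwa [sub_add_cancel] at this
    nlinarith
  have hfin : 3 * K * η * S ≤ 6 * K * η * ‖c 0 - c' 0‖ := by
    have : 3 * K * η * S ≤ 3 * K * η * (2 * ‖c 0 - c' 0‖) := by gcongr
    linarith
  intro t ht
  refine ⟨(hvel t ht).trans hfin, ?_⟩
  have := norm_image_sub_le_of_norm_deriv_le_segment'
    (f := fun t => u t - u' t - t • (c 0 - c' 0)) (C := 3 * K * η * S)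
    (fun s hs => ((((hu s hs).1.sub (hu' s hs).1).sub
      ((hasDerivAt_id s).smul_const (c 0 - c' 0))).congr_deriv
        (by rw [one_smul])).hasDerivWithinAt)
    (fun s hs => hvel s (Ico_subset_Icc_self hs)) t ht
  simp only [h0, sub_self, zero_smul, sub_zero] at this
  exact (this.trans (mul_le_of_le_one_right (by positivity) (ht.2.trans hτ1))).trans hfin

/-- The Lipschitz bound for slow vectors near z₀ suffices to make u'' continuous along `u`. -/
theorem IsSlowSolution.contDiffOn (h : IsSpray Γ z₀ ρ K) {η : ℝ} (hη : 0 < η) {u c : ℝ → E}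
    {J : Set ℝ} (hJ : IsOpen J) (hu : IsSlowSolution Γ z₀ ρ η u c J) : ContDiffOn ℝ 2 u J := by
  have hcont : ContinuousOn (fun t => Γ (u t) (c t)) J := by
    intro t ht
    have hlim : Tendsto (fun s => K * (2 * η) ^ 2 * ‖u s - u t‖ + K * (2 * η) * ‖c s - c t‖)
        (𝓝[J] t) (𝓝 0) := by
      have h1 : ContinuousAt
          (fun s => K * (2 * η) ^ 2 * ‖u s - u t‖ + K * (2 * η) * ‖c s - c t‖) t :=
        (((hu t ht).1.continuousAt.sub continuousAt_const).norm.const_mul _).add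
          (((hu t ht).2.1.continuousAt.sub continuousAt_const).norm.const_mul _)
      have h2 := h1.continuousWithinAt (s := J) |>.tendsto
      simpa using h2
    rw [ContinuousWithinAt, tendsto_iff_norm_sub_tendsto_zero]
    refine squeeze_zero' (Eventually.of_forall fun _ => norm_nonneg _) ?_ hlim
    filter_upwards [self_mem_nhdsWithin] with s hs
    exact h.lipschitz (2 * η) (by positivity) _ (hu s hs).2.2.1 _ (hu t ht).2.2.1 _ _
      (hu s hs).2.2.2 (hu t ht).2.2.2
  have h1 : ContDiffOn ℝ 1 c J := by
    rw [show (1 : WithTop ℕ∞) = 0 + 1 by norm_num, contDiffOn_succ_iff_deriv_of_isOpen hJ]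
    refine ⟨fun t ht => (hu t ht).2.1.differentiableAt.differentiableWithinAt, by simp, ?_⟩
    rw [contDiffOn_zero]
    exact hcont.congr fun t ht => (hu t ht).2.1.deriv
  rw [show (2 : WithTop ℕ∞) = 1 + 1 by norm_num, contDiffOn_succ_iff_deriv_of_isOpen hJ]
  refine ⟨fun t ht => (hu t ht).1.differentiableAt.differentiableWithinAt, by simp, ?_⟩
  exact h1.congr fun t ht => (hu t ht).1.deriv

end QuadraticODE

end SingularFlow

namespace SingularFlow

/-! ### The geodesic spray -/

section Spray

variable {E : Type*} [NormedAddCommGroup E] [NormedSpace ℝ E]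
  {M : Type*} [MetricSpace M] [ChartedSpace E M] [IsManifold 𝓘(ℝ, E) ∞ M]
  [RiemannianBundle (fun x : M => TangentSpace 𝓘(ℝ, E) x)]

/-- The covector `w ↦ (1/2) ∂_w g_z(v, v) - ∂_v g_z(v, w)`. -/
noncomputable def sprayCovector (q : M) (z v : E) : E →L[ℝ] ℝ :=
  (1 / 2 : ℝ) • ((fderiv ℝ (metricForm q) z).flip v).flip v - fderiv ℝ (metricForm q) z v v

theorem sprayCovector_apply (q : M) (z v w : E) : sprayCovector q z v w =
    (1 / 2) * fderiv ℝ (metricForm q) z w v v - fderiv ℝ (metricForm q) z v v w := by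
  simp [sprayCovector]

set_option maxSynthPendingDepth 10 in
theorem sprayCovector_smul (q : M) (c : ℝ) (z v : E) :
    sprayCovector q z (c • v) = c ^ 2 • sprayCovector q z v := by
  ext w
  simp only [sprayCovector_apply, map_smul, smul_apply, smul_eq_mul]
  ring

/-- The geodesic spray in the chart at `q`. -/
noncomputable def sprayRep (q : M) (z v : E) : E :=
  (metricForm q z).inverse (sprayCovector q z v)

theorem sprayRep_smul (q : M) (c : ℝ) (z v : E) :
    sprayRep q z (c • v) = c ^ 2 • sprayRep q z v := by
  rw [sprayRep, sprayRep, sprayCovector_smul, map_smul]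

variable [FiniteDimensional ℝ E]

theorem exists_equiv_metricForm {q : M} {z : E} (hz : z ∈ (extChartAt 𝓘(ℝ, E) q).target) :
    ∃ e : E ≃L[ℝ] (E →L[ℝ] ℝ), (e : E →L[ℝ] (E →L[ℝ] ℝ)) = metricForm q z := by
  have hinj : Function.Injective (metricForm q z) := by
    rw [injective_iff_map_eq_zero]
    intro v hv
    by_contra hne
    have := metricForm_pos hz hne
    rw [hv] at this
    simp at this
  have hrank : Module.finrank ℝ E = Module.finrank ℝ (E →L[ℝ] ℝ) := by
    rw [← (LinearMap.toContinuousLinearMap (𝕜 := ℝ) (E := E) (F' := ℝ)).finrank_eq]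
    exact (Subspace.dual_finrank_eq (K := ℝ) (V := E)).symm
  let e := (LinearEquiv.ofInjectiveOfFinrankEq
    (metricForm q z : E →ₗ[ℝ] (E →L[ℝ] ℝ)) hinj hrank).toContinuousLinearEquiv
  exact ⟨e, by ext v w; rfl⟩

theorem metricForm_sprayRep {q : M} {z : E} (hz : z ∈ (extChartAt 𝓘(ℝ, E) q).target) (v : E) :
    metricForm q z (sprayRep q z v) = sprayCovector q z v := by
  obtain ⟨e, he⟩ := exists_equiv_metricForm hz
  rw [sprayRep, ← he, ContinuousLinearMap.inverse_equiv]
  simp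

theorem energyDefect_metricForm_eq_zero_iff {q : M} {z : E}
    (hz : z ∈ (extChartAt 𝓘(ℝ, E) q).target) (c a : E) :
    (∀ w, energyDefect (metricForm q) z c a w = 0) ↔ a = sprayRep q z c := by
  have key : ∀ w, energyDefect (metricForm q) z c a w =
      metricForm q z (a - sprayRep q z c) w := by
    intro w
    rw [map_sub, metricForm_sprayRep hz, sub_apply, sprayCovector_apply, energyDefect]
    ring
  simp only [key]
  constructor
  · intro h
    by_contra hne
    exact (metricForm_pos hz (sub_ne_zero.2 hne)).ne' (h _)
  · intro h w
    rw [h, sub_self, map_zero, zero_apply]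

variable [IsContMDiffRiemannianBundle 𝓘(ℝ, E) ∞ E (fun x : M => TangentSpace 𝓘(ℝ, E) x)]

set_option maxHeartbeats 1000000 in
set_option maxSynthPendingDepth 10 in
theorem contDiffAt_sprayRep {q : M} {z : E} (hz : z ∈ (extChartAt 𝓘(ℝ, E) q).target) (v : E) :
    ContDiffAt ℝ 1 (fun x : E × E => sprayRep q x.1 x.2) (z, v) := by
  obtain ⟨e, he⟩ := exists_equiv_metricForm hz
  have hG : ContDiffAt ℝ 2 (metricForm q) z := (contDiffAt_metricForm hz).of_le (by decide)
  have h1 : ContDiffAt ℝ 1 (fun x : E × E => (metricForm q x.1).inverse) (z, v) := by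
    have e1 : ContDiffAt ℝ 1 ContinuousLinearMap.inverse (metricForm q z) := by
      rw [← he]; exact contDiffAt_map_inverse e
    have e2 : ContDiffAt ℝ 1 (fun x : E × E => metricForm q x.1) (z, v) :=
      (hG.of_le (by decide)).comp (z, v) contDiffAt_fst
    exact ContDiffAt.comp (z, v) e1 e2
  have h2 : ContDiffAt ℝ 1 (fun x : E × E => sprayCovector q x.1 x.2) (z, v) := by
    have hO : IsOpen ((extChartAt 𝓘(ℝ, E) q).target ×ˢ (univ : Set E)) :=
      (isOpen_extChartAt_target q).prod isOpen_univ
    refine ContDiffOn.contDiffAt (s := (extChartAt 𝓘(ℝ, E) q).target ×ˢ (univ : Set E)) ?_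
      (hO.mem_nhds ⟨hz, mem_univ v⟩)
    refine contDiffOn_clm_apply.2 fun w x hx => ContDiffAt.contDiffWithinAt ?_
    have hG' : ContDiffAt ℝ 2 (metricForm q) x.1 := (contDiffAt_metricForm hx.1).of_le (by decide)
    have e1 : ContDiffAt ℝ 1 (fun x : E × E => fderiv ℝ (metricForm q) x.1) x :=
      ContDiffAt.comp x (hG'.fderiv_right (m := 1) (by norm_num)) contDiffAt_fst
    simp only [sprayCovector_apply]
    exact (contDiffAt_const.mul (((e1.clm_apply contDiffAt_const).clm_apply
      contDiffAt_snd).clm_apply contDiffAt_snd)).sub (((e1.clm_apply contDiffAt_snd).clm_apply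
      contDiffAt_snd).clm_apply contDiffAt_const)
  exact h1.clm_apply h2

/-- In a chart, the geodesic equation reads `u'' = Γ(u, u')`. -/
theorem IsGeodesicOn.hasDerivAt_chart {q : M} {γ : ℝ → M} {J : Set ℝ} (hJ : IsOpen J)
    (h : IsGeodesicOn (E := E) γ J) {t : ℝ} (ht : t ∈ J)
    (hq : γ t ∈ (extChartAt 𝓘(ℝ, E) q).source) :
    let u : ℝ → E := fun s => extChartAt 𝓘(ℝ, E) q (γ s)
    HasDerivAt u (deriv u t) t ∧ HasDerivAt (deriv u) (sprayRep q (u t) (deriv u t)) t := by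
  intro u
  have hγt : ContMDiffAt 𝓘(ℝ, ℝ) 𝓘(ℝ, E) 2 γ t := h.1.contMDiffAt (hJ.mem_nhds ht)
  have hu2 : ContDiffAt ℝ 2 u t := by
    rw [← contMDiffAt_iff_contDiffAt]
    exact ContMDiffAt.comp t
      ((contMDiffAt_extChartAt' (I := 𝓘(ℝ, E)) (n := 2) (x := q) (by simpa using hq))) hγt
  have hc2 : ContDiffAt ℝ 1 (deriv u) t := by
    have h1 : ContDiffAt ℝ 1 (fderiv ℝ u) t := hu2.fderiv_right (by norm_num)
    exact h1.clm_apply (contDiffAt_const (c := (1 : ℝ)))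
  refine ⟨(hu2.differentiableAt two_ne_zero).hasDerivAt, ?_⟩
  have hopen : IsOpen (J ∩ γ ⁻¹' (extChartAt 𝓘(ℝ, E) q).source) :=
    h.1.continuousOn.isOpen_inter_preimage hJ (isOpen_extChartAt_source q)
  have h' : IsGeodesicOn (E := E) γ (J ∩ γ ⁻¹' (extChartAt 𝓘(ℝ, E) q).source) :=
    ⟨h.1.mono inter_subset_left, fun s hs => h.2 s hs.1⟩
  have h2 := (isGeodesicOn_iff hopen (fun s hs => hs.2) h'.1).1 h' t ⟨ht, hq⟩
  rw [energyDefect_metricForm_eq_zero_iff ((extChartAt 𝓘(ℝ, E) q).map_source hq)] at h2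
  have h3 := (hc2.differentiableAt one_ne_zero).hasDerivAt
  exact h3.congr_deriv h2

end Spray

/-! ### The exponential map in a chart. -/

section Exp

variable {E : Type*} [NormedAddCommGroup E] [NormedSpace ℝ E] [FiniteDimensional ℝ E]
  {M : Type*} [MetricSpace M] [ChartedSpace E M] [IsManifold 𝓘(ℝ, E) ∞ M]
  [RiemannianBundle (fun x : M => TangentSpace 𝓘(ℝ, E) x)]
  [IsContMDiffRiemannianBundle 𝓘(ℝ, E) ∞ E (fun x : M => TangentSpace 𝓘(ℝ, E) x)]

theorem IsSlowSolution.isGeodesicOn {σ : M} {z₀ : E} {ρ K η : ℝ}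
    (hΓ : IsSpray (sprayRep σ) z₀ ρ K)
    (hball : Metric.closedBall z₀ ρ ⊆ (extChartAt 𝓘(ℝ, E) σ).target) (hη : 0 < η) {u c : ℝ → E}
    {J : Set ℝ} (hJ : IsOpen J) (hu : IsSlowSolution (sprayRep σ) z₀ ρ η u c J) :
    IsGeodesicOn (E := E) (fun t => (extChartAt 𝓘(ℝ, E) σ).symm (u t)) J := by
  have hut : ∀ t ∈ J, u t ∈ (extChartAt 𝓘(ℝ, E) σ).target := fun t ht => hball (hu t ht).2.2.1
  have hu2 : ContMDiffOn 𝓘(ℝ, ℝ) 𝓘(ℝ, E) 2 u J :=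
    contMDiffOn_iff_contDiffOn.2 (hu.contDiffOn hΓ hη hJ)
  have hγ : ContMDiffOn 𝓘(ℝ, ℝ) 𝓘(ℝ, E) 2 (fun t => (extChartAt 𝓘(ℝ, E) σ).symm (u t)) J :=
    ((contMDiffOn_extChartAt_symm (I := 𝓘(ℝ, E)) (n := ∞) σ).of_le (by decide)).comp hu2 hut
  rw [isGeodesicOn_iff hJ (q := σ) (fun t ht => (extChartAt 𝓘(ℝ, E) σ).map_target (hut t ht)) hγ]
  intro t ht
  have hev : ∀ᶠ s in 𝓝 t,
      extChartAt 𝓘(ℝ, E) σ ((extChartAt 𝓘(ℝ, E) σ).symm (u s)) = u s := by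
    filter_upwards [hJ.mem_nhds ht] with s hs using (extChartAt 𝓘(ℝ, E) σ).right_inv (hut s hs)
  have hd : ∀ᶠ s in 𝓝 t,
      deriv (fun r => extChartAt 𝓘(ℝ, E) σ ((extChartAt 𝓘(ℝ, E) σ).symm (u r))) s = c s := by
    filter_upwards [hev.eventually_nhds, hJ.mem_nhds ht] with s hs hsJ
    rw [EventuallyEq.deriv_eq hs]
    exact (hu s hsJ).1.deriv
  rw [EventuallyEq.deriv_eq hd, hd.self_of_nhds, hev.self_of_nhds, (hu t ht).2.1.deriv,
    energyDefect_metricForm_eq_zero_iff (hut t ht)]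

theorem isExp_of_isSlowSolution {σ : M} {z₀ : E} {ρ K η : ℝ}
    (hΓ : IsSpray (sprayRep σ) z₀ ρ K)
    (hball : Metric.closedBall z₀ ρ ⊆ (extChartAt 𝓘(ℝ, E) σ).target) (hη : 0 < η) {u c : ℝ → E}
    (hu : IsSlowSolution (sprayRep σ) z₀ ρ η u c (Ioo (-2) 2)) {p : M} {v : E}
    (hp : p ∈ (extChartAt 𝓘(ℝ, E) σ).source) (hu0 : u 0 = extChartAt 𝓘(ℝ, E) σ p)
    (hc0 : c 0 = tangentCoordChange 𝓘(ℝ, E) p σ p v) :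
    IsExp p v ((extChartAt 𝓘(ℝ, E) σ).symm (u 1)) := by
  refine ⟨fun t => (extChartAt 𝓘(ℝ, E) σ).symm (u t), Ioo (-2) 2, isOpen_Ioo,
    fun t ht => ⟨by linarith [ht.1], by linarith [ht.2]⟩, hu.isGeodesicOn hΓ hball hη isOpen_Ioo,
    ?_, ?_, rfl⟩
  · simp only [hu0]
    exact (extChartAt 𝓘(ℝ, E) σ).left_inv hp
  · have h1 := hasFDerivAt_transition hp (mem_extChartAt_source (I := 𝓘(ℝ, E)) p)
    rw [← hu0] at h1
    have h2 := h1.comp_hasDerivAt 0 (hu 0 (by norm_num)).1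
    rw [hc0, tangentCoordChange_inv (mem_extChartAt_source (I := 𝓘(ℝ, E)) p) hp] at h2
    exact h2

/-- A competing geodesic might leave the chart, so agreement is proved by continuous induction. The
set of times up to which the curves agree is closed. Just after such a time the geodesic is still in
the chart, within 2ρ of z₀ and of speed at most 4η, and `IsSpray.norm_sub_le` with equal initial
data extends the agreement. The doubled radius and speed provide the room for this. -/
theorem IsExp.eq_of_isSlowSolution {σ : M} {z₀ : E} {ρ K η : ℝ} (hρ : 0 < ρ)
    (hΓ : IsSpray (sprayRep σ) z₀ (2 * ρ) K)
    (hball : Metric.closedBall z₀ ρ ⊆ (extChartAt 𝓘(ℝ, E) σ).target) (hη : 0 < η)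
    (hη1 : 2 * η ≤ 1 / 4) (hKη : 6 * K * (2 * η) ≤ 1) {u c : ℝ → E}
    (hu : IsSlowSolution (sprayRep σ) z₀ ρ η u c (Ioo (-2) 2)) {p : M} {v : E}
    (hp : p ∈ (extChartAt 𝓘(ℝ, E) σ).source) (hu0 : u 0 = extChartAt 𝓘(ℝ, E) σ p)
    (hc0 : c 0 = tangentCoordChange 𝓘(ℝ, E) p σ p v) {q : M} (hq : IsExp p v q) :
    q = (extChartAt 𝓘(ℝ, E) σ).symm (u 1) := by
  obtain ⟨γ, J, hJ, hJ01, hgeo, hγ0, hγd, rfl⟩ := hq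
  have hut : ∀ t ∈ Ioo (-2 : ℝ) 2, u t ∈ (extChartAt 𝓘(ℝ, E) σ).target := fun t ht =>
    hball (hu t ht).2.2.1
  have h01 : Icc (0 : ℝ) 1 ⊆ Ioo (-2 : ℝ) 2 := fun t ht => ⟨by linarith [ht.1], by linarith [ht.2]⟩
  have hcγ : ContinuousOn γ (Icc 0 1) := hgeo.1.continuousOn.mono hJ01
  have hcu : ContinuousOn (fun t => (extChartAt 𝓘(ℝ, E) σ).symm (u t)) (Icc 0 1) := by
    refine (continuousOn_extChartAt_symm (I := 𝓘(ℝ, E)) σ).comp (fun t ht => ?_)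
      (fun t ht => hut t (h01 ht))
    exact (hu t (h01 ht)).1.continuousAt.continuousWithinAt
  set y : ℝ → E := fun s => extChartAt 𝓘(ℝ, E) σ (γ s) with hy
  let s : Set ℝ := {t | ∀ r ∈ Icc (0 : ℝ) t, r ∈ Icc (0 : ℝ) 1 →
    γ r = (extChartAt 𝓘(ℝ, E) σ).symm (u r)}
  have hsrc : ∀ r ∈ Icc (0 : ℝ) 1, γ r = (extChartAt 𝓘(ℝ, E) σ).symm (u r) →
      γ r ∈ (extChartAt 𝓘(ℝ, E) σ).source ∧ y r = u r := by
    intro r hr h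
    refine ⟨?_, ?_⟩
    · rw [h]; exact (extChartAt 𝓘(ℝ, E) σ).map_target (hut r (h01 hr))
    · simp only [hy, h]; exact (extChartAt 𝓘(ℝ, E) σ).right_inv (hut r (h01 hr))
  have hclosed : IsClosed (s ∩ Icc 0 1) := by
    have hs : s ∩ Icc 0 1 = ⋂ r ∈ Icc (0 : ℝ) 1, {t ∈ Icc (0 : ℝ) 1 |
        γ (min r t) = (extChartAt 𝓘(ℝ, E) σ).symm (u (min r t))} := by
      ext t
      simp only [mem_inter_iff, mem_iInter, Set.mem_ofPred_eq, s]
      constructor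
      · rintro ⟨h1, h2⟩ r hr
        exact ⟨h2, h1 _ ⟨le_min hr.1 h2.1, min_le_right _ _⟩
          ⟨le_min hr.1 h2.1, (min_le_left _ _).trans hr.2⟩⟩
      · intro h
        refine ⟨fun r hr hr1 => ?_, (h 0 (by norm_num)).1⟩
        have := (h r hr1).2
        rwa [min_eq_left hr.2] at this
    rw [hs]
    refine isClosed_biInter fun r hr => ?_
    have hmin : MapsTo (fun t => min r t) (Icc (0 : ℝ) 1) (Icc 0 1) := fun t ht =>
      ⟨le_min hr.1 ht.1, (min_le_left _ _).trans hr.2⟩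
    have hcm : ContinuousOn (fun t => min r t) (Icc (0 : ℝ) 1) :=
      (continuous_const.min continuous_id).continuousOn
    have hpair : ContinuousOn
        (fun t => (γ (min r t), (extChartAt 𝓘(ℝ, E) σ).symm (u (min r t)))) (Icc (0 : ℝ) 1) :=
      (hcγ.comp hcm hmin).prodMk (hcu.comp hcm hmin)
    exact hpair.preimage_isClosed_of_isClosed isClosed_Icc isClosed_diagonal
  have hγ0' : γ 0 = (extChartAt 𝓘(ℝ, E) σ).symm (u 0) := by
    rw [hγ0, hu0, (extChartAt 𝓘(ℝ, E) σ).left_inv hp]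
  have hd0 : deriv y 0 = c 0 := by
    have h1 := hasFDerivAt_transition (mem_extChartAt_source (I := 𝓘(ℝ, E)) p) hp
    have h2 : HasDerivAt (fun t => (extChartAt 𝓘(ℝ, E) σ ∘ (extChartAt 𝓘(ℝ, E) p).symm)
        (extChartAt 𝓘(ℝ, E) p (γ t))) (c 0) 0 := by
      rw [hc0]
      rw [← hγ0] at h1
      rw [hγ0] at h1
      exact HasFDerivAt.comp_hasDerivAt (f := fun t => extChartAt 𝓘(ℝ, E) p (γ t)) 0
        (by simp only [hγ0]; exact h1) hγd
    refine (h2.congr_of_eventuallyEq ?_).deriv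
    have hcont : ContinuousAt γ 0 :=
      hgeo.1.continuousOn.continuousAt (hJ.mem_nhds (hJ01 (by norm_num)))
    filter_upwards [hcont.eventually_mem ((isOpen_extChartAt_source (I := 𝓘(ℝ, E)) p).mem_nhds
      (by rw [hγ0]; exact mem_extChartAt_source p))] with t ht
    simp only [hy, Function.comp_apply, (extChartAt 𝓘(ℝ, E) p).left_inv ht]
  have hsub : Icc (0 : ℝ) 1 ⊆ s := by
    refine hclosed.Icc_subset_of_forall_exists_gt ?_ ?_
    · intro r hr _
      have : r = 0 := le_antisymm hr.2 hr.1
      rw [this]; exact hγ0'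
    · rintro x ⟨hxs, hx⟩ b hb
      have hx01 : x ∈ Icc (0 : ℝ) 1 := ⟨hx.1, hx.2.le⟩
      have hle : ∀ r ∈ Icc (0 : ℝ) x, r ∈ Icc (0 : ℝ) 1 := fun r hr => ⟨hr.1, hr.2.trans hx.2.le⟩
      have heq : ∀ r ∈ Icc (0 : ℝ) x, γ r ∈ (extChartAt 𝓘(ℝ, E) σ).source ∧ y r = u r :=
        fun r hr => hsrc r (hle r hr) (hxs r hr (hle r hr))
      have hchart : ∀ r ∈ J, γ r ∈ (extChartAt 𝓘(ℝ, E) σ).source →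
          HasDerivAt y (deriv y r) r ∧ HasDerivAt (deriv y) (sprayRep σ (y r) (deriv y r)) r :=
        fun r hr hs => hgeo.hasDerivAt_chart hJ hr hs
      have hdeq : ∀ r ∈ Icc (0 : ℝ) x, deriv y r = c r := by
        intro r hr
        -- For x = 0 the interval [0, x] is a point and determines no derivative; the prescribed
        -- initial velocity is used instead.
        rcases hx.1.eq_or_lt with h0 | h0
        · have : r = 0 := le_antisymm (by rw [h0]; exact hr.2) hr.1
          rw [this]; exact hd0
        · have h1 := (hchart r (hJ01 (hle r hr)) (heq r hr).1).1.hasDerivWithinAt (s := Icc 0 x)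
          have h2 := (hu r (h01 (hle r hr))).1.hasDerivWithinAt (s := Icc 0 x)
          have h3 : HasDerivWithinAt y (c r) (Icc 0 x) r :=
            h2.congr (fun r' hr' => (heq r' hr').2) (heq r hr).2
          exact (uniqueDiffOn_Icc h0 r hr).eq_deriv _ h1 h3
      have hxx : x ∈ Icc (0 : ℝ) x := right_mem_Icc.2 hx.1
      obtain ⟨hy1, hy2⟩ := hchart x (hJ01 hx01) (heq x hxx).1
      have hnear : ∀ᶠ r in 𝓝 x, r ∈ J ∧ γ r ∈ (extChartAt 𝓘(ℝ, E) σ).source ∧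
          y r ∈ Metric.closedBall z₀ (2 * ρ) ∧ ‖deriv y r‖ ≤ 2 * (2 * η) := by
        have hcont : ContinuousAt γ x := hgeo.1.continuousOn.continuousAt (hJ.mem_nhds (hJ01 hx01))
        have e1 := hcont.eventually_mem
          ((isOpen_extChartAt_source (I := 𝓘(ℝ, E)) σ).mem_nhds (heq x hxx).1)
        have e2 : ∀ᶠ r in 𝓝 x, y r ∈ Metric.ball z₀ (2 * ρ) := by
          apply hy1.continuousAt.eventually_mem (Metric.isOpen_ball.mem_nhds _)
          rw [(heq x hxx).2]
          have := (hu x (h01 hx01)).2.2.1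
          rw [Metric.mem_closedBall] at this
          rw [Metric.mem_ball]; linarith
        have e3 : ∀ᶠ r in 𝓝 x, ‖deriv y r‖ < 2 * (2 * η) := by
          apply hy2.continuousAt.norm.eventually (gt_mem_nhds _)
          show ‖deriv y x‖ < 2 * (2 * η)
          rw [hdeq x hxx]
          have := (hu x (h01 hx01)).2.2.2
          linarith
        filter_upwards [hJ.mem_nhds (hJ01 hx01), e1, e2, e3] with r h1 h2 h3 h4
        exact ⟨h1, h2, Metric.ball_subset_closedBall h3, h4.le⟩
      obtain ⟨ε, hε, hεb⟩ := Metric.eventually_nhds_iff.1 hnear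
      set t := min (min b 1) (x + ε / 2) with ht
      have hxt : x < t := lt_min (lt_min hb hx.2) (by linarith)
      have htb : t ≤ b := (min_le_left _ _).trans (min_le_left _ _)
      have ht1 : t ≤ 1 := (min_le_left _ _).trans (min_le_right _ _)
      have htε : t ≤ x + ε / 2 := min_le_right _ _
      have hslow : IsSlowSolution (sprayRep σ) z₀ (2 * ρ) (2 * η) y (deriv y) (Icc 0 t) := by
        intro r hr
        rcases le_or_gt r x with hrx | hrx
        · have hr' : r ∈ Icc 0 x := ⟨hr.1, hrx⟩
          obtain ⟨h1, h2⟩ := hchart r (hJ01 (hle r hr')) (heq r hr').1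
          refine ⟨h1, h2, ?_, ?_⟩
          · rw [(heq r hr').2]
            exact Metric.closedBall_subset_closedBall (by linarith) (hu r (h01 (hle r hr'))).2.2.1
          · rw [hdeq r hr']
            linarith [(hu r (h01 (hle r hr'))).2.2.2]
        · have := hεb (y := r) (by
            rw [Real.dist_eq, abs_of_pos (by linarith)]; linarith [hr.2])
          obtain ⟨h1, h2⟩ := hchart r this.1 this.2.1
          exact ⟨h1, h2, this.2.2.1, this.2.2.2⟩
      have hslow' : IsSlowSolution (sprayRep σ) z₀ (2 * ρ) (2 * η) u c (Icc 0 t) := by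
        intro r hr
        obtain ⟨h1, h2, h3, h4⟩ := hu r (h01 ⟨hr.1, hr.2.trans ht1⟩)
        exact ⟨h1, h2, Metric.closedBall_subset_closedBall (by linarith) h3, by linarith⟩
      have h0t : 0 ≤ t := hx.1.trans hxt.le
      have hcmp := hΓ.norm_sub_le (by positivity) hη1 hKη h0t ht1 hslow hslow'
        (heq 0 (left_mem_Icc.2 hx.1)).2
      have hsrc' : ∀ r ∈ Icc 0 t, γ r ∈ (extChartAt 𝓘(ℝ, E) σ).source := by
        intro r hr
        rcases le_or_gt r x with hrx | hrx
        · exact (heq r ⟨hr.1, hrx⟩).1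
        · exact (hεb (y := r) (by
            rw [Real.dist_eq, abs_of_pos (by linarith)]; linarith [hr.2])).2.1
      refine ⟨t, fun r hr _ => ?_, hxt, htb⟩
      have h1 := (hcmp r hr).2
      rw [hd0, sub_self, smul_zero, sub_zero, norm_zero, mul_zero, norm_le_zero_iff, sub_eq_zero] at h1
      rw [← h1]
      exact ((extChartAt 𝓘(ℝ, E) σ).left_inv (hsrc' r hr)).symm
  exact hsub (by norm_num : (1 : ℝ) ∈ Icc (0 : ℝ) 1) 1 (by norm_num) (by norm_num)

/-- Near `σ`, in the chart at `σ`, the exponential map is defined on small vectors and is close to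
the translation, uniformly in the base point. -/
theorem exists_exp_chart (σ : M) :
    ∃ ρ > 0, ∃ K ≥ 0, ∃ η₀ > 0,
      Metric.closedBall (extChartAt 𝓘(ℝ, E) σ σ) ρ ⊆ (extChartAt 𝓘(ℝ, E) σ).target ∧
      ∀ η, 0 < η → η ≤ η₀ → ∀ p ∈ (extChartAt 𝓘(ℝ, E) σ).source,
        extChartAt 𝓘(ℝ, E) σ p ∈ Metric.closedBall (extChartAt 𝓘(ℝ, E) σ σ) (ρ / 2) →
        ∃ X : E → E, X 0 = extChartAt 𝓘(ℝ, E) σ p ∧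
          (∀ w, ‖w‖ ≤ η → X w ∈ Metric.closedBall (extChartAt 𝓘(ℝ, E) σ σ) ρ) ∧
          (∀ w w', ‖w‖ ≤ η → ‖w'‖ ≤ η → ‖X w - X w' - (w - w')‖ ≤ K * η * ‖w - w'‖) ∧
          ∀ v, ‖tangentCoordChange 𝓘(ℝ, E) p σ p v‖ ≤ η → ∀ q, IsExp p v q ↔
            q = (extChartAt 𝓘(ℝ, E) σ).symm (X (tangentCoordChange 𝓘(ℝ, E) p σ p v)) := by
  have : CompleteSpace E := FiniteDimensional.complete ℝ E
  obtain ⟨ρ₀, hρ₀, K, hK⟩ := exists_isSpray (sprayRep_smul σ)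
    (contDiffAt_sprayRep (mem_extChartAt_target (I := 𝓘(ℝ, E)) σ) 0)
  obtain ⟨ρ₁, hρ₁, hball₁⟩ := Metric.nhds_basis_closedBall.mem_iff.1
    (extChartAt_target_mem_nhds (I := 𝓘(ℝ, E)) σ)
  set ρ := min (ρ₀ / 2) ρ₁ with hρdef
  have hρ : 0 < ρ := by positivity
  have hS := hK ρ hρ ((min_le_left _ _).trans (by linarith))
  have hS2 := hK (2 * ρ) (by positivity) (by linarith [min_le_left (ρ₀ / 2) ρ₁])
  have hK0 := hS.nonneg
  have hball : Metric.closedBall (extChartAt 𝓘(ℝ, E) σ σ) ρ ⊆ (extChartAt 𝓘(ℝ, E) σ).target :=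
    (Metric.closedBall_subset_closedBall (min_le_right _ _)).trans hball₁
  -- The bounds on η serve existence on (-2, 2) and comparison at doubled speed, which needs 2η ≤
  -- 1/4 and 12Kη ≤ 1; 6K is the constant of `IsSpray.norm_sub_le`.
  refine ⟨ρ, hρ, 6 * K, by positivity,
    min (ρ ^ 2 / (8 * (1 + K))) (min (1 / 8) (1 / (12 * (K + 1)))), by positivity, hball, ?_⟩
  intro η hη hη₀ p hp hpρ
  have hη1 : η ≤ ρ ^ 2 / (8 * (1 + K)) := hη₀.trans (min_le_left _ _)
  have hη2 : η ≤ 1 / 8 := (hη₀.trans (min_le_right _ _)).trans (min_le_left _ _)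
  have hη3 : 12 * K * η ≤ 1 := by
    have : η ≤ 1 / (12 * (K + 1)) := (hη₀.trans (min_le_right _ _)).trans (min_le_right _ _)
    rw [le_div_iff₀ (by positivity)] at this
    nlinarith
  have hex : ∀ w : E, ∃ u c : ℝ → E, ‖w‖ ≤ η → u 0 = extChartAt 𝓘(ℝ, E) σ p ∧ c 0 = w ∧
      IsSlowSolution (sprayRep σ) (extChartAt 𝓘(ℝ, E) σ σ) ρ η u c (Ioo (-2) 2) := by
    intro w
    by_cases hw : ‖w‖ ≤ η
    · obtain ⟨u, c, h⟩ := hS.exists_solution hη hη1 hpρ hw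
      exact ⟨u, c, fun _ => h⟩
    · exact ⟨0, 0, fun h => absurd h hw⟩
  choose u c huc using hex
  have h01 : Icc (0 : ℝ) 1 ⊆ Ioo (-2 : ℝ) 2 := fun t ht => ⟨by linarith [ht.1], by linarith [ht.2]⟩
  have hz : sprayRep σ (extChartAt 𝓘(ℝ, E) σ p) 0 = 0 := by
    simpa using sprayRep_smul σ 0 (extChartAt 𝓘(ℝ, E) σ p) 0
  -- Comparison with the constant solution identifies the value of the exponential at 0.
  have hconst : IsSlowSolution (sprayRep σ) (extChartAt 𝓘(ℝ, E) σ σ) ρ η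
      (fun _ => extChartAt 𝓘(ℝ, E) σ p) (fun _ => 0) (Icc 0 1) := by
    intro t _
    refine ⟨hasDerivAt_const _ _, ?_, Metric.closedBall_subset_closedBall (by linarith) hpρ, ?_⟩
    · simp only [hz]; exact hasDerivAt_const _ _
    · rw [norm_zero]; positivity
  refine ⟨fun w => u w 1, ?_, fun w hw => ?_, fun w w' hw hw' => ?_, fun v hv q => ?_⟩
  · obtain ⟨h1, h2, h3⟩ := huc 0 (by rw [norm_zero]; exact hη.le)
    have := (hS.norm_sub_le hη (by linarith) (by nlinarith) zero_le_one le_rfl (h3.mono h01) hconst h1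
      1 (by norm_num)).2
    rw [h2, sub_self, smul_zero, sub_zero, norm_zero, mul_zero, norm_le_zero_iff, sub_eq_zero] at this
    exact this
  · exact ((huc w hw).2.2 1 (by norm_num)).2.2.1
  · obtain ⟨h1, h2, h3⟩ := huc w hw
    obtain ⟨h1', h2', h3'⟩ := huc w' hw'
    have := (hS.norm_sub_le hη (by linarith) (by nlinarith) zero_le_one le_rfl (h3.mono h01)
      (h3'.mono h01) (h1.trans h1'.symm) 1 (by norm_num)).2
    rwa [one_smul, h2, h2'] at this
  · obtain ⟨h1, h2, h3⟩ := huc _ hv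
    constructor
    · intro hq
      exact hq.eq_of_isSlowSolution hρ hS2 hball hη (by linarith) (by linarith) h3 hp h1 h2
    · rintro rfl
      exact isExp_of_isSlowSolution hS hball hη h3 hp h1 h2

end Exp

end SingularFlow

namespace SingularFlow

/-! ### Dynamics near a saddle in coordinates -/

section LocalSaddle

variable {F : Type*} [NormedAddCommGroup F] [InnerProductSpace ℝ F]

/-- The quadratic form `v ↦ |v^u|² - |v^s|²`. -/
noncomputable def quad (J : F →L[ℝ] F) (v : F) : ℝ := inner ℝ (J v) v

theorem quad_neg (J : F →L[ℝ] F) (v : F) : quad (-J) v = -quad J v := by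
  simp [quad]

theorem continuous_quad (J : F →L[ℝ] F) : Continuous (quad J) :=
  J.continuous.inner continuous_id

theorem SaddleForm.quad_sub {J A : F →L[ℝ] F} {lam : ℝ} (h : SaddleForm J A lam) (x y : F) :
    quad J x - quad J y = inner ℝ (J (x - y)) (x + y) := by
  have : inner ℝ (J x) y = inner ℝ (J y) x := by rw [h.symm, real_inner_comm]
  simp only [quad, map_sub, inner_sub_left, inner_add_right, this]
  ring

/-- `Z` is a vector field on the ball of radius `ρ` that is `ε`-close to the hyperbolic linear
field `A` of saddle type, and `k` is `ε`-close to the identity. -/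
structure IsLocalSaddle (J A : F →L[ℝ] F) (Z k : F → F) (lam Λ ε ρ : ℝ) : Prop where
  form : SaddleForm J A lam
  lam_pos : 0 < lam
  lam_le_one : lam ≤ 1
  one_le : 1 ≤ Λ
  norm_le : ‖A‖ ≤ Λ
  eps_nonneg : 0 ≤ ε
  eps_small : 100 * ε * Λ ≤ lam
  rho_pos : 0 < ρ
  Z_zero : Z 0 = 0
  k_zero : k 0 = 0
  Z_approx : ∀ x ∈ Metric.ball (0 : F) ρ, ∀ y ∈ Metric.ball (0 : F) ρ,
    ‖Z x - Z y - A (x - y)‖ ≤ ε * ‖x - y‖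
  k_approx : ∀ x ∈ Metric.ball (0 : F) ρ, ∀ y ∈ Metric.ball (0 : F) ρ,
    ‖k x - k y - (x - y)‖ ≤ ε * ‖x - y‖

namespace IsLocalSaddle

variable {J A : F →L[ℝ] F} {Z k : F → F} {lam Λ ε ρ : ℝ}

theorem neg (h : IsLocalSaddle J A Z k lam Λ ε ρ) : IsLocalSaddle (-J) (-A) (-Z) k lam Λ ε ρ where
  form := h.form.neg
  lam_pos := h.lam_pos
  lam_le_one := h.lam_le_one
  one_le := h.one_le
  norm_le := by rw [norm_neg]; exact h.norm_le
  eps_nonneg := h.eps_nonneg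
  eps_small := h.eps_small
  rho_pos := h.rho_pos
  Z_zero := by simp [h.Z_zero]
  k_zero := h.k_zero
  Z_approx x hx y hy := by
    have e : (-Z) x - (-Z) y - (-A) (x - y) = -(Z x - Z y - A (x - y)) := by
      rw [Pi.neg_apply, Pi.neg_apply, neg_apply]; abel
    rw [e, norm_neg]
    exact h.Z_approx x hx y hy
  k_approx := h.k_approx

theorem eps_le (h : IsLocalSaddle J A Z k lam Λ ε ρ) : 100 * ε ≤ lam := by
  nlinarith [h.eps_small, h.one_le, h.eps_nonneg]

theorem zero_mem (h : IsLocalSaddle J A Z k lam Λ ε ρ) : (0 : F) ∈ Metric.ball (0 : F) ρ :=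
  Metric.mem_ball_self h.rho_pos

theorem norm_Z_sub_le (h : IsLocalSaddle J A Z k lam Λ ε ρ) {x : F} (hx : x ∈ Metric.ball (0 : F) ρ) :
    ‖Z x - A x‖ ≤ ε * ‖x‖ := by
  simpa [h.Z_zero] using h.Z_approx x hx 0 h.zero_mem

theorem norm_k_sub_le (h : IsLocalSaddle J A Z k lam Λ ε ρ) {x : F} (hx : x ∈ Metric.ball (0 : F) ρ) :
    ‖k x - x‖ ≤ ε * ‖x‖ := by
  simpa [h.k_zero] using h.k_approx x hx 0 h.zero_mem

theorem norm_k_le (h : IsLocalSaddle J A Z k lam Λ ε ρ) {x : F} (hx : x ∈ Metric.ball (0 : F) ρ) :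
    ‖k x‖ ≤ 1.01 * ‖x‖ := by
  have h1 := h.norm_k_sub_le hx
  have h2 := norm_le_norm_add_norm_sub' (k x) x
  nlinarith [h.eps_le, h.lam_le_one, norm_nonneg x]

theorem le_norm_k (h : IsLocalSaddle J A Z k lam Λ ε ρ) {x : F} (hx : x ∈ Metric.ball (0 : F) ρ) :
    0.99 * ‖x‖ ≤ ‖k x‖ := by
  have h1 := h.norm_k_sub_le hx
  have h2 := norm_le_norm_add_norm_sub' x (k x)
  rw [norm_sub_rev] at h2
  nlinarith [h.eps_le, h.lam_le_one, norm_nonneg x]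

theorem continuousOn_k (h : IsLocalSaddle J A Z k lam Λ ε ρ) :
    ContinuousOn k (Metric.ball (0 : F) ρ) := by
  have : LipschitzOnWith 2 k (Metric.ball (0 : F) ρ) := by
    apply LipschitzOnWith.of_dist_le_mul
    intro x hx y hy
    have h1 := h.k_approx x hx y hy
    have h2 := norm_le_norm_add_norm_sub' (k x - k y) (x - y)
    rw [dist_eq_norm, dist_eq_norm]
    simp only [NNReal.coe_ofNat]
    nlinarith [h.eps_le, h.lam_le_one, norm_nonneg (x - y)]
  exact this.continuousOn

theorem norm_Z_le (h : IsLocalSaddle J A Z k lam Λ ε ρ) {x : F} (hx : x ∈ Metric.ball (0 : F) ρ) :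
    ‖Z x‖ ≤ 2 * Λ * ‖x‖ := by
  have h1 := h.norm_Z_sub_le hx
  have h2 := norm_le_norm_add_norm_sub' (Z x) (A x)
  have h3 := A.le_of_opNorm_le h.norm_le x
  nlinarith [h.eps_le, h.lam_le_one, norm_nonneg x, h.one_le]

theorem le_norm_Z (h : IsLocalSaddle J A Z k lam Λ ε ρ) {x : F} (hx : x ∈ Metric.ball (0 : F) ρ) :
    lam / 2 * ‖x‖ ≤ ‖Z x‖ := by
  have h1 := h.norm_Z_sub_le hx
  have h2 := norm_le_norm_add_norm_sub' (A x) (Z x)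
  rw [norm_sub_rev] at h2
  have h3 : lam * ‖x‖ ≤ ‖A x‖ := by
    rcases eq_or_ne x 0 with rfl | hx0
    · simp
    · have h4 := h.form.coercive x
      have h5 := real_inner_le_norm (J x) (A x)
      rw [h.form.norm_map] at h5
      have : 0 < ‖x‖ := norm_pos_iff.2 hx0
      refine le_of_mul_le_mul_left ?_ this
      nlinarith
  have h6 : ε * ‖x‖ ≤ lam / 100 * ‖x‖ :=
    mul_le_mul_of_nonneg_right (by linarith [h.eps_le]) (norm_nonneg _)
  have h7 : 0 ≤ lam * ‖x‖ := mul_nonneg h.lam_pos.le (norm_nonneg _)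
  linarith

theorem inner_map_Z (h : IsLocalSaddle J A Z k lam Λ ε ρ) {x z : F} (hz : ‖z - A x‖ ≤ ε * ‖x‖) :
    (lam - ε) * ‖x‖ ^ 2 ≤ inner ℝ (J x) z := by
  have h1 := h.form.coercive x
  have h2 : inner ℝ (J x) z = inner ℝ (J x) (A x) + inner ℝ (J x) (z - A x) := by
    rw [← inner_add_right]; congr 1; abel
  have h3 := abs_real_inner_le_norm (J x) (z - A x)
  rw [h.form.norm_map] at h3
  have h4 := (abs_le.1 h3).1
  nlinarith [norm_nonneg x]

/-- Since q(x) - q(y) = ⟨J(x - y), x + y⟩, replacing x - y and x + y by their images under `k` costs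
a multiple of ε each. No derivative of `k` is needed, and only Lipschitz closeness to the identity
is available. -/
theorem abs_quad_k_sub_le (h : IsLocalSaddle J A Z k lam Λ ε ρ) {x y : F}
    (hx : x ∈ Metric.ball (0 : F) ρ) (hy : y ∈ Metric.ball (0 : F) ρ) :
    |quad J (k x) - quad J (k y) - inner ℝ (J (x - y)) (x + y)| ≤
      3 * ε * ‖x - y‖ * (‖x‖ + ‖y‖) := by
  have e : quad J (k x) - quad J (k y) - inner ℝ (J (x - y)) (x + y) =
      inner ℝ (J (k x - k y - (x - y))) (k x + k y) +
        inner ℝ (J (x - y)) ((k x - x) + (k y - y)) := by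
    rw [h.form.quad_sub, map_sub J (k x - k y) (x - y), inner_sub_left,
      show (k x - x) + (k y - y) = (k x + k y) - (x + y) by abel, inner_sub_right]
    ring
  have h1 := abs_real_inner_le_norm (J (k x - k y - (x - y))) (k x + k y)
  have h2 := abs_real_inner_le_norm (J (x - y)) ((k x - x) + (k y - y))
  rw [h.form.norm_map] at h1 h2
  have h3 : ‖k x + k y‖ ≤ 1.01 * (‖x‖ + ‖y‖) := by
    have := norm_add_le (k x) (k y)
    linarith [h.norm_k_le hx, h.norm_k_le hy]
  have h4 : ‖(k x - x) + (k y - y)‖ ≤ ε * (‖x‖ + ‖y‖) := by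
    have := norm_add_le (k x - x) (k y - y)
    linarith [h.norm_k_sub_le hx, h.norm_k_sub_le hy]
  rw [e]
  refine (abs_add_le _ _).trans ((add_le_add h1 h2).trans ?_)
  have h5 : ‖k x - k y - (x - y)‖ * ‖k x + k y‖ ≤
      (ε * ‖x - y‖) * (1.01 * (‖x‖ + ‖y‖)) :=
    mul_le_mul (h.k_approx x hx y hy) h3 (norm_nonneg _)
      (mul_nonneg h.eps_nonneg (norm_nonneg _))
  have h6 : ‖x - y‖ * ‖(k x - x) + (k y - y)‖ ≤ ‖x - y‖ * (ε * (‖x‖ + ‖y‖)) :=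
    mul_le_mul_of_nonneg_left h4 (norm_nonneg _)
  have h7 : 0 ≤ ε * ‖x - y‖ * (‖x‖ + ‖y‖) :=
    mul_nonneg (mul_nonneg h.eps_nonneg (norm_nonneg _)) (by positivity)
  nlinarith

/-- The region q ∘ k ≥ 0 lies in a slightly widened cone, where the unstable component still
dominates. -/
theorem neg_le_quad (h : IsLocalSaddle J A Z k lam Λ ε ρ) {x : F} (hx : x ∈ Metric.ball (0 : F) ρ)
    (hq : 0 ≤ quad J (k x)) : -(4 * ε * ‖x‖ ^ 2) ≤ quad J x := by
  have h1 := h.abs_quad_k_sub_le hx h.zero_mem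
  simp only [h.k_zero, sub_zero, add_zero, norm_zero] at h1
  have h2 := (abs_le.1 h1).2
  have h3 : quad J (0 : F) = 0 := by simp [quad]
  change quad J (k x) - quad J 0 - quad J x ≤ _ at h2
  have : 0 ≤ ε * ‖x‖ ^ 2 := mul_nonneg h.eps_nonneg (by positivity)
  nlinarith

/-- In the widened cone u = w + Jw, twice the unstable component, satisfies ‖w‖ ≤ ‖u‖ ≤ 2‖w‖.
Moreover Ju = u and u' - Au has norm at most 2ε‖u‖, so ‖u‖ grows at rate at least λ/2. The statement
concerns a curve and not an orbit because differences of two orbits also satisfy it. -/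
theorem norm_le_of_quad (h : IsLocalSaddle J A Z k lam Λ ε ρ) {w w' : ℝ → F} {a b : ℝ} (hab : a ≤ b)
    (hd : ∀ t ∈ Icc a b, HasDerivAt w (w' t) t)
    (hw : ∀ t ∈ Icc a b, ‖w' t - A (w t)‖ ≤ ε * ‖w t‖)
    (hq : ∀ t ∈ Icc a b, -(4 * ε * ‖w t‖ ^ 2) ≤ quad J (w t)) :
    ‖w a‖ ≤ 2 * Real.exp (-(lam / 2) * (b - a)) * ‖w b‖ := by
  have hε := h.eps_le
  have hlam := h.lam_le_one
  have hε0 := h.eps_nonneg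
  have hsq : ∀ t ∈ Icc a b, ‖w t‖ ≤ ‖w t + J (w t)‖ := by
    intro t ht
    have h1 : ‖w t + J (w t)‖ ^ 2 = 2 * ‖w t‖ ^ 2 + 2 * quad J (w t) := by
      rw [norm_add_sq_real, h.form.norm_map, quad, real_inner_comm (w t)]; ring
    have h2 := hq t ht
    refine (sq_le_sq₀ (norm_nonneg _) (norm_nonneg _)).1 ?_
    nlinarith [sq_nonneg ‖w t‖]
  have h1 := exp_mul_norm_le_norm (z := fun t => w t + J (w t)) (z' := fun t => w' t + J (w' t))
    (c := lam / 2) hab (fun t ht => (hd t ht).add (J.hasFDerivAt.comp_hasDerivAt t (hd t ht))) ?_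
  · have h2 := hsq a (left_mem_Icc.2 hab)
    have h3 : ‖w b + J (w b)‖ ≤ 2 * ‖w b‖ := by
      have := norm_add_le (w b) (J (w b))
      rw [h.form.norm_map] at this
      linarith
    have h4 : Real.exp (lam / 2 * (b - a)) * ‖w a‖ ≤ 2 * ‖w b‖ :=
      (mul_le_mul_of_nonneg_left h2 (Real.exp_pos _).le).trans (h1.trans h3)
    have h5 := mul_le_mul_of_nonneg_left h4 (Real.exp_pos (-(lam / 2) * (b - a))).le
    rw [← mul_assoc, ← Real.exp_add] at h5
    ring_nf at h5 ⊢
    simpa using h5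
  · intro t ht
    set u := w t + J (w t) with hu
    have hJu : J u = u := by rw [hu, map_add, h.form.invol, add_comm]
    have e : w' t + J (w' t) = A u + ((w' t - A (w t)) + J (w' t - A (w t))) := by
      rw [hu, map_add, map_sub, h.form.comm]; abel
    have h2 := h.form.coercive u
    rw [hJu] at h2
    have h3 : ‖(w' t - A (w t)) + J (w' t - A (w t))‖ ≤ 2 * ε * ‖u‖ := by
      have := norm_add_le (w' t - A (w t)) (J (w' t - A (w t)))
      rw [h.form.norm_map] at this
      have h4 := hw t ht
      have h5 := mul_le_mul_of_nonneg_left (hsq t ht) hε0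
      linarith
    have h6 := (abs_le.1 (abs_real_inner_le_norm u ((w' t - A (w t)) + J (w' t - A (w t))))).1
    have h7 : ‖u‖ * ‖(w' t - A (w t)) + J (w' t - A (w t))‖ ≤ ‖u‖ * (2 * ε * ‖u‖) :=
      mul_le_mul_of_nonneg_left h3 (norm_nonneg _)
    change lam / 2 * ‖u‖ ^ 2 ≤ inner ℝ u (w' t + J (w' t))
    rw [e, inner_add_right]
    nlinarith [sq_nonneg ‖u‖]

theorem abs_inner_le (h : IsLocalSaddle J A Z k lam Λ ε ρ) {x z : F} (hz : ‖z - A x‖ ≤ ε * ‖x‖) :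
    |inner ℝ x z| ≤ 2 * Λ * ‖x‖ ^ 2 := by
  have h1 := abs_real_inner_le_norm x z
  have h2 := norm_le_norm_add_norm_sub' z (A x)
  have h3 := A.le_of_opNorm_le h.norm_le x
  have h4 : ‖z‖ ≤ 2 * Λ * ‖x‖ := by
    nlinarith [h.eps_le, h.lam_le_one, norm_nonneg x, h.one_le]
  refine h1.trans ?_
  have := mul_le_mul_of_nonneg_left h4 (norm_nonneg x)
  linarith

theorem norm_orbit_le (h : IsLocalSaddle J A Z k lam Λ ε ρ) {z : ℝ → F} {a b : ℝ} (hab : a ≤ b)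
    (hd : ∀ t ∈ Icc a b, HasDerivAt z (Z (z t)) t)
    (hz : ∀ t ∈ Icc a b, z t ∈ Metric.ball (0 : F) ρ) :
    ‖z b‖ ≤ Real.exp (2 * Λ * (b - a)) * ‖z a‖ :=
  norm_le_exp_mul_norm hab hd fun t ht =>
    (le_abs_self _).trans (h.abs_inner_le (h.norm_Z_sub_le (hz t ht)))

theorem le_norm_orbit (h : IsLocalSaddle J A Z k lam Λ ε ρ) {z : ℝ → F} {a b : ℝ} (hab : a ≤ b)
    (hd : ∀ t ∈ Icc a b, HasDerivAt z (Z (z t)) t)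
    (hz : ∀ t ∈ Icc a b, z t ∈ Metric.ball (0 : F) ρ) :
    Real.exp (-(2 * Λ) * (b - a)) * ‖z a‖ ≤ ‖z b‖ :=
  exp_mul_norm_le_norm hab hd fun t ht => by
    have := (abs_le.1 (h.abs_inner_le (h.norm_Z_sub_le (hz t ht)))).1
    linarith

theorem norm_le_of_orbit (h : IsLocalSaddle J A Z k lam Λ ε ρ) {z : ℝ → F} {a b : ℝ} (hab : a ≤ b)
    (hd : ∀ t ∈ Icc a b, HasDerivAt z (Z (z t)) t)
    (hz : ∀ t ∈ Icc a b, z t ∈ Metric.ball (0 : F) ρ)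
    (hq : ∀ t ∈ Icc a b, 0 ≤ quad J (k (z t))) :
    ‖z a‖ ≤ 2 * Real.exp (-(lam / 2) * (b - a)) * ‖z b‖ :=
  h.norm_le_of_quad hab hd (fun t ht => h.norm_Z_sub_le (hz t ht))
    fun t ht => h.neg_le_quad (hz t ht) (hq t ht)

/-- On a line in a direction of the cone there is at most one point whose orbit stays near the
saddle in the future. -/
theorem eq_of_forall_mem_ball (h : IsLocalSaddle J A Z k lam Λ ε ρ) {z₁ z₂ : ℝ → F}
    (hd₁ : ∀ t, 0 ≤ t → HasDerivAt z₁ (Z (z₁ t)) t) (hd₂ : ∀ t, 0 ≤ t → HasDerivAt z₂ (Z (z₂ t)) t)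
    (h₁ : ∀ t, 0 ≤ t → z₁ t ∈ Metric.ball (0 : F) ρ)
    (h₂ : ∀ t, 0 ≤ t → z₂ t ∈ Metric.ball (0 : F) ρ)
    (hq : quad J (z₁ 0 - z₂ 0) = 0) : z₁ 0 = z₂ 0 := by
  set w : ℝ → F := fun t => z₁ t - z₂ t with hw
  have hd : ∀ t, 0 ≤ t → HasDerivAt w (Z (z₁ t) - Z (z₂ t)) t := fun t ht =>
    (hd₁ t ht).sub (hd₂ t ht)
  have hA : ∀ t, 0 ≤ t → ‖Z (z₁ t) - Z (z₂ t) - A (w t)‖ ≤ ε * ‖w t‖ := fun t ht =>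
    h.Z_approx _ (h₁ t ht) _ (h₂ t ht)
  have hqd : ∀ t, 0 ≤ t → HasDerivAt (fun t => quad J (w t))
      (2 * inner ℝ (J (w t)) (Z (z₁ t) - Z (z₂ t))) t := by
    intro t ht
    have h1 := (J.hasFDerivAt.comp_hasDerivAt t (hd t ht)).inner ℝ (hd t ht)
    refine h1.congr_deriv ?_
    rw [h.form.symm (Z (z₁ t) - Z (z₂ t)), real_inner_comm (J (w t)), two_mul]
    rfl
  -- The form starts at 0 on the difference and increases, so the difference stays where it is
  -- expanded at rate λ/2; being bounded by 2ρ for all times, it is 0.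
  have hmono : MonotoneOn (fun t => quad J (w t)) (Ici 0) := by
    apply monotoneOn_of_deriv_nonneg (convex_Ici 0)
    · exact fun t ht => (hqd t ht).continuousAt.continuousWithinAt
    · intro t ht
      rw [interior_Ici] at ht
      exact (hqd t (le_of_lt ht)).differentiableAt.differentiableWithinAt
    · intro t ht
      rw [interior_Ici] at ht
      rw [(hqd t (le_of_lt ht)).deriv]
      have := h.inner_map_Z (hA t (le_of_lt ht))
      have h2 : 0 ≤ (lam - ε) * ‖w t‖ ^ 2 :=
        mul_nonneg (by linarith [h.eps_le, h.lam_pos]) (sq_nonneg _)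
      linarith
  have hb : ∀ T, 0 ≤ T → ‖w 0‖ ≤ 4 * ρ * Real.exp (-(lam / 2) * T) := by
    intro T hT
    have h1 := h.norm_le_of_quad hT (fun t ht => hd t ht.1) (fun t ht => hA t ht.1) (fun t ht => by
      have h3 : quad J (w 0) ≤ quad J (w t) :=
        hmono (mem_Ici.2 le_rfl) (mem_Ici.2 ht.1) ht.1
      rw [show quad J (w 0) = 0 from hq] at h3
      have : 0 ≤ ε * ‖w t‖ ^ 2 := mul_nonneg h.eps_nonneg (by positivity)
      linarith)
    have h2 : ‖w T‖ ≤ 2 * ρ := by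
      have := norm_sub_le (z₁ T) (z₂ T)
      have h3 := mem_ball_zero_iff.1 (h₁ T hT)
      have h4 := mem_ball_zero_iff.1 (h₂ T hT)
      simp only [hw]; linarith
    rw [sub_zero] at h1
    refine h1.trans ?_
    have := mul_le_mul_of_nonneg_left h2 (Real.exp_pos (-(lam / 2) * T)).le
    linarith
  have hlim : Tendsto (fun T : ℝ => 4 * ρ * Real.exp (-(lam / 2) * T)) atTop (𝓝 0) := by
    have : Tendsto (fun t : ℝ => Real.exp (-(lam / 2) * t)) atTop (𝓝 0) := by
      apply Real.tendsto_exp_atBot.comp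
      exact tendsto_id.const_mul_atTop_of_neg (by linarith [h.lam_pos])
    simpa using this.const_mul (4 * ρ)
  have h0 : ‖w 0‖ ≤ 0 := ge_of_tendsto hlim (by
    filter_upwards [eventually_ge_atTop 0] with T hT using hb T hT)
  exact sub_eq_zero.1 (norm_le_zero_iff.1 h0)

end IsLocalSaddle

/-- Increase immediately to the right of each point, plus continuity, propagates by continuous
induction. This replaces a derivative test, since q ∘ k along an orbit need not be differentiable.
-/
theorem strictMonoOn_of_eventually_lt {g : ℝ → ℝ} {a b : ℝ} (hg : ContinuousOn g (Icc a b))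
    (h : ∀ t ∈ Ico a b, ∀ᶠ s in 𝓝[>] t, g t < g s) : StrictMonoOn g (Icc a b) := by
  have hmono : MonotoneOn g (Icc a b) := by
    intro s hs t ht hst
    have hsub : Icc s t ⊆ Icc a b := Icc_subset_Icc hs.1 ht.2
    have key : Icc s t ⊆ {r | g s ≤ g r} := by
      refine IsClosed.Icc_subset_of_forall_exists_gt ?_ (le_refl (g s)) ?_
      · have := (hg.mono hsub).preimage_isClosed_of_isClosed isClosed_Icc (isClosed_Ici (a := g s))
        rwa [inter_comm] at this
      · rintro x ⟨hx, hx'⟩ y hy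
        have h1 := h x ⟨hs.1.trans hx'.1, hx'.2.trans_le ht.2⟩
        obtain ⟨r, hr1, hr2⟩ := (h1.and (Ioc_mem_nhdsGT hy)).exists
        exact ⟨r, le_trans hx hr1.le, hr2⟩
    exact key (right_mem_Icc.2 hst)
  intro s hs t ht hst
  have h1 := h s ⟨hs.1, hst.trans_le ht.2⟩
  obtain ⟨r, hr1, hr2⟩ := (h1.and (Ioc_mem_nhdsGT hst)).exists
  exact hr1.trans_le (hmono ⟨hs.1.trans hr2.1.le, hr2.2.trans ht.2⟩ ht hr2.2)

namespace IsLocalSaddle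

variable {J A : F →L[ℝ] F} {Z k : F → F} {lam Λ ε ρ : ℝ}

/-- If `c (ζ' - ζ)` is close to `Z ζ`, with `ζ'` close to `ζ`, then `c (q(k ζ') - q(k ζ))` is bounded
below. -/
theorem pos_of_tendsto (h : IsLocalSaddle J A Z k lam Λ ε ρ) {z : F}
    (hz : z ∈ Metric.ball (0 : F) ρ) (hz0 : z ≠ 0) {α : Type*} {l : Filter α} {c : α → ℝ}
    {d : α → F} (hd : Tendsto d l (𝓝 0)) (hcd : Tendsto (fun n => c n • d n) l (𝓝 (Z z))) :
    ∀ᶠ n in l, 0 < c n * (quad J (k (z + d n)) - quad J (k z)) := by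
  -- The lower bound tends to 2⟨Jz, Zz⟩ - 6ε‖Zz‖‖z‖, positive because ε is small relative to λ/Λ.
  -- The general filter serves both difference quotients along an orbit and sequences representing a
  -- tangent vector.
  have hlim : Tendsto (fun n => inner ℝ (J (c n • d n)) (z + d n + z) -
      3 * ε * ‖c n • d n‖ * (‖z + d n‖ + ‖z‖)) l
      (𝓝 (inner ℝ (J (Z z)) (z + 0 + z) - 3 * ε * ‖Z z‖ * (‖z + 0‖ + ‖z‖))) := by
    have h1 : Tendsto (fun n => z + d n) l (𝓝 (z + 0)) := tendsto_const_nhds.add hd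
    exact (((J.continuous.tendsto _).comp hcd).inner (h1.add tendsto_const_nhds)).sub
      ((hcd.norm.const_mul _).mul (h1.norm.add tendsto_const_nhds))
  have hpos : 0 < inner ℝ (J (Z z)) (z + 0 + z) - 3 * ε * ‖Z z‖ * (‖z + 0‖ + ‖z‖) := by
    have h1 := h.inner_map_Z (h.norm_Z_sub_le hz)
    have h2 := h.norm_Z_le hz
    have h3 : 0 < ‖z‖ := norm_pos_iff.2 hz0
    have h4 : ε * ‖Z z‖ ≤ ε * (2 * Λ * ‖z‖) := mul_le_mul_of_nonneg_left h2 h.eps_nonneg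
    have h5 : ε * ‖Z z‖ ≤ lam / 50 * ‖z‖ := by nlinarith [h.eps_small]
    rw [add_zero, inner_add_right, h.form.symm, real_inner_comm]
    have h6 : 0 < lam * ‖z‖ ^ 2 := mul_pos h.lam_pos (by positivity)
    have h7 := mul_le_mul_of_nonneg_right h5 h3.le
    have h8 : ε * ‖z‖ ^ 2 ≤ lam / 100 * ‖z‖ ^ 2 :=
      mul_le_mul_of_nonneg_right (by linarith [h.eps_le]) (sq_nonneg _)
    nlinarith
  have hball : ∀ᶠ n in l, z + d n ∈ Metric.ball (0 : F) ρ := by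
    have h1 : Tendsto (fun n => z + d n) l (𝓝 z) := by simpa using tendsto_const_nhds.add hd
    exact h1.eventually (Metric.isOpen_ball.mem_nhds hz)
  filter_upwards [hlim.eventually (lt_mem_nhds hpos), hball] with n hn hb
  refine hn.trans_le ?_
  have h1 := h.abs_quad_k_sub_le hb hz
  rw [add_sub_cancel_left] at h1
  have h2 : |c n * (quad J (k (z + d n)) - quad J (k z)) -
      inner ℝ (J (c n • d n)) (z + d n + z)| ≤ 3 * ε * ‖c n • d n‖ * (‖z + d n‖ + ‖z‖) := by
    rw [map_smul, real_inner_smul_left, ← mul_sub, abs_mul, norm_smul, Real.norm_eq_abs]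
    have := mul_le_mul_of_nonneg_left h1 (abs_nonneg (c n))
    linarith
  linarith [(abs_le.1 h2).1]

theorem strictMonoOn_quad (h : IsLocalSaddle J A Z k lam Λ ε ρ) {z : ℝ → F} {a b : ℝ}
    (hd : ∀ t ∈ Icc a b, HasDerivAt z (Z (z t)) t)
    (hz : ∀ t ∈ Icc a b, z t ∈ Metric.ball (0 : F) ρ) (hz0 : ∀ t ∈ Icc a b, z t ≠ 0) :
    StrictMonoOn (fun t => quad J (k (z t))) (Icc a b) := by
  have hc : ContinuousOn z (Icc a b) := fun t ht => (hd t ht).continuousAt.continuousWithinAt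
  refine strictMonoOn_of_eventually_lt
    ((continuous_quad J).comp_continuousOn (h.continuousOn_k.comp hc hz)) fun t ht => ?_
  have ht' : t ∈ Icc a b := Ico_subset_Icc_self ht
  have h1 := h.pos_of_tendsto (hz t ht') (hz0 t ht') (l := 𝓝[>] t) (c := fun s => (s - t)⁻¹)
    (d := fun s => z s - z t) ?_ ?_
  · filter_upwards [h1, self_mem_nhdsWithin] with s hs hst
    rw [add_sub_cancel] at hs
    have : 0 < (s - t)⁻¹ := inv_pos.2 (sub_pos.2 hst)
    have := (mul_pos_iff_of_pos_left this).1 hs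
    linarith
  · have := (hd t ht').continuousAt.tendsto.mono_left (nhdsWithin_le_nhds (s := Ioi t))
    simpa using this.sub_const (z t)
  · have := (hasDerivAt_iff_tendsto_slope.1 (hd t ht')).mono_left
      (nhdsWithin_mono t (show Ioi t ⊆ {t}ᶜ from fun s hs => ne_of_gt hs))
    exact this

/-- If Z z were tangent to `S`, q ∘ k would take a different value at some point of `S` near z,
whereas it vanishes on `S`. -/
theorem notMem_tangentConeAt (h : IsLocalSaddle J A Z k lam Λ ε ρ) {z : F}
    (hz : z ∈ Metric.ball (0 : F) ρ) (hz0 : z ≠ 0) {S : Set F} (hS : ∀ x ∈ S, quad J (k x) = 0)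
    (hzS : z ∈ S) : Z z ∉ tangentConeAt ℝ S z := by
  intro hmem
  obtain ⟨α, l, hl, c, d, hd, hdS, hcd⟩ := exists_fun_of_mem_tangentConeAt hmem
  obtain ⟨n, hn1, hn2⟩ := ((h.pos_of_tendsto hz hz0 hd hcd).and hdS).exists
  rw [hS _ hn2, hS _ hzS, sub_self, mul_zero] at hn1
  exact lt_irrefl _ hn1

end IsLocalSaddle

end LocalSaddle

end SingularFlow

namespace SingularFlow

/-! ### First exit from a ball. -/

section ExitTime

variable {M : Type*} [MetricSpace M]

/-- An orbit that starts in a ball and leaves it crosses the boundary for the first time at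
`exitTime`. -/
theorem exitTime_spec (φ : Flow ℝ M) {p x : M} {r T : ℝ} (hx : x ∈ Metric.ball p r) (hT : 0 ≤ T)
    (hxT : φ T x ∉ Metric.ball p r) :
    0 < exitTime φ p r x ∧ exitTime φ p r x ≤ T ∧
      φ (exitTime φ p r x) x ∈ frontier (Metric.ball p r) ∧
      ∀ t, 0 ≤ t → t < exitTime φ p r x → φ t x ∈ Metric.ball p r := by
  have hc : Continuous fun t => φ t x := φ.continuous continuous_id continuous_const
  set s : Set ℝ := Icc 0 T ∩ (fun t => φ t x) ⁻¹' (Metric.ball p r)ᶜ with hs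
  have hsc : IsClosed s :=
    isClosed_Icc.inter (Metric.isOpen_ball.isClosed_compl.preimage hc)
  have hne : s.Nonempty := ⟨T, ⟨hT, le_rfl⟩, hxT⟩
  have hbd : BddBelow s := ⟨0, fun t ht => ht.1.1⟩
  have hmem := hsc.csInf_mem hne hbd
  set e := sInf s with he
  have hbefore : ∀ t, 0 ≤ t → t < e → φ t x ∈ Metric.ball p r := by
    intro t ht hte
    by_contra hn
    exact absurd (csInf_le hbd ⟨⟨ht, hte.le.trans hmem.1.2⟩, hn⟩) (not_le.2 hte)
  have he0 : 0 < e := by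
    refine lt_of_le_of_ne hmem.1.1 fun h0 => hmem.2 ?_
    simpa only [mem_preimage, ← h0, Flow.map_zero_apply] using hx
  have hfr : φ e x ∈ frontier (Metric.ball p r) := by
    rw [frontier, Metric.isOpen_ball.interior_eq]
    refine ⟨?_, hmem.2⟩
    refine mem_closure_of_tendsto (hc.continuousAt.tendsto.mono_left
      (nhdsWithin_le_nhds (s := Iio e) (a := e))) ?_
    filter_upwards [Ioo_mem_nhdsLT he0] with t ht using hbefore t ht.1.le ht.2
  have hleast : IsLeast {τ : ℝ | 0 < τ ∧ φ τ x ∈ frontier (Metric.ball p r)} e := by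
    refine ⟨⟨he0, hfr⟩, fun τ hτ => ?_⟩
    by_contra hn
    have h1 := hbefore τ hτ.1.le (not_le.1 hn)
    have h2 := hτ.2
    rw [frontier, Metric.isOpen_ball.interior_eq] at h2
    exact h2.2 h1
  have hee : exitTime φ p r x = e := hleast.csInf_eq
  rw [hee]
  exact ⟨he0, hmem.1.2, hfr, hbefore⟩

theorem entryTime_eq (φ : Flow ℝ M) (p x : M) (r : ℝ) :
    entryTime φ p r x = exitTime φ.reverse p r x := rfl

end ExitTime

theorem sqrt_two_bounds : 1.414 ≤ √2 ∧ √2 ≤ 1.415 :=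
  ⟨Real.le_sqrt_of_sq_le (by norm_num), Real.sqrt_le_iff.2 (by norm_num)⟩

/-! ### Orbits in a small ball around the saddle. -/

section SaddleBall

variable {M : Type*} [MetricSpace M] {F : Type*} [NormedAddCommGroup F] [InnerProductSpace ℝ F]

/-- The part of the cone `q ∘ k ∘ ζ = 0` where the box norm is in `[s, t)`. -/
def coordShell (ζ : OpenPartialHomeomorph M F) (J : F →L[ℝ] F) (k : F → F) (s t : ℝ) : Set M :=
  {x | x ∈ ζ.source ∧ quad J (k (ζ x)) = 0 ∧ s ≤ ‖k (ζ x)‖ / √2 ∧ ‖k (ζ x)‖ / √2 < t}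

theorem coordShell_neg (ζ : OpenPartialHomeomorph M F) (J : F →L[ℝ] F) (k : F → F) (s t : ℝ) :
    coordShell ζ (-J) k s t = coordShell ζ J k s t := by
  simp only [coordShell, quad_neg, neg_eq_zero]

/-- The layer of index `n` in coordinates. -/
def coordLayer (ζ : OpenPartialHomeomorph M F) (J : F →L[ℝ] F) (k : F → F) (n : ℕ) : Set M :=
  coordShell ζ J k (Real.exp (-((n : ℝ) + 1))) (Real.exp (-(n : ℝ)))

/-- Coordinates `ζ` on a metric space in which a field `Z` is close to a saddle and a map `k` is
close to the identity, with a ball small enough to be studied in these coordinates. -/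
structure IsSaddleChart (ζ : OpenPartialHomeomorph M F) (p : M) (J A : F →L[ℝ] F)
    (Z k : F → F) (lam Λ ε ρ m r : ℝ) (N : ℕ) : Prop extends
    IsLocalSaddle J A Z k lam Λ ε ρ where
  rho_le : ρ ≤ 1 / 2
  target_eq : ζ.target = Metric.ball 0 ρ
  mem_source : p ∈ ζ.source
  map_vertex : ζ p = 0
  m_pos : 0 < m
  le_dist : ∀ x ∈ ζ.source, 10 * ‖ζ x‖ ≤ dist x p
  dist_le : ∀ x ∈ ζ.source, dist x p ≤ m * ‖ζ x‖
  cone : ∃ w, w ≠ 0 ∧ quad J w = 0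
  r_pos : 0 < r
  closedBall_subset : Metric.closedBall p r ⊆ ζ.source
  le_r : 2 * m * Real.exp (-((N : ℝ) / 2)) ≤ r
  le_N : 8 * Λ ≤ N

/-- A flow which in the coordinates `ζ` is the flow of a field near a saddle. -/
structure IsSaddleBall (ζ : OpenPartialHomeomorph M F) (p : M) (φ : Flow ℝ M) (J A : F →L[ℝ] F)
    (Z k : F → F) (lam Λ ε ρ m r : ℝ) (N : ℕ) : Prop extends
    IsSaddleChart ζ p J A Z k lam Λ ε ρ m r N where
  fixed : ∀ t, φ t p = p
  hasDerivAt : ∀ x t, φ t x ∈ ζ.source → HasDerivAt (fun s => ζ (φ s x)) (Z (ζ (φ t x))) t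

namespace IsSaddleChart

variable {ζ : OpenPartialHomeomorph M F} {p : M} {J A : F →L[ℝ] F}
  {Z k : F → F} {lam Λ ε ρ m r : ℝ} {N : ℕ}

theorem reverse (h : IsSaddleChart ζ p J A Z k lam Λ ε ρ m r N) :
    IsSaddleChart ζ p (-J) (-A) (-Z) k lam Λ ε ρ m r N where
  toIsLocalSaddle := h.toIsLocalSaddle.neg
  rho_le := h.rho_le
  target_eq := h.target_eq
  mem_source := h.mem_source
  map_vertex := h.map_vertex
  m_pos := h.m_pos
  le_dist := h.le_dist
  dist_le := h.dist_le
  cone := by simpa only [quad_neg, neg_eq_zero] using h.cone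
  r_pos := h.r_pos
  closedBall_subset := h.closedBall_subset
  le_r := h.le_r
  le_N := h.le_N

theorem mem_ball_of_mem_source (h : IsSaddleChart ζ p J A Z k lam Λ ε ρ m r N) {x : M}
    (hx : x ∈ ζ.source) : ζ x ∈ Metric.ball (0 : F) ρ :=
  h.target_eq ▸ ζ.map_source hx

theorem one_le_of_lt (h : IsSaddleChart ζ p J A Z k lam Λ ε ρ m r N) {n : ℕ} (hn : N < n) :
    8 * Λ ≤ n := h.le_N.trans (by exact_mod_cast hn.le)

theorem map_ne_zero (h : IsSaddleChart ζ p J A Z k lam Λ ε ρ m r N) {x : M}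
    (hx : x ∈ ζ.source) (hxp : x ≠ p) : ζ x ≠ 0 := fun h0 =>
  hxp (ζ.injOn hx h.mem_source (h0.trans h.map_vertex.symm))

theorem layer_subset_section (ζ : OpenPartialHomeomorph M F) (J : F →L[ℝ] F) (k : F → F) {n N : ℕ}
    (hn : N < n) : coordLayer ζ J k n ⊆ coordShell ζ J k 0 (Real.exp (-((N : ℝ) + 1))) := by
  rintro x ⟨h1, h2, h3, h4⟩
  refine ⟨h1, h2, by positivity, h4.trans_le (Real.exp_le_exp.2 ?_)⟩
  have : (N : ℝ) + 1 ≤ n := by exact_mod_cast hn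
  linarith

/-- On the cone the Euclidean norm is √2 times the box norm; the constants come from √2/1.01 > 1 and
√2/0.99 < 1.5. -/
theorem norm_bounds (h : IsSaddleChart ζ p J A Z k lam Λ ε ρ m r N) {n : ℕ} {x : M}
    (hx : x ∈ coordLayer ζ J k n) :
    Real.exp (-((n : ℝ) + 1)) < ‖ζ x‖ ∧ ‖ζ x‖ ≤ 1.5 * Real.exp (-(n : ℝ)) := by
  obtain ⟨h1, h2, h3, h4⟩ := hx
  have hb := h.mem_ball_of_mem_source h1
  have e1 := h.toIsLocalSaddle.norm_k_le hb
  have e2 := h.toIsLocalSaddle.le_norm_k hb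
  obtain ⟨s1, s2⟩ := sqrt_two_bounds
  rw [le_div_iff₀ (by positivity)] at h3
  rw [div_lt_iff₀ (by positivity)] at h4
  have p1 := Real.exp_pos (-((n : ℝ) + 1))
  have p2 := Real.exp_pos (-(n : ℝ))
  constructor <;> nlinarith

theorem ne_of_mem_layer (h : IsSaddleChart ζ p J A Z k lam Λ ε ρ m r N) {n : ℕ} {x : M}
    (hx : x ∈ coordLayer ζ J k n) : x ≠ p := by
  rintro rfl
  have := (h.norm_bounds hx).1
  rw [h.map_vertex, norm_zero] at this
  exact absurd this (not_lt.2 (Real.exp_pos _).le)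

theorem exp_half (h : IsSaddleChart ζ p J A Z k lam Λ ε ρ m r N) {n : ℕ} (hn : N ≤ n) :
    2 * m * Real.exp (-((n : ℝ) / 2)) ≤ r := by
  refine le_trans ?_ h.le_r
  have : (N : ℝ) ≤ n := by exact_mod_cast hn
  have := h.m_pos
  gcongr

theorem exp_le_r (h : IsSaddleChart ζ p J A Z k lam Λ ε ρ m r N) {n : ℕ} (hn : N ≤ n) :
    2 * m * Real.exp (-(n : ℝ)) ≤ r := by
  refine le_trans ?_ (h.exp_half hn)
  have : (0 : ℝ) ≤ n := n.cast_nonneg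
  have := h.m_pos
  gcongr
  linarith

theorem mem_ball_of_norm_le (h : IsSaddleChart ζ p J A Z k lam Λ ε ρ m r N) {x : M}
    (hx : x ∈ ζ.source) (hN : ‖ζ x‖ ≤ 1.5 * Real.exp (-(N : ℝ))) : x ∈ Metric.ball p r := by
  have h2 := h.dist_le x hx
  have h3 := h.exp_le_r le_rfl
  have h4 := mul_le_mul_of_nonneg_left hN h.m_pos.le
  have h5 := mul_pos h.m_pos (Real.exp_pos (-(N : ℝ)))
  rw [Metric.mem_ball]
  linarith

theorem mem_ball_of_mem_layer (h : IsSaddleChart ζ p J A Z k lam Λ ε ρ m r N) {n : ℕ} (hn : N < n)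
    {x : M} (hx : x ∈ coordLayer ζ J k n) : x ∈ Metric.ball p r := by
  refine h.mem_ball_of_norm_le hx.1 ((h.norm_bounds hx).2.trans ?_)
  have : (N : ℝ) ≤ n := by exact_mod_cast hn.le
  gcongr

theorem norm_frontier (h : IsSaddleChart ζ p J A Z k lam Λ ε ρ m r N) {x : M}
    (hx : x ∈ frontier (Metric.ball p r)) : r ≤ m * ‖ζ x‖ ∧ x ∈ Metric.closedBall p r := by
  have h1 : dist x p = r := Metric.frontier_ball_subset_sphere hx
  have h2 : x ∈ Metric.closedBall p r := h1.le
  exact ⟨h1 ▸ h.dist_le x (h.closedBall_subset h2), h2⟩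

/-- A point of the section different from the vertex is in a layer. -/
theorem exists_mem_layer (h : IsSaddleChart ζ p J A Z k lam Λ ε ρ m r N) {x : M}
    (hx : x ∈ coordShell ζ J k 0 (Real.exp (-((N : ℝ) + 1)))) (hxp : x ≠ p) :
    ∃ n, N < n ∧ x ∈ coordLayer ζ J k n := by
  obtain ⟨h1, h2, h3, h4⟩ := hx
  have hy : 0 < ‖k (ζ x)‖ / √2 := by
    have e1 := h.toIsLocalSaddle.le_norm_k (h.mem_ball_of_mem_source h1)
    have e2 := norm_pos_iff.2 (h.map_ne_zero h1 hxp)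
    have : 0 < ‖k (ζ x)‖ := by linarith
    positivity
  set y := ‖k (ζ x)‖ / √2
  have hl : (N : ℝ) + 1 < -Real.log y := by
    have := Real.log_lt_log hy h4
    rw [Real.log_exp] at this
    linarith
  -- The index is ⌈-log y⌉ - 1: a layer contains its inner radius e^{-(n+1)} and not its outer
  -- radius e^{-n}.
  have hc : N + 1 < ⌈-Real.log y⌉₊ := by
    rw [Nat.lt_ceil]; push_cast; exact hl
  obtain ⟨n, hn⟩ : ∃ n, ⌈-Real.log y⌉₊ = n + 1 := ⟨⌈-Real.log y⌉₊ - 1, by omega⟩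
  refine ⟨n, by omega, h1, h2, ?_, ?_⟩
  · have e1 : -Real.log y ≤ (n : ℝ) + 1 := by
      have := Nat.le_ceil (-Real.log y)
      rw [hn] at this
      exact_mod_cast this
    rw [← Real.le_log_iff_exp_le hy]
    linarith
  · have e1 : (n : ℝ) < -Real.log y := by
      rw [← Nat.lt_ceil, hn]; exact Nat.lt_succ_self n
    rw [← Real.log_lt_iff_lt_exp hy]
    linarith

theorem layer_index_unique {n n' : ℕ} {x : M} (hx : x ∈ coordLayer ζ J k n)
    (hx' : x ∈ coordLayer ζ J k n') : n = n' := by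
  have h1 : (n : ℝ) < (n' : ℝ) + 1 := by
    have := hx'.2.2.1.trans_lt hx.2.2.2
    rw [Real.exp_lt_exp] at this
    linarith
  have h2 : (n' : ℝ) < (n : ℝ) + 1 := by
    have := hx.2.2.1.trans_lt hx'.2.2.2
    rw [Real.exp_lt_exp] at this
    linarith
  have h3 : n < n' + 1 := by exact_mod_cast h1
  have h4 : n' < n + 1 := by exact_mod_cast h2
  omega

end IsSaddleChart

namespace IsSaddleBall

variable {ζ : OpenPartialHomeomorph M F} {p : M} {φ : Flow ℝ M} {J A : F →L[ℝ] F}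
  {Z k : F → F} {lam Λ ε ρ m r : ℝ} {N : ℕ}

theorem reverse (h : IsSaddleBall ζ p φ J A Z k lam Λ ε ρ m r N) :
    IsSaddleBall ζ p φ.reverse (-J) (-A) (-Z) k lam Λ ε ρ m r N where
  toIsSaddleChart := h.toIsSaddleChart.reverse
  fixed t := h.fixed (-t)
  hasDerivAt x t hx := by
    have h1 := h.hasDerivAt x (-t) hx
    exact (h1.scomp t (hasDerivAt_neg t)).congr_deriv (by simp)

theorem flow_ne (h : IsSaddleBall ζ p φ J A Z k lam Λ ε ρ m r N) {x : M} (hxp : x ≠ p) (t : ℝ) :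
    φ t x ≠ p := by
  intro h0
  apply hxp
  have : φ (-t) (φ t x) = p := by rw [h0, h.fixed]
  rwa [← Flow.map_add, neg_add_cancel, Flow.map_zero_apply] at this

theorem strictMonoOn_orbit (h : IsSaddleBall ζ p φ J A Z k lam Λ ε ρ m r N) {x : M} (hxp : x ≠ p)
    {a b : ℝ} (hb : ∀ t ∈ Icc a b, φ t x ∈ Metric.closedBall p r) :
    StrictMonoOn (fun t => quad J (k (ζ (φ t x)))) (Icc a b) :=
  h.toIsLocalSaddle.strictMonoOn_quad (z := fun t => ζ (φ t x))
    (fun t ht => h.hasDerivAt x t (h.closedBall_subset (hb t ht)))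
    (fun t ht => h.mem_ball_of_mem_source (h.closedBall_subset (hb t ht)))
    (fun t ht => h.map_ne_zero (h.closedBall_subset (hb t ht)) (h.flow_ne hxp t))

theorem continuousOn_quad_orbit (h : IsSaddleBall ζ p φ J A Z k lam Λ ε ρ m r N) {x : M}
    {a b : ℝ} (hb : ∀ t ∈ Icc a b, φ t x ∈ Metric.closedBall p r) :
    ContinuousOn (fun t => quad J (k (ζ (φ t x)))) (Icc a b) :=
  (continuous_quad J).comp_continuousOn (h.toIsLocalSaddle.continuousOn_k.comp
    (fun t ht => (h.hasDerivAt x t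
      (h.closedBall_subset (hb t ht))).continuousAt.continuousWithinAt)
    (fun t ht => h.mem_ball_of_mem_source (h.closedBall_subset (hb t ht))))

/-- The exit time from the layer of index `n`. -/
theorem exitTime_layer (h : IsSaddleBall ζ p φ J A Z k lam Λ ε ρ m r N) {n : ℕ} (hn : N < n) {x : M}
    (hx : x ∈ coordLayer ζ J k n) :
    (n : ℝ) / (4 * Λ) ≤ exitTime φ p r x ∧ exitTime φ p r x ≤ 4 / lam * n ∧
      0 < exitTime φ p r x ∧ φ (exitTime φ p r x) x ∈ frontier (Metric.ball p r) ∧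
      (∀ t, 0 ≤ t → t < exitTime φ p r x → φ t x ∈ Metric.ball p r) ∧
      ∀ t ∈ Icc 0 (exitTime φ p r x), φ t x ∈ Metric.closedBall p r := by
  have hxr := h.mem_ball_of_mem_layer hn hx
  have hxp := h.ne_of_mem_layer hx
  have hn1 : (1 : ℝ) ≤ n := by
    have : 1 ≤ n := by omega
    exact_mod_cast this
  have hlam := h.lam_pos
  -- Upper bound: after the section q ∘ k ≥ 0, so staying for time 4n/λ would give e^{-(n+1)} <
  -- 2e^{-2n}ρ ≤ e^{-2n}, impossible for n ≥ 1.
  have hex : ∃ t ∈ Icc 0 (4 / lam * n), φ t x ∉ Metric.ball p r := by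
    by_contra! hcon
    have hcb : ∀ t ∈ Icc 0 (4 / lam * n), φ t x ∈ Metric.closedBall p r := fun t ht =>
      Metric.ball_subset_closedBall (hcon t ht)
    have hT : 0 ≤ 4 / lam * n := by positivity
    have hmono := h.strictMonoOn_orbit hxp hcb
    have h1 := h.toIsLocalSaddle.norm_le_of_orbit (z := fun t => ζ (φ t x)) hT
      (fun t ht => h.hasDerivAt x t (h.closedBall_subset (hcb t ht)))
      (fun t ht => h.mem_ball_of_mem_source (h.closedBall_subset (hcb t ht)))
      (fun t ht => by
        have := hmono.monotoneOn (left_mem_Icc.2 hT) ht ht.1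
        simp only [Flow.map_zero_apply, hx.2.1] at this
        exact this)
    have h2 := mem_ball_zero_iff.1 (h.mem_ball_of_mem_source
      (h.closedBall_subset (hcb _ (right_mem_Icc.2 hT))))
    have h3 := (h.norm_bounds hx).1
    simp only [Flow.map_zero_apply] at h1
    have h4 : Real.exp (-((n : ℝ) + 1)) < Real.exp (-(lam / 2) * (4 / lam * n - 0)) := by
      have := Real.exp_pos (-(lam / 2) * (4 / lam * n - 0))
      nlinarith [h.rho_le]
    rw [Real.exp_lt_exp] at h4
    have h5 : -(lam / 2) * (4 / lam * n - 0) = -(2 * n) := by field_simp; ring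
    linarith
  obtain ⟨T, hT, hTx⟩ := hex
  obtain ⟨e1, e2, e3, e4⟩ := exitTime_spec φ hxr hT.1 hTx
  set e := exitTime φ p r x
  have hcb : ∀ t ∈ Icc 0 e, φ t x ∈ Metric.closedBall p r := by
    intro t ht
    rcases ht.2.lt_or_eq with h1 | h1
    · exact Metric.ball_subset_closedBall (e4 t ht.1 h1)
    · rw [h1]; exact (h.norm_frontier e3).2
  refine ⟨?_, e2.trans hT.2, e1, e3, e4, hcb⟩
  have h1 := h.toIsLocalSaddle.norm_orbit_le (z := fun t => ζ (φ t x)) e1.le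
    (fun t ht => h.hasDerivAt x t (h.closedBall_subset (hcb t ht)))
    (fun t ht => h.mem_ball_of_mem_source (h.closedBall_subset (hcb t ht)))
  simp only [Flow.map_zero_apply, sub_zero] at h1
  have h2 := (h.norm_frontier e3).1
  have h3 := (h.norm_bounds hx).2
  have h4 := h.exp_half hn.le
  have hm := h.m_pos
  -- Lower bound: at the boundary ‖ζ‖ ≥ r/m ≥ 2e^{-n/2}, reached from at most 1.5e^{-n} at rate at
  -- most 2Λ.
  have h5 : 2 * Real.exp (-((n : ℝ) / 2)) ≤ Real.exp (2 * Λ * e) * (1.5 * Real.exp (-(n : ℝ))) := by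
    refine le_of_mul_le_mul_left ?_ hm
    have h6 := mul_le_mul_of_nonneg_left h3 (Real.exp_pos (2 * Λ * e)).le
    have h7 := mul_le_mul_of_nonneg_left (h1.trans h6) hm.le
    linarith
  have h8 : Real.exp (-((n : ℝ) / 2)) ≤ Real.exp (2 * Λ * e + -(n : ℝ)) := by
    rw [Real.exp_add]
    have := Real.exp_pos (-((n : ℝ) / 2))
    linarith
  rw [Real.exp_le_exp] at h8
  have := h.one_le
  rw [div_le_iff₀ (by positivity)]
  linarith

/-- Both points are zeros of q ∘ k ∘ ζ, which is strictly increasing along the orbit. -/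
theorem once (h : IsSaddleBall ζ p φ J A Z k lam Λ ε ρ m r N) {x : M} (hxp : x ≠ p) {a b : ℝ}
    (hb : ∀ t ∈ Icc a b, φ t x ∈ Metric.closedBall p r) {s t : ℝ} {R R' T T' : ℝ} (hs : s ∈ Icc a b)
    (ht : t ∈ Icc a b) (hxs : φ s x ∈ coordShell ζ J k R T) (hxt : φ t x ∈ coordShell ζ J k R' T') :
    s = t :=
  (h.strictMonoOn_orbit hxp hb).injOn hs ht (hxs.2.1.trans hxt.2.1.symm)

theorem eq_of_flow_mem_layer (h : IsSaddleBall ζ p φ J A Z k lam Λ ε ρ m r N) {n n' : ℕ}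
    (hn : N < n) {x : M} (hx : x ∈ coordLayer ζ J k n) {u : ℝ} (hu : 0 ≤ u)
    (hu' : u ≤ n / (4 * Λ)) (hux : φ u x ∈ coordLayer ζ J k n') : u = 0 := by
  obtain ⟨e1, e2, e3, e4, e5, e6⟩ := h.exitTime_layer hn hx
  have h0 : φ 0 x ∈ coordLayer ζ J k n := by rwa [Flow.map_zero_apply]
  exact (h.once (h.ne_of_mem_layer hx) e6 ⟨le_rfl, e3.le⟩ ⟨hu, hu'.trans e1⟩ h0 hux).symm

/-- The flow boxes over the layers are disjoint up to the exit times. -/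
theorem flow_injective (h : IsSaddleBall ζ p φ J A Z k lam Λ ε ρ m r N) {n n' : ℕ} (hn : N < n)
    (hn' : N < n') {x x' : M} (hx : x ∈ coordLayer ζ J k n) (hx' : x' ∈ coordLayer ζ J k n')
    {a b : ℝ} (ha : 0 ≤ a) (ha' : a ≤ n / (4 * Λ)) (hb : 0 ≤ b) (hb' : b ≤ n' / (4 * Λ))
    (hab : φ a x = φ b x') : a = b ∧ n = n' := by
  wlog hle : a ≤ b generalizing n n' x x' a b
  · have := this hn' hn hx' hx hb hb' ha ha' hab.symm (le_of_not_ge hle)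
    exact ⟨this.1.symm, this.2.symm⟩
  -- The point x lies on the orbit of x' before its exit, so the orbit of x' meets the section at
  -- the times 0 and b - a, which must coincide.
  have e : φ (b - a) x' = x := by
    have : φ (-a) (φ b x') = x := by
      rw [← hab, ← Flow.map_add, neg_add_cancel, Flow.map_zero_apply]
    rw [← this, ← Flow.map_add]
    congr 1; ring
  have h0 := h.eq_of_flow_mem_layer hn' hx' (sub_nonneg.2 hle) (by linarith) (e ▸ hx)
  rw [h0, Flow.map_zero_apply] at e
  exact ⟨by linarith, IsSaddleChart.layer_index_unique hx (e ▸ hx')⟩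

/-- Follow y back to the boundary. If q ∘ k were nonnegative all the way, the backward orbit would
keep ‖ζ‖ ≤ 2‖ζ y‖, too small for the boundary. So q ∘ k vanishes on the way, and the same estimate
puts the crossing point close enough to p to lie in a layer. -/
theorem exists_layer_of_nonneg (h : IsSaddleBall ζ p φ J A Z k lam Λ ε ρ m r N) {y : M}
    (hy : y ∈ Metric.ball p (Real.exp (-(N : ℝ)) / 2)) (hyr : y ∈ Metric.ball p r) (hyp : y ≠ p)
    (hq : 0 ≤ quad J (k (ζ y))) {T : ℝ} (hT : 0 ≤ T) (hyT : φ (-T) y ∉ Metric.ball p r) :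
    ∃ n, N < n ∧ ∃ x ∈ coordLayer ζ J k n, ∃ t, 0 ≤ t ∧ t ≤ exitTime φ p r x ∧ φ t x = y := by
  obtain ⟨e1, e2, e3, e4⟩ := exitTime_spec φ.reverse hyr hT hyT
  set e := exitTime φ.reverse p r y
  rw [Flow.reverse_apply] at e3
  have hb : ∀ t, -e < t → t ≤ 0 → φ t y ∈ Metric.ball p r := by
    intro t ht ht0
    have := e4 (-t) (by linarith) (by linarith)
    rwa [Flow.reverse_apply, neg_neg] at this
  have hcb : ∀ t ∈ Icc (-e) 0, φ t y ∈ Metric.closedBall p r := by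
    intro t ht
    rcases ht.1.lt_or_eq with h1 | h1
    · exact Metric.ball_subset_closedBall (hb t h1 ht.2)
    · rw [← h1]; exact (h.norm_frontier e3).2
  have hmono := h.strictMonoOn_orbit hyp hcb
  have hsrc : y ∈ ζ.source := h.closedBall_subset (Metric.ball_subset_closedBall hyr)
  have hN := Real.exp_pos (-(N : ℝ))
  -- The factor 10 in `le_dist` enters here: points traced back from y keep ‖ζ‖ ≤ e^{-N}/10, well
  -- within the section's bound √2 e^{-(N+1)}.
  have hynorm : ‖ζ y‖ ≤ Real.exp (-(N : ℝ)) / 20 := by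
    have := h.le_dist y hsrc
    rw [Metric.mem_ball] at hy
    linarith
  have hback : ∀ t ∈ Icc (-e) 0, 0 ≤ quad J (k (ζ (φ t y))) → ‖ζ (φ t y)‖ ≤ 2 * ‖ζ y‖ := by
    intro t ht htq
    have hsub : ∀ s ∈ Icc t 0, s ∈ Icc (-e) 0 := fun s hs => ⟨ht.1.trans hs.1, hs.2⟩
    have h1 := h.toIsLocalSaddle.norm_le_of_orbit (z := fun t => ζ (φ t y)) ht.2
      (fun s hs => h.hasDerivAt y s (h.closedBall_subset (hcb s (hsub s hs))))
      (fun s hs => h.mem_ball_of_mem_source (h.closedBall_subset (hcb s (hsub s hs))))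
      (fun s hs => htq.trans (hmono.monotoneOn ht (hsub s hs) hs.1))
    simp only [Flow.map_zero_apply] at h1
    refine h1.trans ?_
    have : Real.exp (-(lam / 2) * (0 - t)) ≤ 1 := by
      rw [Real.exp_le_one_iff]
      nlinarith [h.lam_pos, ht.2]
    nlinarith [norm_nonneg (ζ y)]
  have hneg : quad J (k (ζ (φ (-e) y))) < 0 := by
    by_contra hcon
    have h1 := hback (-e) ⟨le_rfl, by linarith⟩ (not_lt.1 hcon)
    have h2 := (h.norm_frontier e3).1
    have h3 := h.exp_le_r le_rfl
    have h4 := h.m_pos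
    have h5 : 2 * Real.exp (-(N : ℝ)) ≤ ‖ζ (φ (-e) y)‖ := by
      refine le_of_mul_le_mul_left ?_ h4
      linarith
    linarith
  have hq' : 0 ≤ quad J (k (ζ (φ 0 y))) := by rwa [Flow.map_zero_apply]
  obtain ⟨t₀, ht₀, hqt⟩ := intermediate_value_Icc (by linarith : -e ≤ 0)
    (h.continuousOn_quad_orbit hcb) ⟨hneg.le, hq'⟩
  simp only at hqt
  have ht₀' : -e < t₀ := lt_of_le_of_ne ht₀.1 (by rintro rfl; linarith)
  have hnorm := hback t₀ ht₀ hqt.ge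
  have hsrc' : φ t₀ y ∈ ζ.source := h.closedBall_subset (hcb t₀ ht₀)
  have hsec : φ t₀ y ∈ coordShell ζ J k 0 (Real.exp (-((N : ℝ) + 1))) := by
    refine ⟨hsrc', hqt, by positivity, ?_⟩
    rw [div_lt_iff₀ (by positivity), neg_add, Real.exp_add]
    have h1 := h.toIsLocalSaddle.norm_k_le (h.mem_ball_of_mem_source hsrc')
    have h2 : (0.36 : ℝ) < Real.exp (-1) := by
      have := Real.exp_neg_one_gt_d9; linarith
    have h3 : 0.36 * Real.exp (-(N : ℝ)) ≤ Real.exp (-(N : ℝ)) * Real.exp (-1) := by nlinarith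
    have h4 := sqrt_two_bounds.1
    nlinarith
  obtain ⟨n, hn, hnx⟩ := h.exists_mem_layer hsec (h.flow_ne hyp t₀)
  refine ⟨n, hn, φ t₀ y, hnx, -t₀, by linarith [ht₀.2], ?_, ?_⟩
  -- The orbit is in the open ball from the crossing up to y, so the exit time of the crossing point
  -- cannot be earlier than -t₀.
  · obtain ⟨f1, f2, f3, f4, f5, f6⟩ := h.exitTime_layer hn hnx
    by_contra hcon
    rw [not_le] at hcon
    have h1 := hb (exitTime φ p r (φ t₀ y) + t₀) (by linarith) (by linarith)
    rw [Flow.map_add] at h1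
    rw [frontier, Metric.isOpen_ball.interior_eq] at f4
    exact f4.2 h1
  · rw [← Flow.map_add, neg_add_cancel, Flow.map_zero_apply]

/-- The union of the orbit segments through the layers, in coordinates. -/
def coordTube (ζ : OpenPartialHomeomorph M F) (J : F →L[ℝ] F) (k : F → F) (φ : Flow ℝ M) (p : M)
    (r : ℝ) (N : ℕ) : Set M :=
  {y | ∃ n, N < n ∧ ∃ x ∈ coordLayer ζ J k n,
    ∃ t ∈ Icc (-(entryTime φ p r x)) (exitTime φ p r x), φ t x = y}

theorem tube_subset (h : IsSaddleBall ζ p φ J A Z k lam Λ ε ρ m r N) :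
    coordTube ζ J k φ p r N ⊆ closure (Metric.ball p r) := by
  have key : ∀ {φ : Flow ℝ M} {J A : F →L[ℝ] F} {Z : F → F}
      (_ : IsSaddleBall ζ p φ J A Z k lam Λ ε ρ m r N) {n : ℕ} (_ : N < n) {x : M}
      (_ : x ∈ coordLayer ζ J k n) {t : ℝ} (_ : t ∈ Icc 0 (exitTime φ p r x)),
      φ t x ∈ closure (Metric.ball p r) := by
    intro φ J A Z h n hn x hx t ht
    obtain ⟨e1, e2, e3, e4, e5, e6⟩ := h.exitTime_layer hn hx
    rcases ht.2.lt_or_eq with h1 | h1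
    · exact subset_closure (e5 t ht.1 h1)
    · rw [h1]; exact frontier_subset_closure e4
  rintro y ⟨n, hn, x, hx, t, ht, rfl⟩
  rcases le_total 0 t with h0 | h0
  · exact key h hn hx ⟨h0, ht.2⟩
  · have := key h.reverse hn (x := x) (t := -t) (by rw [coordLayer, coordShell_neg]; exact hx)
      ⟨by linarith, by rw [← entryTime_eq]; linarith [ht.1]⟩
    rwa [Flow.reverse_apply, neg_neg] at this

/-- Points with q ∘ k ≤ 0 are handled by the reversed flow, for which the sign of the form changes
and exit becomes entry. -/
theorem mem_tube (h : IsSaddleBall ζ p φ J A Z k lam Λ ε ρ m r N) {y : M}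
    (hy : y ∈ Metric.ball p (Real.exp (-(N : ℝ)) / 2)) (hyr : y ∈ Metric.ball p r) (hyp : y ≠ p)
    {T T' : ℝ} (hT : 0 ≤ T) (hyT : φ T y ∉ Metric.ball p r) (hT' : 0 ≤ T')
    (hyT' : φ (-T') y ∉ Metric.ball p r) : y ∈ coordTube ζ J k φ p r N := by
  rcases le_total 0 (quad J (k (ζ y))) with hq | hq
  · obtain ⟨n, hn, x, hx, t, ht, ht', hxy⟩ := h.exists_layer_of_nonneg hy hyr hyp hq hT' hyT'
    have hx' : x ∈ coordLayer ζ (-J) k n := by rw [coordLayer, coordShell_neg]; exact hx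
    have := (h.reverse.exitTime_layer hn hx').2.2.1
    exact ⟨n, hn, x, hx, t, ⟨by rw [entryTime_eq]; linarith, ht'⟩, hxy⟩
  · obtain ⟨n, hn, x, hx, t, ht, ht', hxy⟩ := h.reverse.exists_layer_of_nonneg hy hyr hyp
      (by rw [quad_neg]; linarith) hT (by rwa [Flow.reverse_apply, neg_neg])
    have hx' : x ∈ coordLayer ζ J k n := by rw [coordLayer, coordShell_neg] at hx; exact hx
    have := (h.exitTime_layer hn hx').2.2.1
    exact ⟨n, hn, x, hx', -t, ⟨by rw [entryTime_eq]; linarith, by linarith⟩, hxy⟩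

theorem _root_.Set.Subsingleton.eventually_notMem_nhdsGT {B : Set ℝ} (hB : B.Subsingleton) (a : ℝ) :
    ∀ᶠ t in 𝓝[>] a, t ∉ B := by
  have h1 : (B \ {a})ᶜ ∈ 𝓝 a :=
    ((hB.finite.subset sdiff_subset).isClosed.isOpen_compl).mem_nhds (by simp)
  filter_upwards [nhdsWithin_le_nhds h1, self_mem_nhdsWithin] with t ht hta htB
  exact ht ⟨htB, ne_of_gt hta⟩

/-- Two points of the line differ by a multiple of `w`, on which the form vanishes, so
`eq_of_forall_mem_ball` applies. -/
theorem subsingleton_stable (h : IsSaddleBall ζ p φ J A Z k lam Λ ε ρ m r N) {w : F} (hw : w ≠ 0)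
    (hq : quad J w = 0) (z : F) :
    {τ : ℝ | z + τ • w ∈ Metric.ball (0 : F) ρ ∧
      ∀ t, 0 ≤ t → φ t (ζ.symm (z + τ • w)) ∈ Metric.ball p r}.Subsingleton := by
  rintro τ ⟨h1, h2⟩ τ' ⟨h1', h2'⟩
  have hsrc : ∀ x t, φ t x ∈ Metric.ball p r → φ t x ∈ ζ.source := fun x t hx =>
    h.closedBall_subset (Metric.ball_subset_closedBall hx)
  have e : ∀ z ∈ Metric.ball (0 : F) ρ, ζ (φ 0 (ζ.symm z)) = z := fun z hz => by
    rw [Flow.map_zero_apply]; exact ζ.right_inv (h.target_eq ▸ hz)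
  have := h.toIsLocalSaddle.eq_of_forall_mem_ball
    (z₁ := fun t => ζ (φ t (ζ.symm (z + τ • w)))) (z₂ := fun t => ζ (φ t (ζ.symm (z + τ' • w))))
    (fun t ht => h.hasDerivAt _ t (hsrc _ t (h2 t ht)))
    (fun t ht => h.hasDerivAt _ t (hsrc _ t (h2' t ht)))
    (fun t ht => h.mem_ball_of_mem_source (hsrc _ t (h2 t ht)))
    (fun t ht => h.mem_ball_of_mem_source (hsrc _ t (h2' t ht))) (by
      rw [e _ h1, e _ h1', add_sub_add_left_eq_sub, ← sub_smul]
      have : quad J ((τ - τ') • w) = (τ - τ') ^ 2 * quad J w := by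
        simp only [quad, map_smul, real_inner_smul_left, real_inner_smul_right]; ring
      rw [this, hq, mul_zero])
  rw [e _ h1, e _ h1', add_right_inj] at this
  exact smul_left_injective ℝ hw this

/-- Points that never leave may lie outside the tube, hence the closure. Moving y along a cone
direction avoids them: at most one parameter is bad for the future and one for the past. -/
theorem ball_subset (h : IsSaddleBall ζ p φ J A Z k lam Λ ε ρ m r N)
    (hN : Real.exp (-(N : ℝ)) / 2 ≤ r) :
    Metric.ball p (Real.exp (-(N : ℝ)) / 2) ⊆ closure (coordTube ζ J k φ p r N) := by
  intro y hy
  obtain ⟨w, hw, hq⟩ := h.cone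
  have hyr : y ∈ Metric.ball p r := Metric.ball_subset_ball hN hy
  have hys : y ∈ ζ.source := h.closedBall_subset (Metric.ball_subset_closedBall hyr)
  have hyb := h.mem_ball_of_mem_source hys
  have hlin : Tendsto (fun τ : ℝ => ζ y + τ • w) (𝓝[>] 0) (𝓝 (ζ y)) := by
    have : Continuous fun τ : ℝ => ζ y + τ • w := by fun_prop
    have h1 := (this.tendsto 0).mono_left (nhdsWithin_le_nhds (s := Ioi 0))
    simpa using h1
  have hlim : Tendsto (fun τ : ℝ => ζ.symm (ζ y + τ • w)) (𝓝[>] 0) (𝓝 y) := by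
    have := ζ.tendsto_symm hys
    exact this.comp hlin
  refine mem_closure_of_tendsto hlim ?_
  filter_upwards [(h.subsingleton_stable hw hq (ζ y)).eventually_notMem_nhdsGT 0,
    (h.reverse.subsingleton_stable hw (by rw [quad_neg, hq, neg_zero])
      (ζ y)).eventually_notMem_nhdsGT 0,
    hlim.eventually (Metric.isOpen_ball.mem_nhds hy),
    hlin.eventually (Metric.isOpen_ball.mem_nhds hyb)] with τ h1 h2 h3 h4
  have h1' : ∃ t, 0 ≤ t ∧ φ t (ζ.symm (ζ y + τ • w)) ∉ Metric.ball p r := by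
    by_contra! hcon
    exact h1 ⟨h4, hcon⟩
  have h2' : ∃ t, 0 ≤ t ∧ φ (-t) (ζ.symm (ζ y + τ • w)) ∉ Metric.ball p r := by
    by_contra! hcon
    exact h2 ⟨h4, hcon⟩
  obtain ⟨T, hT, hT1⟩ := h1'
  obtain ⟨T', hT', hT1'⟩ := h2'
  refine h.mem_tube h3 (Metric.ball_subset_ball hN h3) ?_ hT hT1 hT' hT1'
  intro h0
  rw [h0, h.fixed] at hT1
  exact hT1 (Metric.mem_ball_self h.r_pos)

end IsSaddleBall

end SaddleBall

end SingularFlow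

namespace SingularFlow

/-! ### A bound for the entropy function. -/

section Entropy

/-- The right-hand side is the tangent line at e^{-(n+1)} of the concave function -x log x. -/
theorem negMulLog_le (n : ℕ) {x : ℝ} (hx : 0 ≤ x) :
    Real.negMulLog x ≤ n * x + Real.exp (-((n : ℝ) + 1)) := by
  rcases hx.eq_or_lt with rfl | hx
  · simp [Real.exp_nonneg]
  · have h1 := Real.log_le_sub_one_of_pos (div_pos (Real.exp_pos (-((n : ℝ) + 1))) hx)
    rw [Real.log_div (Real.exp_pos _).ne' hx.ne', Real.log_exp] at h1
    have h2 := mul_le_mul_of_nonneg_left h1 hx.le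
    have h3 : x * (Real.exp (-((n : ℝ) + 1)) / x - 1) = Real.exp (-((n : ℝ) + 1)) - x := by
      field_simp
    rw [h3] at h2
    rw [Real.negMulLog]
    linarith

theorem exp_neg_succ_le (n : ℕ) : Real.exp (-((n : ℝ) + 1)) ≤ (1 / 2) * (1 / 2) ^ n := by
  have h1 : Real.exp (-1) ≤ 1 / 2 := by
    have := Real.exp_neg_one_lt_d9; linarith
  have h2 : Real.exp (-((n : ℝ) + 1)) = Real.exp (-1) ^ (n + 1) := by
    rw [← Real.exp_nat_mul]; congr 1; push_cast; ring
  rw [h2, ← pow_succ']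
  exact pow_le_pow_left₀ (Real.exp_pos _).le h1 _

end Entropy

/-! ### Towers over the layers and the entropy of their partition. -/

section Towers

variable {M : Type*} [TopologicalSpace M]

/-- The flow boxes of height one over a sequence of sets. -/
def tile (φ : Flow ℝ M) (D : ℕ → Set M) (n : ℕ) : Set M :=
  {y | ∃ t ∈ Ico (0 : ℝ) 1, ∃ x ∈ D n, φ t x = y}

/-- The partition by the flow boxes of index larger than `N`. -/
def tilePartition (φ : Flow ℝ M) (D : ℕ → Set M) (N : ℕ) : Set (Set M) :=
  {C | ∃ n, N < n ∧ C = tile φ D n} ∪ {(⋃ n, ⋃ (_ : N < n), tile φ D n)ᶜ}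

/-- The flow boxes of height `c n` over the sets `D n` are disjoint. -/
def IsTower (φ : Flow ℝ M) (D : ℕ → Set M) (N : ℕ) (c : ℝ) : Prop :=
  ∀ n n', N < n → N < n' → ∀ x ∈ D n, ∀ x' ∈ D n', ∀ a b : ℝ, 0 ≤ a → a ≤ c * n → 0 ≤ b →
    b ≤ c * n' → φ a x = φ b x' → a = b ∧ n = n'

variable {φ : Flow ℝ M} {D : ℕ → Set M} {N : ℕ} {c : ℝ}

theorem IsTower.tile_index_unique (h : IsTower φ D N c) (hc : 2 ≤ c * N) (hc0 : 0 < c) {n n' : ℕ}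
    (hn : N < n) (hn' : N < n') {y : M} (hy : y ∈ tile φ D n) (hy' : y ∈ tile φ D n') : n = n' := by
  obtain ⟨t, ht, x, hx, rfl⟩ := hy
  obtain ⟨t', ht', x', hx', he⟩ := hy'
  have hle : ∀ n : ℕ, N < n → 2 ≤ c * n := fun n hn => hc.trans (by gcongr)
  exact (h n n' hn hn' x hx x' hx' t t' ht.1 (by linarith [ht.2, hle n hn]) ht'.1
    (by linarith [ht'.2, hle n' hn']) he.symm).2

/-- No class is empty: the bases are nonempty, and the point `p`, outside every box, lies in the
complement. -/
theorem IsTower.isPartition (h : IsTower φ D N c) (hc : 2 ≤ c * N) (hc0 : 0 < c)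
    (hne : ∀ n, N < n → (D n).Nonempty) {p : M} (hp : ∀ n, N < n → p ∉ tile φ D n) :
    Setoid.IsPartition (tilePartition φ D N) := by
  refine ⟨?_, fun y => ?_⟩
  · rintro (⟨n, hn, he⟩ | he)
    · obtain ⟨x, hx⟩ := hne n hn
      have : φ 0 x ∈ tile φ D n := ⟨0, by norm_num, x, hx, rfl⟩
      rw [← he] at this
      exact this
    · have : p ∈ (⋃ n, ⋃ (_ : N < n), tile φ D n)ᶜ := by
        simp only [mem_compl_iff, mem_iUnion, not_exists]
        exact hp
      rw [← show ∅ = _ from he] at this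
      exact this
  · by_cases hy : ∃ n, N < n ∧ y ∈ tile φ D n
    · obtain ⟨n, hn, hy⟩ := hy
      refine ⟨tile φ D n, ⟨Or.inl ⟨n, hn, rfl⟩, hy⟩, ?_⟩
      rintro C ⟨⟨n', hn', rfl⟩ | hC, hyC⟩
      · rw [h.tile_index_unique hc hc0 hn hn' hy hyC]
      · rw [show C = _ from hC] at hyC
        simp only [mem_compl_iff, mem_iUnion, not_exists] at hyC
        exact absurd hy (hyC n hn)
    · refine ⟨_, ⟨Or.inr rfl, ?_⟩, ?_⟩
      · simp only [mem_compl_iff, mem_iUnion, not_exists]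
        exact fun n hn hyn => hy ⟨n, hn, hyn⟩
      · rintro C ⟨⟨n', hn', rfl⟩ | hC, hyC⟩
        · exact absurd ⟨n', hn', hyC⟩ hy
        · exact hC

theorem countable_tilePartition (φ : Flow ℝ M) (D : ℕ → Set M) (N : ℕ) :
    (tilePartition φ D N).Countable := by
  refine Countable.union ?_ (countable_singleton _)
  refine (countable_range (tile φ D)).mono ?_
  rintro C ⟨n, _, rfl⟩
  exact ⟨n, rfl⟩

variable [MeasurableSpace M]

theorem measurableSet_tilePartition (hm : ∀ n, N < n → MeasurableSet (tile φ D n)) :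
    ∀ C ∈ tilePartition φ D N, MeasurableSet C := by
  rintro C (⟨n, hn, rfl⟩ | hC)
  · exact hm n hn
  · rw [show C = _ from hC]
    exact (MeasurableSet.iUnion fun n => MeasurableSet.iUnion fun hn => hm n hn).compl

/-- Exhausting [0, 1) by compact intervals writes the box as a countable union of continuous images
of compact sets. Injectivity of the flow on the box plays no role. -/
theorem measurableSet_tile [T2Space M] [BorelSpace M] (φ : Flow ℝ M) {D : ℕ → Set M} {n : ℕ}
    (h : IsSigmaCompact (D n)) : MeasurableSet (tile φ D n) := by
  obtain ⟨K, hK, hKD⟩ := h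
  have e : tile φ D n = ⋃ (i : ℕ) (j : ℕ),
      (fun q : ℝ × M => φ q.1 q.2) '' (Icc 0 (1 - 1 / ((j : ℝ) + 1)) ×ˢ K i) := by
    ext y
    simp only [tile, mem_iUnion, mem_image, Prod.exists, mem_prod]
    constructor
    · rintro ⟨t, ht, x, hx, rfl⟩
      rw [← hKD] at hx
      obtain ⟨i, hi⟩ := mem_iUnion.1 hx
      obtain ⟨j, hj⟩ := exists_nat_one_div_lt (sub_pos.2 ht.2)
      exact ⟨i, j, t, x, ⟨⟨ht.1, by linarith⟩, hi⟩, rfl⟩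
    · rintro ⟨i, j, t, x, ⟨ht, hx⟩, rfl⟩
      refine ⟨t, ⟨ht.1, ht.2.trans_lt ?_⟩, x, hKD ▸ mem_iUnion.2 ⟨i, hx⟩, rfl⟩
      have : 0 < 1 / ((j : ℝ) + 1) := by positivity
      linarith
  rw [e]
  refine MeasurableSet.iUnion fun i => MeasurableSet.iUnion fun j => ?_
  exact ((isCompact_Icc.prod (hK i)).image
    (φ.continuous continuous_fst continuous_snd)).measurableSet

/-- The entropy of the tower partition. -/
theorem IsTower.entropy_lt (h : IsTower φ D N c) (hc : 2 ≤ c * N) (hc0 : 0 < c)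
    (hm : ∀ n, N < n → MeasurableSet (tile φ D n)) (μ : Measure M) [IsProbabilityMeasure μ]
    (hμ : ∀ t, MeasurePreserving (φ t) μ μ) :
    partitionEntropy μ (tilePartition φ D N) < ENNReal.ofReal (2 / c + 3) := by
  -- `s (n, j)` is the box over `D n` moved by time j. For j < ⌊cn⌋ these translates fit in the
  -- tower of height cn, so all of them are disjoint; by invariance each has the measure of the box,
  -- and ∑ ⌊cn⌋ μ(C_n) ≤ 1.
  set s : ℕ × ℕ → Set M := fun i => if N < i.1 ∧ i.2 < ⌊c * i.1⌋₊ then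
    φ (-(i.2 : ℝ)) ⁻¹' tile φ D i.1 else ∅ with hs
  have hsm : ∀ i, MeasurableSet (s i) := by
    intro i
    simp only [hs]
    split_ifs with hi
    · exact (hμ _).measurable (hm _ hi.1)
    · exact MeasurableSet.empty
  have hsd : Pairwise (Function.onFun Disjoint s) := by
    intro i i' hii'
    rw [Function.onFun, Set.disjoint_left]
    intro y hy hy'
    apply hii'
    simp only [hs] at hy hy'
    split_ifs at hy hy' with hi hi'
    · obtain ⟨t, ht, x, hx, he⟩ := hy
      obtain ⟨t', ht', x', hx', he'⟩ := hy'
      have e1 : φ (i.2 + t) x = y := by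
        rw [Flow.map_add, he, ← Flow.map_add, add_neg_cancel, Flow.map_zero_apply]
      have e2 : φ (i'.2 + t') x' = y := by
        rw [Flow.map_add, he', ← Flow.map_add, add_neg_cancel, Flow.map_zero_apply]
      have hfl : ∀ i : ℕ × ℕ, i.2 < ⌊c * i.1⌋₊ → (i.2 : ℝ) + 1 ≤ c * i.1 := by
        intro i hi
        have h1 : ((i.2 + 1 : ℕ) : ℝ) ≤ ⌊c * i.1⌋₊ := by exact_mod_cast hi
        have h2 := Nat.floor_le (show 0 ≤ c * i.1 by positivity)
        push_cast at h1
        linarith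
      have h1 := hfl i hi.2
      have h2 := hfl i' hi'.2
      obtain ⟨h3, h4⟩ := h i.1 i'.1 hi.1 hi'.1 x hx x' hx' (i.2 + t) (i'.2 + t')
        (by linarith [ht.1, i.2.cast_nonneg (α := ℝ)])
        (by linarith [ht.2])
        (by linarith [ht'.1, i'.2.cast_nonneg (α := ℝ)]) (by linarith [ht'.2]) (e1.trans e2.symm)
      have h5 : (i.2 : ℝ) < i'.2 + 1 := by linarith [ht.1, ht'.2]
      have h6 : (i'.2 : ℝ) < i.2 + 1 := by linarith [ht'.1, ht.2]
      have h7 : i.2 < i'.2 + 1 := by exact_mod_cast h5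
      have h8 : i'.2 < i.2 + 1 := by exact_mod_cast h6
      exact Prod.ext h4 (by omega)
    · exact absurd hy' (notMem_empty y)
    · exact absurd hy (notMem_empty y)
    · exact absurd hy (notMem_empty y)
  have hsum : ∑' n : ℕ, (if N < n then (⌊c * n⌋₊ : ℝ≥0∞) * μ (tile φ D n) else 0) ≤ 1 := by
    have h1 := tsum_measure_le_measure_univ (μ := μ) (fun i => (hsm i).nullMeasurableSet)
      (fun i j hij => (hsd hij).aedisjoint)
    rw [measure_univ, ENNReal.tsum_prod'] at h1
    refine le_trans (ENNReal.tsum_le_tsum fun n => ?_) h1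
    split_ifs with hn
    · calc (⌊c * n⌋₊ : ℝ≥0∞) * μ (tile φ D n)
          = ∑ j ∈ Finset.range ⌊c * n⌋₊, μ (tile φ D n) := by simp
        _ = ∑ j ∈ Finset.range ⌊c * n⌋₊, μ (s (n, j)) := by
            refine Finset.sum_congr rfl fun j hj => ?_
            rw [hs]
            simp only [hn, Finset.mem_range.1 hj, and_self, if_true]
            exact ((hμ _).measure_preimage (hm n hn).nullMeasurableSet).symm
        _ ≤ ∑' j, μ (s (n, j)) := ENNReal.sum_le_tsum _
    · exact zero_le
  have hterm : ∀ n, N < n → ENNReal.ofReal (Real.negMulLog (μ.real (tile φ D n))) ≤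
      ENNReal.ofReal (2 / c) * ((⌊c * n⌋₊ : ℝ≥0∞) * μ (tile φ D n)) +
        ENNReal.ofReal ((1 / 2) * (1 / 2) ^ n) := by
    intro n hn
    have h1 := negMulLog_le n (measureReal_nonneg (μ := μ) (s := tile φ D n))
    -- Since cn ≥ 2, the floor loses at most half of cn.
    have h2 : (n : ℝ) ≤ 2 / c * ⌊c * n⌋₊ := by
      have h3 := Nat.lt_floor_add_one (c * n)
      have h4 : c * N ≤ c * n := by gcongr
      rw [div_mul_eq_mul_div, le_div_iff₀ hc0]
      linarith
    calc ENNReal.ofReal (Real.negMulLog (μ.real (tile φ D n)))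
        ≤ ENNReal.ofReal (2 / c * (⌊c * n⌋₊ * μ.real (tile φ D n)) + (1 / 2) * (1 / 2) ^ n) := by
          apply ENNReal.ofReal_le_ofReal
          have h3 := mul_le_mul_of_nonneg_right h2
            (measureReal_nonneg (μ := μ) (s := tile φ D n))
          have := exp_neg_succ_le n
          linarith
      _ = _ := by
          rw [ENNReal.ofReal_add (by positivity) (by positivity), ENNReal.ofReal_mul (by positivity),
            ENNReal.ofReal_mul (by positivity), ENNReal.ofReal_natCast, ofReal_measureReal]
  have hgeo : ∑' n : ℕ, ENNReal.ofReal ((1 / 2) * (1 / 2) ^ n) = ENNReal.ofReal 1 := by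
    rw [← ENNReal.ofReal_tsum_of_nonneg (fun n => by positivity)
      (summable_geometric_two.mul_left _), tsum_mul_left, tsum_geometric_two]
    norm_num
  have hcompl : ENNReal.ofReal
      (Real.negMulLog (μ.real (⋃ n, ⋃ (_ : N < n), tile φ D n)ᶜ)) ≤ ENNReal.ofReal 1 := by
    apply ENNReal.ofReal_le_ofReal
    have h1 := negMulLog_le 0 (measureReal_nonneg (μ := μ)
      (s := (⋃ n, ⋃ (_ : N < n), tile φ D n)ᶜ))
    have h2 : Real.exp (-(((0 : ℕ) : ℝ) + 1)) ≤ 1 := Real.exp_le_one_iff.2 (by norm_num)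
    rw [Nat.cast_zero, zero_mul, zero_add] at h1
    rw [Nat.cast_zero] at h2
    exact h1.trans h2
  -- A sum over classes is at most the sum over indices, so distinctness of the boxes is not needed
  -- here.
  have htiles : ∑' C : {C | ∃ n, N < n ∧ C = tile φ D n},
      ENNReal.ofReal (Real.negMulLog (μ.real (C : Set M))) ≤
        ENNReal.ofReal (2 / c) + ENNReal.ofReal 1 := by
    have e : {C | ∃ n, N < n ∧ C = tile φ D n} = ⋃ n : ℕ, {C | N < n ∧ C = tile φ D n} := by
      ext C; simp
    rw [e]
    refine (ENNReal.tsum_iUnion_le_tsum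
      (fun C : Set M => ENNReal.ofReal (Real.negMulLog (μ.real C))) _).trans ?_
    calc ∑' n : ℕ, ∑' C : {C | N < n ∧ C = tile φ D n},
          ENNReal.ofReal (Real.negMulLog (μ.real (C : Set M)))
        ≤ ∑' n : ℕ, (ENNReal.ofReal (2 / c) *
            (if N < n then (⌊c * n⌋₊ : ℝ≥0∞) * μ (tile φ D n) else 0) +
            ENNReal.ofReal ((1 / 2) * (1 / 2) ^ n)) := by
          refine ENNReal.tsum_le_tsum fun n => ?_
          by_cases hn : N < n
          · have e2 : {C | N < n ∧ C = tile φ D n} = {tile φ D n} := by ext C; simp [hn]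
            rw [e2, if_pos hn]
            rw [tsum_singleton (tile φ D n)
              (fun C : Set M => ENNReal.ofReal (Real.negMulLog (μ.real C)))]
            exact hterm n hn
          · have e2 : {C | N < n ∧ C = tile φ D n} = ∅ := by ext C; simp [hn]
            rw [e2, tsum_empty]
            exact zero_le
      _ = ENNReal.ofReal (2 / c) *
            ∑' n : ℕ, (if N < n then (⌊c * n⌋₊ : ℝ≥0∞) * μ (tile φ D n) else 0) +
            ENNReal.ofReal 1 := by rw [ENNReal.tsum_add, ENNReal.tsum_mul_left, hgeo]
      _ ≤ ENNReal.ofReal (2 / c) * 1 + ENNReal.ofReal 1 := by gcongr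
      _ = _ := by rw [mul_one]
  calc partitionEntropy μ (tilePartition φ D N)
      ≤ (ENNReal.ofReal (2 / c) + ENNReal.ofReal 1) + ENNReal.ofReal 1 := by
        rw [partitionEntropy, tilePartition]
        refine (ENNReal.tsum_union_le
          (fun C : Set M => ENNReal.ofReal (Real.negMulLog (μ.real C))) _ _).trans ?_
        refine add_le_add htiles ?_
        rw [tsum_singleton _ (fun C : Set M => ENNReal.ofReal (Real.negMulLog (μ.real C)))]
        exact hcompl
    _ = ENNReal.ofReal (2 / c + 2) := by
        rw [← ENNReal.ofReal_add (by positivity) (by norm_num),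
          ← ENNReal.ofReal_add (by positivity) (by norm_num)]
        congr 1; ring
    _ < ENNReal.ofReal (2 / c + 3) := by
        rw [ENNReal.ofReal_lt_ofReal_iff (by positivity)]; linarith

end Towers

/-- The strict upper bound cuts out an open subset of a finite-dimensional space, which is a
countable union of closed sets; the other conditions are closed. -/
theorem IsSaddleChart.isSigmaCompact_layer {M : Type*} [MetricSpace M] {F : Type*}
    [NormedAddCommGroup F] [InnerProductSpace ℝ F] [FiniteDimensional ℝ F]
    {ζ : OpenPartialHomeomorph M F} {p : M} {J A : F →L[ℝ] F}
    {Z k : F → F} {lam Λ ε ρ m r : ℝ} {N : ℕ}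
    (h : IsSaddleChart ζ p J A Z k lam Λ ε ρ m r N) (n : ℕ) :
    IsSigmaCompact (coordLayer ζ J k n) := by
  have hk := h.toIsLocalSaddle.continuousOn_k
  set O : Set F := Metric.ball 0 ρ ∩ (fun z => ‖k z‖ / √2) ⁻¹' Iio (Real.exp (-(n : ℝ))) with hO
  have hc : ContinuousOn (fun z => ‖k z‖ / √2) (Metric.ball 0 ρ) := hk.norm.div_const _
  have hOo : IsOpen O := hc.isOpen_inter_preimage Metric.isOpen_ball isOpen_Iio
  obtain ⟨K, hK, hKO, hKU, -⟩ := hOo.exists_iUnion_isClosed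
  have e : coordLayer ζ J k n = ζ.symm '' ⋃ i, (K i ∩ (fun z => (quad J (k z), ‖k z‖ / √2)) ⁻¹'
      ({0} ×ˢ Ici (Real.exp (-((n : ℝ) + 1))))) := by
    ext x
    simp only [coordLayer, coordShell, mem_image, mem_iUnion, mem_inter_iff, mem_preimage, mem_prod,
      mem_singleton_iff, mem_Ici]
    constructor
    · rintro ⟨h1, h2, h3, h4⟩
      have : ζ x ∈ ⋃ i, K i := by
        rw [hKU]; exact ⟨h.mem_ball_of_mem_source h1, h4⟩
      obtain ⟨i, hi⟩ := mem_iUnion.1 this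
      exact ⟨ζ x, ⟨i, hi, h2, h3⟩, ζ.left_inv h1⟩
    · rintro ⟨z, ⟨i, hi, h2, h3⟩, rfl⟩
      have hz : z ∈ O := hKO i hi
      have hzt : z ∈ ζ.target := h.target_eq ▸ hz.1
      refine ⟨ζ.map_target hzt, ?_⟩
      rw [ζ.right_inv hzt]
      exact ⟨h2, h3, hz.2⟩
  rw [e]
  refine IsSigmaCompact.image_of_continuousOn (isSigmaCompact_iUnion _ fun i => ?_)
    (ζ.continuousOn_symm.mono ?_)
  · have hKb : K i ⊆ Metric.ball 0 ρ := fun z hz => (hKO i hz).1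
    have : IsClosed (K i ∩ (fun z => (quad J (k z), ‖k z‖ / √2)) ⁻¹'
      ({0} ×ˢ Ici (Real.exp (-((n : ℝ) + 1))))) :=
      ContinuousOn.preimage_isClosed_of_isClosed
        (((continuous_quad J).comp_continuousOn (hk.mono hKb)).prodMk (hc.mono hKb)) (hK i)
        (isClosed_singleton.prod isClosed_Ici)
    exact isSigmaCompact_univ.of_isClosed_subset this (subset_univ _)
  · intro z hz
    obtain ⟨i, hi⟩ := mem_iUnion.1 hz
    rw [h.target_eq]
    exact (hKO i hi.1).1

namespace IsSaddleBall

variable {M : Type*} [MetricSpace M] {F : Type*} [NormedAddCommGroup F] [InnerProductSpace ℝ F]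
  {ζ : OpenPartialHomeomorph M F} {p : M} {φ : Flow ℝ M} {J A : F →L[ℝ] F}
  {Z k : F → F} {lam Λ ε ρ m r : ℝ} {N : ℕ}

theorem isTower (h : IsSaddleBall ζ p φ J A Z k lam Λ ε ρ m r N) :
    IsTower φ (coordLayer ζ J k) N (1 / (4 * Λ)) := by
  intro n n' hn hn' x hx x' hx' a b ha ha' hb hb' hab
  exact h.flow_injective hn hn' hx hx' ha (by rwa [one_div_mul_eq_div] at ha') hb
    (by rwa [one_div_mul_eq_div] at hb') hab

theorem two_le (h : IsSaddleBall ζ p φ J A Z k lam Λ ε ρ m r N) : 2 ≤ 1 / (4 * Λ) * N := by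
  have h1 := h.one_le
  rw [one_div_mul_eq_div, le_div_iff₀ (by positivity)]
  linarith [h.le_N]

theorem notMem_tile (h : IsSaddleBall ζ p φ J A Z k lam Λ ε ρ m r N) (n : ℕ) :
    p ∉ tile φ (coordLayer ζ J k) n := by
  rintro ⟨t, ht, x, hx, he⟩
  exact h.flow_ne (h.ne_of_mem_layer hx) t he

/-- During a time less than 1 the norm ‖ζ‖ changes by a factor between e^{-2Λ} and e^{2Λ}. The
condition 8Λ ≤ N keeps the whole box before the exit time. -/
theorem dist_tile (h : IsSaddleBall ζ p φ J A Z k lam Λ ε ρ m r N) {n : ℕ} (hn : N < n) {y : M}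
    (hy : y ∈ tile φ (coordLayer ζ J k) n) {κ : ℝ} (hκ : Real.exp (2 * Λ + 1) ≤ κ)
    (hκ' : 2 * m * Real.exp (2 * Λ) ≤ κ) :
    dist y p ∈ Icc (κ⁻¹ * Real.exp (-(n : ℝ))) (κ * Real.exp (-(n : ℝ))) := by
  obtain ⟨t, ht, x, hx, rfl⟩ := hy
  obtain ⟨e1, e2, e3, e4, e5, e6⟩ := h.exitTime_layer hn hx
  have hΛ := h.one_le
  have hm := h.m_pos
  have hte : t ≤ exitTime φ p r x := by
    have h1 : 1 ≤ (n : ℝ) / (4 * Λ) := by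
      rw [le_div_iff₀ (by positivity)]; linarith [h.one_le_of_lt hn]
    linarith [ht.2]
  have hcb : ∀ s ∈ Icc 0 t, φ s x ∈ Metric.closedBall p r := fun s hs =>
    e6 s ⟨hs.1, hs.2.trans hte⟩
  have hd : ∀ s ∈ Icc 0 t, HasDerivAt (fun s => ζ (φ s x)) (Z (ζ (φ s x))) s := fun s hs =>
    h.hasDerivAt x s (h.closedBall_subset (hcb s hs))
  have hz : ∀ s ∈ Icc 0 t, ζ (φ s x) ∈ Metric.ball (0 : F) ρ := fun s hs =>
    h.mem_ball_of_mem_source (h.closedBall_subset (hcb s hs))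
  have h1 := h.toIsLocalSaddle.norm_orbit_le ht.1 hd hz
  have h2 := h.toIsLocalSaddle.le_norm_orbit ht.1 hd hz
  simp only [Flow.map_zero_apply, sub_zero] at h1 h2
  obtain ⟨h3, h4⟩ := h.norm_bounds hx
  have hs : φ t x ∈ ζ.source := h.closedBall_subset (hcb t ⟨ht.1, le_rfl⟩)
  have h5 := h.le_dist _ hs
  have h6 := h.dist_le _ hs
  have hn := Real.exp_pos (-(n : ℝ))
  constructor
  · have h7 : Real.exp (-(2 * Λ)) ≤ Real.exp (-(2 * Λ) * t) := by
      rw [Real.exp_le_exp]; nlinarith [ht.2]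
    have h8 : κ⁻¹ ≤ Real.exp (-(2 * Λ + 1)) := by
      rw [Real.exp_neg]
      exact inv_anti₀ (Real.exp_pos _) hκ
    calc κ⁻¹ * Real.exp (-(n : ℝ)) ≤ Real.exp (-(2 * Λ + 1)) * Real.exp (-(n : ℝ)) := by gcongr
      _ = Real.exp (-(2 * Λ)) * Real.exp (-((n : ℝ) + 1)) := by
        rw [← Real.exp_add, ← Real.exp_add]; congr 1; ring
      _ ≤ Real.exp (-(2 * Λ) * t) * ‖ζ x‖ := by gcongr
      _ ≤ dist (φ t x) p := by linarith [norm_nonneg (ζ (φ t x))]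
  · have h7 : Real.exp (2 * Λ * t) ≤ Real.exp (2 * Λ) := by
      rw [Real.exp_le_exp]; nlinarith [ht.2]
    calc dist (φ t x) p ≤ m * (Real.exp (2 * Λ) * (1.5 * Real.exp (-(n : ℝ)))) := by
          refine h6.trans ?_
          gcongr
          exact h1.trans (by gcongr)
      _ ≤ 2 * m * Real.exp (2 * Λ) * Real.exp (-(n : ℝ)) := by
          have : 0 < m * Real.exp (2 * Λ) * Real.exp (-(n : ℝ)) := by positivity
          linarith
      _ ≤ κ * Real.exp (-(n : ℝ)) := by gcongr

end IsSaddleBall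

end SingularFlow

namespace SingularFlow

/-! ### Comparison of the Riemannian distance with the distance in a chart -/

section Comparison

variable {E : Type*} [NormedAddCommGroup E] [NormedSpace ℝ E]
  {M : Type*} [MetricSpace M] [ChartedSpace E M] [IsManifold 𝓘(ℝ, E) ∞ M]

/-- The velocity of a curve in a chart. -/
theorem trivializationAt_mfderiv {σ : M} {γ : ℝ → M} {t : ℝ} {c : E}
    (hγ : ContinuousAt γ t) (hs : γ t ∈ (extChartAt 𝓘(ℝ, E) σ).source)
    (hc : HasDerivAt (fun s => extChartAt 𝓘(ℝ, E) σ (γ s)) c t) :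
    tangentCoordChange 𝓘(ℝ, E) (γ t) σ (γ t) (mfderiv 𝓘(ℝ, ℝ) 𝓘(ℝ, E) γ t (1 : ℝ) : E) = c := by
  have hs' := mem_extChartAt_source (I := 𝓘(ℝ, E)) (γ t)
  have h1 : HasDerivAt (fun s => (extChartAt 𝓘(ℝ, E) (γ t) ∘ (extChartAt 𝓘(ℝ, E) σ).symm)
      (extChartAt 𝓘(ℝ, E) σ (γ s))) (tangentCoordChange 𝓘(ℝ, E) σ (γ t) (γ t) c) t :=
    (hasFDerivAt_transition hs hs').comp_hasDerivAt t hc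
  have h2 : HasDerivAt (fun s => extChartAt 𝓘(ℝ, E) (γ t) (γ s))
      (tangentCoordChange 𝓘(ℝ, E) σ (γ t) (γ t) c) t := by
    refine h1.congr_of_eventuallyEq ?_
    filter_upwards [hγ.eventually_mem ((isOpen_extChartAt_source (I := 𝓘(ℝ, E)) σ).mem_nhds hs)]
      with s hs
    simp only [Function.comp_apply, (extChartAt 𝓘(ℝ, E) σ).left_inv hs]
  have h3 : HasMFDerivAt 𝓘(ℝ, ℝ) 𝓘(ℝ, E) γ t
      (ContinuousLinearMap.toSpanSingleton ℝ (tangentCoordChange 𝓘(ℝ, E) σ (γ t) (γ t) c) :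
        ℝ →L[ℝ] E) :=
    ⟨hγ, h2.hasFDerivAt.hasFDerivWithinAt⟩
  rw [h3.mfderiv]
  have e : (ContinuousLinearMap.toSpanSingleton ℝ (tangentCoordChange 𝓘(ℝ, E) σ (γ t) (γ t) c) :
        ℝ →L[ℝ] E) 1 = tangentCoordChange 𝓘(ℝ, E) σ (γ t) (γ t) c := by simp
  exact (congrArg _ e).trans (tangentCoordChange_inv hs hs' c)

variable [RiemannianBundle (fun x : M => TangentSpace 𝓘(ℝ, E) x)]
  [IsContMDiffRiemannianBundle 𝓘(ℝ, E) ∞ E (fun x : M => TangentSpace 𝓘(ℝ, E) x)]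

/-- Near `σ`, the Riemannian norm is comparable to the norm in the chart at `σ`. -/
theorem exists_norm_comparison (σ : M) :
    ∃ C > 0, ∀ᶠ x in 𝓝 σ, ∀ w : TangentSpace 𝓘(ℝ, E) x,
      ‖w‖ ≤ C * ‖tangentCoordChange 𝓘(ℝ, E) x σ x w‖ ∧
      ‖tangentCoordChange 𝓘(ℝ, E) x σ x w‖ ≤ C * ‖w‖ := by
  have : IsContinuousRiemannianBundle E (fun x : M => TangentSpace 𝓘(ℝ, E) x) := by
    obtain ⟨g, hg, hg'⟩ := IsContMDiffRiemannianBundle.exists_contMDiff (IB := 𝓘(ℝ, E)) (n := ∞)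
      (F := E) (E := fun x : M => TangentSpace 𝓘(ℝ, E) x)
    exact ⟨g, hg.continuous, hg'⟩
  obtain ⟨C₁, hC₁, h₁⟩ := eventually_norm_trivializationAt_lt E
    (fun x : M => TangentSpace 𝓘(ℝ, E) x) σ
  obtain ⟨C₂, hC₂, h₂⟩ := eventually_norm_symmL_trivializationAt_lt E
    (fun x : M => TangentSpace 𝓘(ℝ, E) x) σ
  refine ⟨max C₁ C₂, by positivity, ?_⟩
  filter_upwards [h₁, h₂, extChartAt_source_mem_nhds (I := 𝓘(ℝ, E)) σ] with x h₁ h₂ hx w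
  have hb : x ∈ (trivializationAt E (TangentSpace 𝓘(ℝ, E) : M → Type _) σ).baseSet := by
    simpa using hx
  have e : (trivializationAt E (TangentSpace 𝓘(ℝ, E) : M → Type _) σ).continuousLinearMapAt ℝ x w =
      tangentCoordChange 𝓘(ℝ, E) x σ x w := by
    rw [Trivialization.continuousLinearMapAt_apply_of_mem (R := ℝ) _ hb]
    rfl
  have e' : (trivializationAt E (TangentSpace 𝓘(ℝ, E) : M → Type _) σ).symmL ℝ x
      (tangentCoordChange 𝓘(ℝ, E) x σ x w) = w := by
    rw [← e]
    exact (trivializationAt E (TangentSpace 𝓘(ℝ, E) : M → Type _) σ).symmL_continuousLinearMapAt hb w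
  constructor
  · have := ContinuousLinearMap.le_of_opNorm_le _ h₂.le (tangentCoordChange 𝓘(ℝ, E) x σ x w)
    rw [e'] at this
    refine this.trans ?_
    gcongr
    exact le_max_right _ _
  · have := ContinuousLinearMap.le_of_opNorm_le _ h₁.le w
    rw [e] at this
    refine this.trans ?_
    gcongr
    exact le_max_left _ _

variable [IsRiemannianManifold 𝓘(ℝ, E) M]

/-- Near `σ`, the Riemannian distance is comparable to the distance in the chart at `σ`. -/
theorem exists_dist_comparison (σ : M) :
    ∃ C > 0, ∃ δ > 0, Metric.ball σ δ ⊆ (extChartAt 𝓘(ℝ, E) σ).source ∧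
      ∀ x ∈ Metric.ball σ δ, ∀ y ∈ Metric.ball σ δ,
        dist x y ≤ C * ‖extChartAt 𝓘(ℝ, E) σ x - extChartAt 𝓘(ℝ, E) σ y‖ ∧
        ‖extChartAt 𝓘(ℝ, E) σ x - extChartAt 𝓘(ℝ, E) σ y‖ ≤ C * dist x y := by
  obtain ⟨C, hC, hev⟩ := exists_norm_comparison (E := E) σ
  have hsrc := extChartAt_source_mem_nhds (I := 𝓘(ℝ, E)) σ
  obtain ⟨R, hR, hRb⟩ := Metric.mem_nhds_iff.1 (hev.and hsrc)
  -- a convex neighbourhood in the chart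
  have hpre : (extChartAt 𝓘(ℝ, E) σ).target ∩ (extChartAt 𝓘(ℝ, E) σ).symm ⁻¹' Metric.ball σ R ∈
      𝓝 (extChartAt 𝓘(ℝ, E) σ σ) :=
    inter_mem (extChartAt_target_mem_nhds σ)
      ((continuousAt_extChartAt_symm (I := 𝓘(ℝ, E)) σ).preimage_mem_nhds (by
        rw [extChartAt_to_inv]; exact Metric.ball_mem_nhds _ hR))
  obtain ⟨R', hR', hRb'⟩ := Metric.mem_nhds_iff.1 hpre
  have hpre2 : extChartAt 𝓘(ℝ, E) σ ⁻¹' Metric.ball (extChartAt 𝓘(ℝ, E) σ σ) R' ∈ 𝓝 σ :=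
    (continuousAt_extChartAt σ).preimage_mem_nhds (Metric.ball_mem_nhds _ hR')
  obtain ⟨δ₁, hδ₁, hδb⟩ := Metric.mem_nhds_iff.1 hpre2
  refine ⟨C, hC, min δ₁ (R / 4), by positivity, fun x hx => ?_, fun x hx y hy => ⟨?_, ?_⟩⟩
  · exact (hRb (Metric.ball_subset_ball (by linarith [min_le_right δ₁ (R / 4)]) hx)).2
  · -- the image of a segment
    set χ := extChartAt 𝓘(ℝ, E) σ with hχ
    have hxs : x ∈ χ.source :=
      (hRb (Metric.ball_subset_ball (by linarith [min_le_right δ₁ (R / 4)]) hx)).2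
    have hys : y ∈ χ.source :=
      (hRb (Metric.ball_subset_ball (by linarith [min_le_right δ₁ (R / 4)]) hy)).2
    have hxb := hδb (Metric.ball_subset_ball (min_le_left _ _) hx)
    have hyb := hδb (Metric.ball_subset_ball (min_le_left _ _) hy)
    let η : ℝ → E := fun t => χ x + t • (χ y - χ x)
    have hη : ∀ t ∈ Icc (0 : ℝ) 1, η t ∈ Metric.ball (χ σ) R' := fun t ht =>
      (convex_ball _ _).add_smul_sub_mem hxb hyb ht
    have hηd : ∀ t, HasDerivAt η (χ y - χ x) t := fun t => by
      simpa [η] using ((hasDerivAt_id t).smul_const (χ y - χ x)).const_add (χ x)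
    have hηc : ContDiff ℝ 1 η := by
      simp only [η]; fun_prop
    have hlen : riemannianEDist 𝓘(ℝ, E) x y ≤
        pathELength 𝓘(ℝ, E) (fun t => χ.symm (η t)) 0 1 := by
      refine riemannianEDist_le_pathELength ?_ ?_ ?_ zero_le_one
      · exact ((contMDiffOn_extChartAt_symm (I := 𝓘(ℝ, E)) (n := 1) σ)).comp
          (contMDiffOn_iff_contDiffOn.2 hηc.contDiffOn) (fun t ht => (hRb' (hη t ht)).1)
      · simp only [η, zero_smul, add_zero, χ.left_inv hxs]
      · simp only [η, one_smul, add_sub_cancel, χ.left_inv hys]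
    have hlen2 : pathELength 𝓘(ℝ, E) (fun t => χ.symm (η t)) 0 1 ≤
        ENNReal.ofReal (C * ‖χ y - χ x‖) := by
      rw [pathELength_eq_lintegral_mfderiv_Ioo]
      calc ∫⁻ t in Ioo (0 : ℝ) 1,
            ‖mfderiv 𝓘(ℝ, ℝ) 𝓘(ℝ, E) (fun t => χ.symm (η t)) t (1 : ℝ)‖ₑ
          ≤ ∫⁻ t in Ioo (0 : ℝ) 1, ENNReal.ofReal (C * ‖χ y - χ x‖) := by
            refine setLIntegral_mono' measurableSet_Ioo fun t ht => ?_
            have ht' : t ∈ Icc (0 : ℝ) 1 := Ioo_subset_Icc_self ht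
            obtain ⟨h1, h2⟩ := hRb' (hη t ht')
            have hγc : ContinuousAt (fun t => χ.symm (η t)) t :=
              (continuousAt_extChartAt_symm'' h1).comp (hηd t).continuousAt
            have hd : HasDerivAt (fun s => χ (χ.symm (η s))) (χ y - χ x) t := by
              refine (hηd t).congr_of_eventuallyEq ?_
              filter_upwards [(hηd t).continuousAt.eventually_mem
                ((isOpen_extChartAt_target (I := 𝓘(ℝ, E)) σ).mem_nhds h1)] with s hs
                using χ.right_inv hs
            have key := trivializationAt_mfderiv hγc (χ.map_target h1) hd
            have h3 := ((hRb h2).1 (mfderiv 𝓘(ℝ, ℝ) 𝓘(ℝ, E) (fun t => χ.symm (η t)) t (1 : ℝ))).1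
            rw [key] at h3
            rw [← ofReal_norm]
            exact ENNReal.ofReal_le_ofReal h3
        _ = ENNReal.ofReal (C * ‖χ y - χ x‖) := by simp
    have h4 := hlen.trans hlen2
    rw [← IsRiemannianManifold.out (I := 𝓘(ℝ, E)) x y, edist_dist,
      ENNReal.ofReal_le_ofReal_iff (by positivity)] at h4
    rwa [norm_sub_rev]
  · set χ := extChartAt 𝓘(ℝ, E) σ with hχ
    refine le_of_forall_pos_le_add fun ε hε => ?_
    obtain ⟨ε', hε', hε'1, hε'2⟩ : ∃ ε' > 0, ε' < R / 4 ∧ C * ε' ≤ ε :=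
      ⟨min (R / 8) (ε / C), by positivity, by linarith [min_le_left (R / 8) (ε / C)], by
        have := mul_le_mul_of_nonneg_left (min_le_right (R / 8) (ε / C)) hC.le
        rwa [mul_div_cancel₀ _ hC.ne'] at this⟩
    -- Take a nearly minimizing curve. It starts within R/4 of σ and its length is below R/2 + R/4,
    -- so it stays in the ball of radius R where velocities can be compared with the chart.
    have hlt : riemannianEDist 𝓘(ℝ, E) x y < ENNReal.ofReal (dist x y + ε') := by
      rw [← IsRiemannianManifold.out (I := 𝓘(ℝ, E)) x y, edist_dist]
      exact (ENNReal.ofReal_lt_ofReal_iff (by positivity)).2 (by linarith)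
    obtain ⟨γ, hγ0, hγ1, hγs, hγl⟩ := exists_lt_of_riemannianEDist_lt hlt
    rw [Metric.mem_ball] at hx hy
    have hδR := min_le_right δ₁ (R / 4)
    have hγb : ∀ t ∈ Icc (0 : ℝ) 1, γ t ∈ Metric.ball σ R := by
      intro t ht
      have h1 : riemannianEDist 𝓘(ℝ, E) x (γ t) ≤ pathELength 𝓘(ℝ, E) γ 0 t :=
        riemannianEDist_le_pathELength (hγs.mono (Icc_subset_Icc_right ht.2)) hγ0 rfl ht.1
      have h2 := (h1.trans (pathELength_mono le_rfl ht.2)).trans_lt hγl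
      rw [← IsRiemannianManifold.out (I := 𝓘(ℝ, E)) x (γ t), edist_dist,
        ENNReal.ofReal_lt_ofReal_iff (by positivity)] at h2
      have h3 := dist_triangle_right x y σ
      have h4 := dist_triangle_left (γ t) σ x
      rw [Metric.mem_ball]
      linarith
    have hu : ContDiffOn ℝ 1 (fun t => χ (γ t)) (Icc 0 1) := by
      rw [← contMDiffOn_iff_contDiffOn]
      exact (contMDiffOn_extChartAt (I := 𝓘(ℝ, E)) (n := 1) (x := σ)).comp hγs
        (fun t ht => by
          have := (hRb (hγb t ht)).2
          rwa [hχ, extChartAt_source] at this)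
    have h5 := enorm_sub_le_lintegral_derivWithin_Icc_of_contDiffOn_Icc hu zero_le_one
    rw [hγ0, hγ1] at h5
    have h6 : ∫⁻ t in Icc (0 : ℝ) 1, ‖derivWithin (fun t => χ (γ t)) (Icc 0 1) t‖ₑ ≤
        ENNReal.ofReal C * pathELength 𝓘(ℝ, E) γ 0 1 := by
      rw [pathELength_eq_lintegral_mfderiv_Ioo, ← lintegral_const_mul' _ _ ENNReal.ofReal_ne_top,
        ← restrict_Ioo_eq_restrict_Icc]
      refine setLIntegral_mono' measurableSet_Ioo fun t ht => ?_
      have hnhds : Icc (0 : ℝ) 1 ∈ 𝓝 t := Icc_mem_nhds ht.1 ht.2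
      have ht' : t ∈ Icc (0 : ℝ) 1 := Ioo_subset_Icc_self ht
      have hd := ((hu.contDiffAt hnhds).differentiableAt one_ne_zero).hasDerivAt
      rw [derivWithin_of_mem_nhds hnhds]
      have hγc : ContinuousAt γ t := (hγs.continuousOn t ht').continuousAt hnhds
      have key := trivializationAt_mfderiv hγc (hRb (hγb t ht')).2 hd
      have h7 := ((hRb (hγb t ht')).1 (mfderiv 𝓘(ℝ, ℝ) 𝓘(ℝ, E) γ t (1 : ℝ))).2
      rw [key] at h7
      rw [← ofReal_norm, ← ofReal_norm, ← ENNReal.ofReal_mul hC.le]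
      exact ENNReal.ofReal_le_ofReal h7
    have h8 : ENNReal.ofReal C * pathELength 𝓘(ℝ, E) γ 0 1 ≤
        ENNReal.ofReal (C * (dist x y + ε')) := by
      rw [ENNReal.ofReal_mul hC.le]
      gcongr
    have h9 := (h5.trans h6).trans h8
    rw [← ofReal_norm, ENNReal.ofReal_le_ofReal_iff (by positivity)] at h9
    rw [norm_sub_rev]
    linarith

end Comparison

end SingularFlow

namespace SingularFlow

/-! ### Quantitative inverse of a map close to the identity. -/

section LocalInverse

variable {F : Type*} [NormedAddCommGroup F] [NormedSpace ℝ F] [CompleteSpace F]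

/-- A quantitative inverse of a map close to the identity. -/
theorem exists_local_inverse {G : F → F} {r c : ℝ} (hr : 0 ≤ r) (hc0 : 0 ≤ c) (hc : c ≤ 1 / 2)
    (h0 : G 0 = 0)
    (hG : ∀ x y, ‖x‖ ≤ r → ‖y‖ ≤ r → ‖G x - G y - (x - y)‖ ≤ c * ‖x - y‖) :
    ∃ k : F → F, k 0 = 0 ∧ (∀ y, ‖y‖ ≤ r / 2 → ‖k y‖ ≤ r ∧ G (k y) = y) ∧
      (∀ y y', ‖y‖ ≤ r / 2 → ‖y'‖ ≤ r / 2 → ‖k y - k y' - (y - y')‖ ≤ 2 * c * ‖y - y'‖) ∧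
      ∀ x, ‖x‖ ≤ r → ‖G x‖ ≤ r / 2 → k (G x) = x := by
  have happ : ApproximatesLinearOn G (ContinuousLinearMap.id ℝ F) (Metric.closedBall 0 r)
      c.toNNReal := by
    intro x hx y hy
    rw [Real.coe_toNNReal _ hc0]
    exact hG x y (by simpa using hx) (by simpa using hy)
  let inv : (ContinuousLinearMap.id ℝ F).NonlinearRightInverse :=
    ⟨id, 1, fun y => by simp, fun y => rfl⟩
  -- The image of the ball of radius r contains the ball of radius (1 - c) r ≥ r/2.
  have hsurj := happ.surjOn_closedBall_of_nonlinearRightInverse inv hr subset_rfl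
  have hex : ∀ y : F, ∃ x, ‖y‖ ≤ r / 2 → ‖x‖ ≤ r ∧ G x = y := by
    intro y
    by_cases hy : ‖y‖ ≤ r / 2
    · obtain ⟨x, hx, hxy⟩ := hsurj (a := y) (by
        rw [h0, mem_closedBall_zero_iff, Real.coe_toNNReal _ hc0]
        have : ((inv.nnnorm : ℝ))⁻¹ = 1 := by simp [inv]
        rw [this]
        nlinarith)
      exact ⟨x, fun _ => ⟨by simpa using hx, hxy⟩⟩
    · exact ⟨0, fun h => absurd h hy⟩
  choose k hk using hex
  have hinj : ∀ x y, ‖x‖ ≤ r → ‖y‖ ≤ r → ‖x - y‖ ≤ 2 * ‖G x - G y‖ := by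
    intro x y hx hy
    have h1 := hG x y hx hy
    have h2 := norm_le_norm_add_norm_sub' (x - y) (G x - G y)
    rw [norm_sub_rev (x - y)] at h2
    nlinarith [norm_nonneg (x - y)]
  have hleft : ∀ x, ‖x‖ ≤ r → ‖G x‖ ≤ r / 2 → k (G x) = x := by
    intro x hx hGx
    obtain ⟨h1, h2⟩ := hk (G x) hGx
    have h3 := hinj _ _ h1 hx
    rw [h2, sub_self, norm_zero, mul_zero] at h3
    exact sub_eq_zero.1 (norm_le_zero_iff.1 h3)
  refine ⟨k, ?_, hk, fun y y' hy hy' => ?_, hleft⟩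
  · have := hleft 0 (by simpa using hr) (by rw [h0, norm_zero]; positivity)
    rwa [h0] at this
  · obtain ⟨h1, h2⟩ := hk y hy
    obtain ⟨h1', h2'⟩ := hk y' hy'
    have h3 := hG _ _ h1 h1'
    have h4 := hinj _ _ h1 h1'
    rw [h2, h2'] at h3 h4
    rw [norm_sub_rev]
    nlinarith [norm_nonneg (k y - k y')]

end LocalInverse

/-! ### The cone and the splitting under a linear isomorphism. -/

section Shell

variable {F : Type*} [NormedAddCommGroup F] [InnerProductSpace ℝ F]

/-- The cone in coordinates adapted to a saddle. -/
theorem mem_coneShell_iff {E : Type*} [NormedAddCommGroup E] [NormedSpace ℝ E] {J A : F →L[ℝ] F}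
    {lam : ℝ} (h : SaddleForm J A lam) {B : E →L[ℝ] E} {R : E ≃L[ℝ] F}
    (hs : ∀ v, v ∈ stableSpace B ↔ J (R v) = -R v) (hu : ∀ v, v ∈ unstableSpace B ↔ J (R v) = R v)
    {Q : LinearMap.BilinForm ℝ E} (hQ : ∀ v w, Q v w = inner ℝ (R v) (R w)) {s t : ℝ} {v : E} :
    v ∈ coneShell B Q s t ↔
      quad J (R v) = 0 ∧ s ≤ ‖R v‖ / √2 ∧ ‖R v‖ / √2 < t := by
  have hsq : ∀ v, √(Q v v) = ‖R v‖ := fun v => by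
    rw [hQ, real_inner_self_eq_norm_sq, Real.sqrt_sq (norm_nonneg _)]
  have h2 : (0 : ℝ) < √2 := by positivity
  have hs2 : √2 ^ 2 = (2 : ℝ) := Real.sq_sqrt (by norm_num)
  constructor
  · rintro ⟨a, ha, b, hb, rfl, hab, hsa, hta⟩
    rw [hsq, hsq] at hab
    rw [hsq] at hsa hta
    rw [hs] at ha
    rw [hu] at hb
    have horth : inner ℝ (R a) (R b) = 0 := by
      have h1 := h.symm (R a) (R b)
      rw [ha, hb, inner_neg_left] at h1
      linarith
    have hq : quad J (R (a + b)) = 0 := by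
      rw [quad, map_add, map_add, ha, hb, inner_add_right, inner_add_left, inner_add_left,
        inner_neg_left, inner_neg_left, real_inner_comm (R a) (R b), horth,
        real_inner_self_eq_norm_sq, real_inner_self_eq_norm_sq, hab]
      ring
    have hn : ‖R (a + b)‖ / √2 = ‖R a‖ := by
      rw [div_eq_iff h2.ne', ← sq_eq_sq₀ (norm_nonneg _) (by positivity), map_add,
        norm_add_sq_real, horth, ← hab, mul_pow, hs2]
      ring
    rw [hn]
    exact ⟨hq, hsa, hta⟩
  · rintro ⟨hq, hsv, htv⟩
    set f := R v with hf
    -- The stable and unstable components of f. On the cone f and Jf are orthogonal, so both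
    -- components have norm ‖f‖/√2.
    set a := R.symm ((1 / 2 : ℝ) • (f - J f)) with ha
    set b := R.symm ((1 / 2 : ℝ) • (f + J f)) with hb
    have hRa : R a = (1 / 2 : ℝ) • (f - J f) := by simp [ha]
    have hRb : R b = (1 / 2 : ℝ) • (f + J f) := by simp [hb]
    have hq' : inner ℝ f (J f) = 0 := by rw [real_inner_comm]; exact hq
    have hna : ‖R a‖ = ‖f‖ / √2 := by
      rw [eq_div_iff h2.ne', ← sq_eq_sq₀ (by positivity) (norm_nonneg _), mul_pow, hs2, hRa,
        norm_smul, mul_pow, norm_sub_sq_real, hq', h.norm_map]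
      norm_num
      ring
    have hnb : ‖R b‖ = ‖f‖ / √2 := by
      rw [eq_div_iff h2.ne', ← sq_eq_sq₀ (by positivity) (norm_nonneg _), mul_pow, hs2, hRb,
        norm_smul, mul_pow, norm_add_sq_real, hq', h.norm_map]
      norm_num
      ring
    refine ⟨a, ?_, b, ?_, ?_, ?_, ?_, ?_⟩
    · rw [hs, hRa, map_smul, map_sub, h.invol, ← smul_neg, neg_sub]
    · rw [hu, hRb, map_smul, map_add, h.invol, add_comm]
    · apply R.injective
      rw [map_add, hRa, hRb, ← hf, ← smul_add]
      have : f - J f + (f + J f) = (2 : ℝ) • f := by rw [two_smul]; abel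
      rw [this, smul_smul]
      norm_num
    · rw [hsq, hsq, hna, hnb]
    · rw [hsq, hna]; exact hsv
    · rw [hsq, hna]; exact htv

theorem IsHyperbolicSaddle.conj {E : Type*} [NormedAddCommGroup E] [NormedSpace ℝ E]
    {A : F →L[ℝ] F} (h : IsHyperbolicSaddle A) {B : E →L[ℝ] E} {R : E ≃L[ℝ] F}
    (hs : ∀ v, v ∈ stableSpace B ↔ R v ∈ stableSpace A)
    (hu : ∀ v, v ∈ unstableSpace B ↔ R v ∈ unstableSpace A) : IsHyperbolicSaddle B where
  isCompl := by
    constructor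
    · rw [Submodule.disjoint_def]
      intro v h1 h2
      rw [hs] at h1
      rw [hu] at h2
      have := Submodule.disjoint_def.1 h.isCompl.disjoint _ h1 h2
      simpa using this
    · rw [codisjoint_iff, Submodule.eq_top_iff']
      intro v
      have h1 : R v ∈ stableSpace A ⊔ unstableSpace A := by
        rw [h.isCompl.sup_eq_top]; trivial
      obtain ⟨a, ha, b, hb, hab⟩ := Submodule.mem_sup.1 h1
      refine Submodule.mem_sup.2 ⟨R.symm a, ?_, R.symm b, ?_, ?_⟩
      · rw [hs]; simpa using ha
      · rw [hu]; simpa using hb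
      · rw [← map_add, hab]; simp
  stable_ne_bot := by
    obtain ⟨v, hv, hv0⟩ := (Submodule.ne_bot_iff _).1 h.stable_ne_bot
    exact (Submodule.ne_bot_iff _).2 ⟨R.symm v, by rw [hs]; simpa using hv, by simpa using hv0⟩
  unstable_ne_bot := by
    obtain ⟨v, hv, hv0⟩ := (Submodule.ne_bot_iff _).1 h.unstable_ne_bot
    exact (Submodule.ne_bot_iff _).2 ⟨R.symm v, by rw [hu]; simpa using hv, by simpa using hv0⟩

end Shell

/-! ### The field in a chart -/

section LocalRep

variable {E : Type*} [NormedAddCommGroup E] [NormedSpace ℝ E]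
  {M : Type*} [MetricSpace M] [ChartedSpace E M] [IsManifold 𝓘(ℝ, E) ∞ M]

theorem localRep_apply (Y : C1VectorField E M) {p x : M}
    (hx : x ∈ (extChartAt 𝓘(ℝ, E) p).source) :
    localRep Y p (extChartAt 𝓘(ℝ, E) p x) = tangentCoordChange 𝓘(ℝ, E) x p x (Y x) := by
  have e : ∀ y, y = x → (trivializationAt E (TangentSpace 𝓘(ℝ, E) : M → Type _) p ⟨y, Y y⟩).2 =
      (trivializationAt E (TangentSpace 𝓘(ℝ, E) : M → Type _) p ⟨x, Y x⟩).2 := by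
    rintro y rfl; rfl
  exact (e _ ((extChartAt 𝓘(ℝ, E) p).left_inv hx)).trans (trivializationAt_snd_eq p x (Y x))

theorem localRep_apply_of_mem_target (Y : C1VectorField E M) {p : M} {z : E}
    (hz : z ∈ (extChartAt 𝓘(ℝ, E) p).target) :
    localRep Y p z = tangentCoordChange 𝓘(ℝ, E) ((extChartAt 𝓘(ℝ, E) p).symm z) p
      ((extChartAt 𝓘(ℝ, E) p).symm z) (Y ((extChartAt 𝓘(ℝ, E) p).symm z)) := by
  rw [← localRep_apply Y ((extChartAt 𝓘(ℝ, E) p).map_target hz),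
    (extChartAt 𝓘(ℝ, E) p).right_inv hz]

theorem localRep_eq_zero_iff (Y : C1VectorField E M) {p x : M}
    (hx : x ∈ (extChartAt 𝓘(ℝ, E) p).source) :
    localRep Y p (extChartAt 𝓘(ℝ, E) p x) = 0 ↔ Y x = 0 := by
  rw [localRep_apply Y hx]
  constructor
  · intro h
    have h1 := tangentCoordChange_inv (mem_extChartAt_source (I := 𝓘(ℝ, E)) x) hx (Y x : E)
    rw [h, map_zero] at h1
    exact h1.symm
  · intro h
    have h1 : tangentCoordChange 𝓘(ℝ, E) x p x (0 : E) = 0 := map_zero _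
    exact (congrArg (tangentCoordChange 𝓘(ℝ, E) x p x) h).trans h1

theorem contDiffOn_localRep (Y : C1VectorField E M) (p : M) :
    ContDiffOn ℝ 1 (localRep Y p) (extChartAt 𝓘(ℝ, E) p).target := by
  rw [← contMDiffOn_iff_contDiffOn]
  have h1 : ContMDiffOn 𝓘(ℝ, E) 𝓘(ℝ, E) 1
      (fun x => (trivializationAt E (TangentSpace 𝓘(ℝ, E) : M → Type _) p ⟨x, Y x⟩).2)
      (trivializationAt E (TangentSpace 𝓘(ℝ, E) : M → Type _) p).baseSet :=
    (Trivialization.contMDiffOn_section_baseSet_iff _).1 Y.contMDiff.contMDiffOn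
  refine h1.comp (contMDiffOn_extChartAt_symm (I := 𝓘(ℝ, E)) (n := 1) p) fun z hz => ?_
  have := (extChartAt 𝓘(ℝ, E) p).map_target hz
  simpa using this

/-- The coordinate expressions in two charts. -/
theorem localRep_eventuallyEq (Y : C1VectorField E M) {p q : M}
    (hq : q ∈ (extChartAt 𝓘(ℝ, E) p).source) :
    localRep Y q =ᶠ[𝓝 (extChartAt 𝓘(ℝ, E) q q)] fun z =>
      tangentCoordChange 𝓘(ℝ, E) p q ((extChartAt 𝓘(ℝ, E) q).symm z)
        (localRep Y p ((extChartAt 𝓘(ℝ, E) p ∘ (extChartAt 𝓘(ℝ, E) q).symm) z)) := by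
  filter_upwards [eventually_mem_source_symm (mem_extChartAt_source (I := 𝓘(ℝ, E)) q) hq]
    with z hz
  set x := (extChartAt 𝓘(ℝ, E) q).symm z with hx
  have hxq : x ∈ (extChartAt 𝓘(ℝ, E) q).source := (extChartAt 𝓘(ℝ, E) q).map_target hz.1
  rw [localRep_apply_of_mem_target Y hz.1, Function.comp_apply, ← hx, localRep_apply Y hz.2]
  exact (tangentCoordChange_comp (I := 𝓘(ℝ, E))
    ⟨⟨mem_extChartAt_source (I := 𝓘(ℝ, E)) x, hz.2⟩, hxq⟩).symm

/-- The linearization at a zero is conjugate to the derivative in a chart. -/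
theorem linearization_eq (Y : C1VectorField E M) {p q : M}
    (hq : q ∈ (extChartAt 𝓘(ℝ, E) p).source) (h0 : Y q = 0) :
    linearization Y q = (tangentCoordChange 𝓘(ℝ, E) p q q) ∘L
      (fderiv ℝ (localRep Y p) (extChartAt 𝓘(ℝ, E) p q)) ∘L
      (tangentCoordChange 𝓘(ℝ, E) q p q) := by
  have hqq := mem_extChartAt_source (I := 𝓘(ℝ, E)) q
  rw [linearization, (localRep_eventuallyEq Y hq).fderiv_eq]
  have hq0 : (extChartAt 𝓘(ℝ, E) q).symm (extChartAt 𝓘(ℝ, E) q q) = q := extChartAt_to_inv q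
  have htr := hasFDerivAt_transition hqq hq
  have hval : (extChartAt 𝓘(ℝ, E) p ∘ (extChartAt 𝓘(ℝ, E) q).symm) (extChartAt 𝓘(ℝ, E) q q) =
      extChartAt 𝓘(ℝ, E) p q := by rw [Function.comp_apply, hq0]
  have hrep : HasFDerivAt (localRep Y p) (fderiv ℝ (localRep Y p) (extChartAt 𝓘(ℝ, E) p q))
      (extChartAt 𝓘(ℝ, E) p q) :=
    (((contDiffOn_localRep Y p).contDiffAt (extChartAt_target_mem_nhds'
      ((extChartAt 𝓘(ℝ, E) p).map_source hq))).differentiableAt one_ne_zero).hasFDerivAt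
  have hcomp : HasFDerivAt (localRep Y p ∘ (extChartAt 𝓘(ℝ, E) p ∘ (extChartAt 𝓘(ℝ, E) q).symm))
      (fderiv ℝ (localRep Y p) (extChartAt 𝓘(ℝ, E) p q) ∘L
        tangentCoordChange 𝓘(ℝ, E) q p q) (extChartAt 𝓘(ℝ, E) q q) := by
    refine HasFDerivAt.comp (g := localRep Y p) _ ?_ htr
    rw [hval]
    exact hrep
  -- the change of coordinates is differentiable
  have hT : DifferentiableAt ℝ (fun z => tangentCoordChange 𝓘(ℝ, E) p q
      ((extChartAt 𝓘(ℝ, E) q).symm z)) (extChartAt 𝓘(ℝ, E) q q) := by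
    have h1 : DifferentiableAt ℝ (fderiv ℝ (extChartAt 𝓘(ℝ, E) q ∘ (extChartAt 𝓘(ℝ, E) p).symm))
        (extChartAt 𝓘(ℝ, E) p q) :=
      ((contDiffAt_transition hq hqq).fderiv_right (m := 1) (by decide)).differentiableAt
        one_ne_zero
    have h2 : DifferentiableAt ℝ (fun z =>
        fderiv ℝ (extChartAt 𝓘(ℝ, E) q ∘ (extChartAt 𝓘(ℝ, E) p).symm)
          ((extChartAt 𝓘(ℝ, E) p ∘ (extChartAt 𝓘(ℝ, E) q).symm) z)) (extChartAt 𝓘(ℝ, E) q q) :=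
      DifferentiableAt.comp (extChartAt 𝓘(ℝ, E) q q) (by rw [hval]; exact h1)
        htr.differentiableAt
    refine h2.congr_of_eventuallyEq ?_
    filter_upwards [eventually_mem_source_symm hqq hq] with z hz
    rw [Function.comp_apply]
    exact (hasFDerivAt_transition hz.2 ((extChartAt 𝓘(ℝ, E) q).map_target hz.1)).fderiv.symm
  have hfin := hT.hasFDerivAt.clm_apply hcomp
  refine hfin.fderiv.trans ?_
  ext v
  -- The derivative of the change of coordinates is applied to the value of the field at q, which is
  -- 0; this is why the linearization at a zero is merely conjugated.
  have hz0 : localRep Y p ((extChartAt 𝓘(ℝ, E) p ∘ (extChartAt 𝓘(ℝ, E) q).symm)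
      (extChartAt 𝓘(ℝ, E) q q)) = 0 := by
    rw [hval]; exact (localRep_eq_zero_iff Y hq).2 h0
  simp only [ContinuousLinearMap.comp_apply,
    Function.comp_apply (f := localRep Y p), hz0,
    map_zero, add_zero, hq0]

/-- Orbits in a chart. -/
theorem IsFlowOf.hasDerivAt {φ : Flow ℝ M} {Y : C1VectorField E M} (h : IsFlowOf φ Y) {p x : M}
    {t : ℝ} (hx : φ t x ∈ (extChartAt 𝓘(ℝ, E) p).source) :
    HasDerivAt (fun s => extChartAt 𝓘(ℝ, E) p (φ s x))
      (localRep Y p (extChartAt 𝓘(ℝ, E) p (φ t x))) t := by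
  obtain ⟨hc, hd⟩ := h x t
  have hxx := mem_extChartAt_source (I := 𝓘(ℝ, E)) (φ t x)
  have h1 : HasFDerivWithinAt (fun s => extChartAt 𝓘(ℝ, E) (φ t x) (φ s x))
      ((1 : ℝ →L[ℝ] ℝ).smulRight (Y (φ t x) : E)) univ t := by
    rw [← range_id (α := ℝ)]
    exact hd
  rw [hasFDerivWithinAt_univ] at h1
  have h2 : HasDerivAt (fun s => extChartAt 𝓘(ℝ, E) (φ t x) (φ s x)) (Y (φ t x) : E) t := by
    have key : ∀ (u : ℝ → E) (v : E), HasFDerivAt u ((1 : ℝ →L[ℝ] ℝ).smulRight v) t →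
        HasDerivAt u v t := fun u v hu => hu.hasDerivAt.congr_deriv (by simp)
    exact key _ _ h1
  have h3 : HasDerivAt (fun s => (extChartAt 𝓘(ℝ, E) p ∘ (extChartAt 𝓘(ℝ, E) (φ t x)).symm)
      (extChartAt 𝓘(ℝ, E) (φ t x) (φ s x)))
      (tangentCoordChange 𝓘(ℝ, E) (φ t x) p (φ t x) (Y (φ t x) : E)) t :=
    (hasFDerivAt_transition hxx hx).comp_hasDerivAt t h2
  rw [localRep_apply Y hx]
  refine h3.congr_of_eventuallyEq ?_
  filter_upwards [hc.eventually_mem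
    ((isOpen_extChartAt_source (I := 𝓘(ℝ, E)) (φ t x)).mem_nhds hxx)] with s hs
  simp only [Function.comp_apply, (extChartAt 𝓘(ℝ, E) (φ t x)).left_inv hs]

/-- The constant curve is an integral curve, and integral curves of a C¹ field are unique. -/
theorem IsFlowOf.fixed [FiniteDimensional ℝ E] {φ : Flow ℝ M} {Y : C1VectorField E M}
    (h : IsFlowOf φ Y) {p : M} (hp : Y p = 0) (t : ℝ) : φ t p = p := by
  have : CompleteSpace E := FiniteDimensional.complete ℝ E
  have : IsManifold 𝓘(ℝ, E) 1 M := IsManifold.of_le (n := ∞) (by decide)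
  have hconst : IsMIntegralCurve (I := 𝓘(ℝ, E)) (fun _ : ℝ => p) (fun y => Y y) := by
    intro t
    have h1 := hasMFDerivAt_const (I := 𝓘(ℝ, ℝ)) (I' := 𝓘(ℝ, E)) p t
    have h2 : ((1 : ℝ →L[ℝ] ℝ).smulRight (Y p) : ℝ →L[ℝ] TangentSpace 𝓘(ℝ, E) p) = 0 := by
      rw [hp]; exact ContinuousLinearMap.smulRight_zero _
    rw [h2]
    exact h1
  have := isMIntegralCurve_Ioo_eq_of_contMDiff_boundaryless (t₀ := 0) Y.contMDiff (h p) hconst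
    (by simp only [Flow.map_zero_apply])
  exact congrFun this t

/-- Closeness on a compact subset of a chart is a neighbourhood in the `C^1` topology. -/
theorem eventually_localRep_close (X : C1VectorField E M) {p : M} {K : Set E} (hK : IsCompact K)
    (hKt : K ⊆ (extChartAt 𝓘(ℝ, E) p).target) {ε : ℝ} (hε : 0 < ε) :
    ∀ᶠ Y in 𝓝 X, ∀ z ∈ K, ‖localRep Y p z - localRep X p z‖ < ε ∧
      ‖fderiv ℝ (localRep Y p) z - fderiv ℝ (localRep X p) z‖ < ε := by
  set 𝔖 := {K : Set E | IsCompact K ∧ K ⊆ (extChartAt 𝓘(ℝ, E) p).target} with h𝔖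
  set Φ : C1VectorField E M → UniformOnFun E (E × (E →L[ℝ] E)) 𝔖 := fun Y =>
    UniformOnFun.ofFun 𝔖 (fun z => (localRep Y p z, fderiv ℝ (localRep Y p) z)) with hΦ
  have hcont : Continuous Φ := by
    refine continuous_iff_le_induced.2 ?_
    exact iInf_le _ p
  have hmem := UniformOnFun.gen_mem_nhds (E × (E →L[ℝ] E)) 𝔖 (Φ X) (s := K) ⟨hK, hKt⟩
    (Metric.dist_mem_uniformity hε)
  filter_upwards [hcont.continuousAt.preimage_mem_nhds hmem] with Y hY z hz
  have h1 := hY z hz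
  simp only [hΦ, UniformOnFun.toFun_ofFun] at h1
  rw [dist_comm, Prod.dist_eq, max_lt_iff, dist_eq_norm, dist_eq_norm] at h1
  exact h1

end LocalRep

end SingularFlow

namespace SingularFlow

/-! ### The inner product on the tangent space. -/

section Pullback

variable {E : Type*} [NormedAddCommGroup E] [NormedSpace ℝ E]
  {F : Type*} [NormedAddCommGroup F] [InnerProductSpace ℝ F]

/-- The inner product pulled back by an isomorphism. -/
noncomputable def pullbackInner (R : E ≃L[ℝ] F) : LinearMap.BilinForm ℝ E :=
  (innerₗ F).compl₁₂ (R : E →ₗ[ℝ] F) (R : E →ₗ[ℝ] F)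

theorem pullbackInner_apply (R : E ≃L[ℝ] F) (v w : E) :
    pullbackInner R v w = inner ℝ (R v) (R w) := rfl

theorem SaddleForm.isSplittingInner_pullback {J B : F →L[ℝ] F} {lam : ℝ} (h : SaddleForm J B lam)
    {A : E →L[ℝ] E} {R : E ≃L[ℝ] F} (hs : ∀ v, v ∈ stableSpace A ↔ J (R v) = -R v)
    (hu : ∀ v, v ∈ unstableSpace A ↔ J (R v) = R v) : IsSplittingInner A (pullbackInner R) where
  symm v w := by rw [pullbackInner_apply, pullbackInner_apply, real_inner_comm]
  pos v hv := by
    rw [pullbackInner_apply]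
    exact real_inner_self_pos.2 (by simpa using hv)
  ortho a ha b hb := by
    rw [pullbackInner_apply]
    have h1 := h.symm (R a) (R b)
    rw [(hs a).1 ha, (hu b).1 hb, inner_neg_left] at h1
    linarith

end Pullback

/-! ### From a saddle model to the properties of the section and of the partition. -/

section Model

variable {E : Type*} [NormedAddCommGroup E] [NormedSpace ℝ E]
  {M : Type*} [MetricSpace M] [ChartedSpace E M] [IsManifold 𝓘(ℝ, E) ∞ M]
  [RiemannianBundle (fun x : M => TangentSpace 𝓘(ℝ, E) x)]
  {F : Type*} [NormedAddCommGroup F] [InnerProductSpace ℝ F]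

/-- A chart `ζ` around a singularity `p` of the field `Y` in which `Y` becomes a local saddle `Z`
and the exponential map, read through `R : T_p M → F`, is inverse to `k`. -/
structure IsSaddleModel (Y : C1VectorField E M) (p : M) (ζ : OpenPartialHomeomorph M F)
    (R : E ≃L[ℝ] F) (J A B : F →L[ℝ] F) (Z k : F → F) (lam Λ ε ρ m r₀ c : ℝ) : Prop extends
    IsLocalSaddle J A Z k lam Λ ε ρ where
  rho_le : ρ ≤ 1 / 2
  target_eq : ζ.target = Metric.ball 0 ρ
  mem_source : p ∈ ζ.source
  map_vertex : ζ p = 0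
  le_m : 10 ≤ m
  le_dist : ∀ x ∈ ζ.source, 10 * ‖ζ x‖ ≤ dist x p
  dist_le : ∀ x ∈ ζ.source, dist x p ≤ m * ‖ζ x‖
  stable : ∃ w, w ≠ 0 ∧ J w = -w
  unstable : ∃ w, w ≠ 0 ∧ J w = w
  closedBall_subset : Metric.closedBall p r₀ ⊆ ζ.source
  zero : Y p = 0
  block : SaddleForm J B (lam / 2)
  linearization_eq : linearization Y p = R.symm ∘L B ∘L R
  exp : ∀ v, 2 * ‖R v‖ < ρ → ∃ q ∈ ζ.source, k (ζ q) = R v ∧ ∀ q', IsExp p v q' ↔ q' = q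
  hasFDerivAt : ∀ x ∈ ζ.source, ∃ T : E →L[ℝ] F,
    HasFDerivAt (ζ ∘ (extChartAt 𝓘(ℝ, E) x).symm) T (extChartAt 𝓘(ℝ, E) x x) ∧ T (Y x) = Z (ζ x)
  one_le_c : 1 ≤ c
  norm_field_le : ∀ x ∈ ζ.source, ‖Y x‖ ≤ c * ‖Z (ζ x)‖
  le_norm_field : ∀ x ∈ ζ.source, ‖Z (ζ x)‖ ≤ c * ‖Y x‖

namespace IsSaddleModel

variable {Y : C1VectorField E M} {p : M} {ζ : OpenPartialHomeomorph M F}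
  {R : E ≃L[ℝ] F} {J A B : F →L[ℝ] F} {Z k : F → F} {lam Λ ε ρ m r₀ c r : ℝ} {N : ℕ}

theorem mem_stableSpace_iff [CompleteSpace E] [CompleteSpace F]
    (h : IsSaddleModel Y p ζ R J A B Z k lam Λ ε ρ m r₀ c) (v : E) :
    v ∈ stableSpace (linearization Y p) ↔ J (R v) = -R v := by
  rw [h.linearization_eq, mem_stableSpace_conj, h.block.mem_stableSpace_iff (half_pos h.lam_pos)]

theorem mem_unstableSpace_iff [CompleteSpace E] [CompleteSpace F]
    (h : IsSaddleModel Y p ζ R J A B Z k lam Λ ε ρ m r₀ c) (v : E) :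
    v ∈ unstableSpace (linearization Y p) ↔ J (R v) = R v := by
  rw [h.linearization_eq, mem_unstableSpace_conj,
    h.block.mem_unstableSpace_iff (half_pos h.lam_pos)]

theorem isSplittingInner [CompleteSpace E] [CompleteSpace F]
    (h : IsSaddleModel Y p ζ R J A B Z k lam Λ ε ρ m r₀ c) :
    IsSplittingInner (linearization Y p) (pullbackInner R) :=
  h.block.isSplittingInner_pullback h.mem_stableSpace_iff h.mem_unstableSpace_iff

theorem isSaddleSingularity [CompleteSpace E] [CompleteSpace F]
    (h : IsSaddleModel Y p ζ R J A B Z k lam Λ ε ρ m r₀ c) : IsSaddleSingularity Y p := by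
  have hB := h.block.isHyperbolicSaddle (half_pos h.lam_pos) h.stable h.unstable
  exact ⟨h.zero, hB.conj (R := R) (fun v => by rw [h.linearization_eq, mem_stableSpace_conj])
    fun v => by rw [h.linearization_eq, mem_unstableSpace_conj]⟩

theorem exists_cone (h : IsSaddleModel Y p ζ R J A B Z k lam Λ ε ρ m r₀ c) :
    ∃ w, w ≠ 0 ∧ quad J w = 0 := by
  obtain ⟨a, ha, hJa⟩ := h.stable
  obtain ⟨b, hb, hJb⟩ := h.unstable
  have hab : inner ℝ a b = 0 := by
    have h1 := h.form.symm a b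
    rw [hJa, hJb, inner_neg_left] at h1
    linarith
  have hq : ∀ s t : ℝ, quad J (s • a + t • b) = t ^ 2 * ‖b‖ ^ 2 - s ^ 2 * ‖a‖ ^ 2 := by
    intro s t
    simp only [quad, map_add, map_smul, hJa, hJb, inner_add_left, inner_add_right,
      real_inner_smul_left, real_inner_smul_right, inner_neg_left, hab, real_inner_comm a b,
      real_inner_self_eq_norm_sq, norm_smul, mul_pow, Real.norm_eq_abs, sq_abs]
    ring
  -- A stable and an unstable vector scaled to the same length ‖a‖‖b‖.
  refine ⟨‖b‖ • a + ‖a‖ • b, fun h0 => ?_, by rw [hq]; ring⟩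
  have h1 : inner ℝ (‖b‖ • a + ‖a‖ • b) a = ‖b‖ * ‖a‖ ^ 2 := by
    rw [inner_add_left, real_inner_smul_left, real_inner_smul_left, real_inner_comm a b, hab,
      real_inner_self_eq_norm_sq]
    ring
  rw [h0, inner_zero_left] at h1
  have : 0 < ‖b‖ * ‖a‖ ^ 2 := by positivity
  linarith

/-- Shells of the exponential cone, in coordinates. -/
theorem expImage_coneShell [CompleteSpace E] [CompleteSpace F]
    (h : IsSaddleModel Y p ζ R J A B Z k lam Λ ε ρ m r₀ c) {s t : ℝ} (ht : 3 * t ≤ ρ) :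
    expImage p (coneShell (linearization Y p) (pullbackInner R) s t) = coordShell ζ J k s t := by
  have hmem : ∀ v, v ∈ coneShell (linearization Y p) (pullbackInner R) s t ↔
      quad J (R v) = 0 ∧ s ≤ ‖R v‖ / √2 ∧ ‖R v‖ / √2 < t := fun v =>
    mem_coneShell_iff h.block h.mem_stableSpace_iff h.mem_unstableSpace_iff (pullbackInner_apply R)
  have h2 : (0 : ℝ) < √2 := by positivity
  have hsmall : ∀ f : F, ‖f‖ / √2 < t → 2 * ‖f‖ < ρ := by
    intro f hf
    rw [div_lt_iff₀ h2] at hf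
    have ht0 : 0 < t := by
      by_contra hn
      have := mul_nonpos_of_nonpos_of_nonneg (not_lt.1 hn) h2.le
      linarith [norm_nonneg f]
    have : √2 ≤ 1.5 := by
      rw [Real.sqrt_le_left (by norm_num)]; norm_num
    nlinarith
  ext q
  constructor
  · rintro ⟨v, hv, hexp⟩
    rw [hmem] at hv
    obtain ⟨q₁, hq₁, hk, hiff⟩ := h.exp v (hsmall _ hv.2.2)
    rw [(hiff q).1 hexp]
    refine ⟨hq₁, ?_⟩
    rw [hk]
    exact hv
  · rintro ⟨hq, h0, hs, ht'⟩
    have hv : ∃ v, R v = k (ζ q) := ⟨R.symm (k (ζ q)), by simp⟩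
    obtain ⟨v, hv⟩ := hv
    obtain ⟨q₁, hq₁, hk, hiff⟩ := h.exp v (by rw [hv]; exact hsmall _ ht')
    refine ⟨v, ?_, ?_⟩
    · rw [hmem, hv]
      exact ⟨h0, hs, ht'⟩
    · rw [hiff]
      refine ζ.injOn hq hq₁ ?_
      have hb : ∀ x ∈ ζ.source, ζ x ∈ Metric.ball 0 ρ := fun x hx => by
        rw [← h.target_eq]; exact ζ.map_source hx
      -- Since ε < 1, closeness to the identity makes `k` injective on the ball, so the exponential
      -- reaches q itself.
      have h1 := h.k_approx _ (hb q hq) _ (hb _ hq₁)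
      rw [hk, hv, sub_self, zero_sub, norm_neg] at h1
      have h3 : ε < 1 := by nlinarith [h.eps_small, h.eps_nonneg, h.one_le, h.lam_le_one]
      have h4 : ‖ζ q - ζ q₁‖ = 0 := by
        by_contra hne
        have : 0 < ‖ζ q - ζ q₁‖ := lt_of_le_of_ne (norm_nonneg _) (Ne.symm hne)
        nlinarith
      exact sub_eq_zero.1 (norm_eq_zero.1 h4)

theorem isSaddleChart (h : IsSaddleModel Y p ζ R J A B Z k lam Λ ε ρ m r₀ c) (hr : 0 < r)
    (hr₀ : r ≤ r₀) (hN : 2 * m * Real.exp (-((N : ℝ) / 2)) ≤ r) (hΛ : 8 * Λ ≤ N) :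
    IsSaddleChart ζ p J A Z k lam Λ ε ρ m r N where
  toIsLocalSaddle := h.toIsLocalSaddle
  rho_le := h.rho_le
  target_eq := h.target_eq
  mem_source := h.mem_source
  map_vertex := h.map_vertex
  m_pos := by linarith [h.le_m]
  le_dist := h.le_dist
  dist_le := h.dist_le
  cone := h.exists_cone
  r_pos := hr
  closedBall_subset := (Metric.closedBall_subset_closedBall hr₀).trans h.closedBall_subset
  le_r := hN
  le_N := hΛ

theorem isSaddleBall [FiniteDimensional ℝ E]
    (h : IsSaddleModel Y p ζ R J A B Z k lam Λ ε ρ m r₀ c) (hr : 0 < r)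
    (hr₀ : r ≤ r₀) (hN : 2 * m * Real.exp (-((N : ℝ) / 2)) ≤ r) (hΛ : 8 * Λ ≤ N) {φ : Flow ℝ M}
    (hφ : IsFlowOf φ Y) : IsSaddleBall ζ p φ J A Z k lam Λ ε ρ m r N where
  toIsSaddleChart := h.isSaddleChart hr hr₀ hN hΛ
  fixed := hφ.fixed h.zero
  hasDerivAt x t hx := by
    obtain ⟨T, hT, hTY⟩ := h.hasFDerivAt _ hx
    have hxx := mem_extChartAt_source (I := 𝓘(ℝ, E)) (φ t x)
    have h1 := hφ.hasDerivAt (p := φ t x) (x := x) (t := t) hxx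
    rw [localRep_apply Y hxx, tangentCoordChange_self (I := 𝓘(ℝ, E)) (v := (Y (φ t x) : E)) hxx]
      at h1
    have h2 := HasFDerivAt.comp_hasDerivAt t hT h1
    rw [hTY] at h2
    refine h2.congr_of_eventuallyEq ?_
    filter_upwards [((hφ x t).1.eventually_mem
      ((isOpen_extChartAt_source (I := 𝓘(ℝ, E)) (φ t x)).mem_nhds hxx))] with s hs
    simp only [Function.comp_apply, (extChartAt 𝓘(ℝ, E) (φ t x)).left_inv hs]

theorem layer_eq [CompleteSpace E] [CompleteSpace F]
    (h : IsSaddleModel Y p ζ R J A B Z k lam Λ ε ρ m r₀ c) (hN : 3 * Real.exp (-(N : ℝ)) ≤ ρ)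
    {n : ℕ} (hn : N ≤ n) : layer Y p (pullbackInner R) n = coordLayer ζ J k n := by
  refine h.expImage_coneShell (le_trans ?_ hN)
  have : (N : ℝ) ≤ n := by exact_mod_cast hn
  gcongr

theorem crossSection_eq [CompleteSpace E] [CompleteSpace F]
    (h : IsSaddleModel Y p ζ R J A B Z k lam Λ ε ρ m r₀ c) (hN : 3 * Real.exp (-(N : ℝ)) ≤ ρ) :
    crossSection Y p (pullbackInner R) N =
      coordShell ζ J k 0 (Real.exp (-((N : ℝ) + 1))) := by
  refine h.expImage_coneShell (le_trans ?_ hN)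
  gcongr
  linarith

theorem crossSectionProps [FiniteDimensional ℝ E] [FiniteDimensional ℝ F] [MeasurableSpace M]
    [BorelSpace M] (h : IsSaddleModel Y p ζ R J A B Z k lam Λ ε ρ m r₀ c) (hr : 0 < r)
    (hr₀ : r ≤ r₀) (hN : 2 * m * Real.exp (-((N : ℝ) / 2)) ≤ r) (hΛ : 8 * Λ ≤ N)
    (hNρ : 3 * Real.exp (-(N : ℝ)) ≤ ρ) :
    CrossSectionProps Y p (pullbackInner R) r N (lam / (2 * c)) (3 * c * Λ) := by
  have : CompleteSpace E := FiniteDimensional.complete ℝ E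
  have : CompleteSpace F := FiniteDimensional.complete ℝ F
  have hc := h.isSaddleChart hr hr₀ hN hΛ
  have hlay : ∀ n, N < n → layer Y p (pullbackInner R) n = coordLayer ζ J k n :=
    fun n hn => h.layer_eq hNρ hn.le
  have hcs := h.crossSection_eq hNρ
  have hc0 : 0 < c := by linarith [h.one_le_c]
  have hmem : p ∈ coordShell ζ J k 0 (Real.exp (-((N : ℝ) + 1))) := by
    refine ⟨h.mem_source, ?_⟩
    rw [h.map_vertex, h.k_zero]
    simp [quad, Real.exp_pos]
  have hb : ∀ x ∈ ζ.source, ζ x ∈ Metric.ball 0 ρ := fun x hx => by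
    rw [← h.target_eq]; exact ζ.map_source hx
  have h2 : (0 : ℝ) < √2 := by positivity
  have hs2 : √2 ≤ 1.5 := by rw [Real.sqrt_le_left (by norm_num)]; norm_num
  refine ⟨fun v hv => ?_, ?_, ?_, fun x hx hxp htan => ?_, fun n hn => ?_, fun n hn => ?_,
    fun i j hi hj hij => ?_, ?_, fun n hn x hx => ?_⟩
  · rw [mem_coneShell_iff h.block h.mem_stableSpace_iff h.mem_unstableSpace_iff
      (pullbackInner_apply R)] at hv
    have h1 := hv.2.2
    rw [div_lt_iff₀ h2] at h1
    have h3 : Real.exp (-((N : ℝ) + 1)) ≤ Real.exp (-(N : ℝ)) := by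
      rw [Real.exp_le_exp]; linarith
    obtain ⟨q, -, -, hq⟩ := h.exp v (by
      nlinarith [Real.exp_pos (-((N : ℝ) + 1)), norm_nonneg (R v)])
    exact ⟨q, (hq q).2 rfl, fun q' hq' => (hq q').1 hq'⟩
  · rw [hcs]
    intro x hx
    by_cases hxp : x = p
    · rw [hxp]; exact Metric.mem_ball_self hr
    · obtain ⟨n, hn, hxn⟩ := hc.exists_mem_layer hx hxp
      exact hc.mem_ball_of_mem_layer hn hxn
  · rw [hcs]; exact hmem
  · rw [hcs] at hx htan
    obtain ⟨T, hT, hTY⟩ := h.hasFDerivAt x hx.1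
    -- The derivative of ζ carries a tangent vector of the section, in the chart at x, to a tangent
    -- vector of its image in `F`, and carries Y x to Z(ζ x).
    have h1 := (hT.hasFDerivWithinAt (s := extChartAt 𝓘(ℝ, E) x ''
      (coordShell ζ J k 0 (Real.exp (-((N : ℝ) + 1))) ∩
        (extChartAt 𝓘(ℝ, E) x).source))).mapsTo_tangent_cone htan
    rw [hTY, Function.comp_apply, extChartAt_to_inv] at h1
    refine h.notMem_tangentConeAt (hb x hx.1) (hc.map_ne_zero hx.1 hxp) ?_ ?_ h1
    · rintro _ ⟨_, ⟨y, hy, rfl⟩, rfl⟩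
      rw [Function.comp_apply, (extChartAt 𝓘(ℝ, E) x).left_inv hy.2]
      exact hy.1.2.1
    · refine ⟨_, ⟨x, ⟨hx, mem_extChartAt_source x⟩, rfl⟩, ?_⟩
      rw [Function.comp_apply, extChartAt_to_inv]
  · obtain ⟨w, hw0, hw⟩ := h.exists_cone
    -- Scaled so that the box norm is exactly e^{-(n+1)}, the inner radius, which belongs to the
    -- layer.
    set s : ℝ := √2 * Real.exp (-((n : ℝ) + 1)) / ‖w‖ with hs
    have hw' : 0 < ‖w‖ := norm_pos_iff.2 hw0
    have hs0 : 0 < s := by positivity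
    have hn1 : ‖R (R.symm (s • w))‖ = √2 * Real.exp (-((n : ℝ) + 1)) := by
      rw [R.apply_symm_apply, norm_smul, Real.norm_of_nonneg hs0.le, hs,
        div_mul_cancel₀ _ hw'.ne']
    have hn2 : ‖R (R.symm (s • w))‖ / √2 = Real.exp (-((n : ℝ) + 1)) := by
      rw [hn1, mul_div_cancel_left₀ _ h2.ne']
    have hnN : (N : ℝ) < n := by exact_mod_cast hn
    obtain ⟨q, -, -, hq⟩ := h.exp (R.symm (s • w)) (by
      rw [hn1]
      have h3 : Real.exp (-((n : ℝ) + 1)) < Real.exp (-(N : ℝ)) := by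
        rw [Real.exp_lt_exp]; linarith
      nlinarith [Real.exp_pos (-((n : ℝ) + 1))])
    refine ⟨q, R.symm (s • w), ?_, (hq q).2 rfl⟩
    rw [mem_coneShell_iff h.block h.mem_stableSpace_iff h.mem_unstableSpace_iff
      (pullbackInner_apply R), hn2]
    refine ⟨?_, le_rfl, ?_⟩
    · rw [R.apply_symm_apply]
      simp only [quad, map_smul, real_inner_smul_left, real_inner_smul_right] at hw ⊢
      rw [hw]
      ring
    · rw [Real.exp_lt_exp]; linarith
  · rw [hlay n hn]
    obtain ⟨K, hK, hU⟩ := hc.isSigmaCompact_layer n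
    rw [← hU]
    exact MeasurableSet.iUnion fun i => (hK i).measurableSet
  · rw [hlay i hi, hlay j hj, Set.disjoint_left]
    exact fun x hx hx' => hij (IsSaddleChart.layer_index_unique hx hx')
  · rw [hcs]
    ext x
    simp only [mem_iUnion, Set.mem_sdiff, mem_singleton_iff]
    constructor
    · rintro ⟨n, hn, hx⟩
      rw [hlay n hn] at hx
      exact ⟨IsSaddleChart.layer_subset_section ζ J k hn hx, hc.ne_of_mem_layer hx⟩
    · rintro ⟨hx, hxp⟩
      obtain ⟨n, hn, hxn⟩ := hc.exists_mem_layer hx hxp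
      exact ⟨n, hn, by rw [hlay n hn]; exact hxn⟩
  · rw [hlay n hn] at hx
    obtain ⟨h3, h4⟩ := hc.norm_bounds hx
    have h5 := h.norm_Z_le (hb x hx.1)
    have h6 := h.le_norm_Z (hb x hx.1)
    have h7 := h.norm_field_le x hx.1
    have h8 := h.le_norm_field x hx.1
    have hl := h.lam_pos
    have hL := h.one_le
    constructor
    · rw [div_mul_eq_mul_div, div_le_iff₀ (by positivity)]
      nlinarith
    · have h9 : 2 * Λ * ‖ζ x‖ ≤ 2 * Λ * (1.5 * Real.exp (-(n : ℝ))) := by gcongr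
      have h10 : c * ‖Z (ζ x)‖ ≤ c * (2 * Λ * (1.5 * Real.exp (-(n : ℝ)))) := by
        gcongr; exact h5.trans h9
      linarith

/-- The number 1/(4Λ) has two roles: lower bound for the exit and entry times per unit of n, and
height per unit of n of the towers that bound the entropy. -/
theorem coarsePartitionProps [FiniteDimensional ℝ E] [FiniteDimensional ℝ F] [MeasurableSpace M]
    [BorelSpace M] (h : IsSaddleModel Y p ζ R J A B Z k lam Λ ε ρ m r₀ c) (hr : 0 < r)
    (hr₀ : r ≤ r₀) (hN : 2 * m * Real.exp (-((N : ℝ) / 2)) ≤ r) (hΛ : 8 * Λ ≤ N)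
    (hNρ : 3 * Real.exp (-(N : ℝ)) ≤ ρ) {φ : Flow ℝ M} (hφ : IsFlowOf φ Y) {κ : ℝ}
    (hκ : Real.exp (2 * Λ + 1) ≤ κ) (hκ' : 2 * m * Real.exp (2 * Λ) ≤ κ) :
    CoarsePartitionProps Y φ p (pullbackInner R) r N κ (1 / (4 * Λ)) (4 / lam)
      (2 / (1 / (4 * Λ)) + 3) := by
  have : CompleteSpace E := FiniteDimensional.complete ℝ E
  have : CompleteSpace F := FiniteDimensional.complete ℝ F
  have hb := h.isSaddleBall hr hr₀ hN hΛ hφ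
  have hcross := h.crossSectionProps hr hr₀ hN hΛ hNρ
  have hlay : ∀ n, N < n → layer Y p (pullbackInner R) n = coordLayer ζ J k n :=
    fun n hn => h.layer_eq hNρ hn.le
  have hcs := h.crossSection_eq hNρ
  have hΛ0 : 0 < Λ := by linarith [h.one_le]
  have htile : ∀ n, N < n → flowLayer Y φ p (pullbackInner R) n = tile φ (coordLayer ζ J k) n := by
    intro n hn
    unfold flowLayer tile
    rw [hlay n hn]
  have hpart : coarsePartition Y φ p (pullbackInner R) N =
      tilePartition φ (coordLayer ζ J k) N := by
    have h1 : (⋃ n, ⋃ (_ : N < n), flowLayer Y φ p (pullbackInner R) n) =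
        ⋃ n, ⋃ (_ : N < n), tile φ (coordLayer ζ J k) n :=
      iUnion_congr fun n => iUnion_congr fun hn => htile n hn
    unfold coarsePartition tilePartition
    rw [h1]
    congr 1
    ext C
    exact exists_congr fun n => and_congr_right fun hn => by rw [htile n hn]
  have htube : orbitTube Y φ p (pullbackInner R) N r = IsSaddleBall.coordTube ζ J k φ p r N := by
    unfold orbitTube IsSaddleBall.coordTube
    ext y
    exact exists_congr fun n => and_congr_right fun hn => by rw [hlay n hn]
  have hc0 : 0 < 1 / (4 * Λ) := by positivity
  have hmt : ∀ n, N < n → MeasurableSet (tile φ (coordLayer ζ J k) n) := fun n _ =>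
    measurableSet_tile φ (hb.toIsSaddleChart.isSigmaCompact_layer n)
  refine ⟨fun x hx a b hab s hs t ht => ?_, fun n hn x hx => ?_, ?_, ?_, ?_, ?_, ?_,
    fun n hn y hy => ?_, fun μ hμ hinv => ?_⟩
  · rw [hcs] at hs ht
    exact hb.once hx hab hs.1 ht.1 hs.2 ht.2
  · rw [hlay n hn] at hx
    have hn0 : (0 : ℝ) < n := by exact_mod_cast (Nat.zero_le N).trans_lt hn
    have key : ∀ τ : ℝ, (n : ℝ) / (4 * Λ) ≤ τ → τ ≤ 4 / lam * n →
        τ / n ∈ Icc (1 / (4 * Λ)) (4 / lam) := by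
      intro τ h1 h2
      constructor
      · rw [le_div_iff₀ hn0]
        calc 1 / (4 * Λ) * n = n / (4 * Λ) := by ring
          _ ≤ τ := h1
      · rwa [div_le_iff₀ hn0]
    have hx' : x ∈ coordLayer ζ (-J) k n := by
      rw [coordLayer, coordShell_neg]; exact hx
    have h1 := hb.exitTime_layer hn hx
    have h2 := hb.reverse.exitTime_layer hn hx'
    exact ⟨key _ h1.1 h1.2.1, key _ h2.1 h2.2.1⟩
  · rw [htube]; exact hb.tube_subset
  · rw [htube]
    refine hb.ball_subset ?_
    have h1 := hb.toIsSaddleChart.exp_le_r (le_refl N)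
    have h2 := h.le_m
    nlinarith [Real.exp_pos (-(N : ℝ))]
  · rw [hpart]
    refine hb.isTower.isPartition hb.two_le hc0 (fun n hn => ?_) (fun n _ => hb.notMem_tile n)
    rw [← hlay n hn]
    exact hcross.layer_nonempty n hn
  · rw [hpart]; exact countable_tilePartition _ _ _
  · rw [hpart]; exact measurableSet_tilePartition hmt
  · rw [htile n hn] at hy
    exact hb.dist_tile hn hy hκ hκ'
  · rw [hpart]
    exact hb.isTower.entropy_lt hb.two_le hc0 hmt μ hinv

end IsSaddleModel

end Model

end SingularFlow

namespace SingularFlow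

/-! ### Construction of a saddle model from uniform estimates in one chart. -/

section ExistsModel

variable {E : Type*} [NormedAddCommGroup E] [NormedSpace ℝ E]
  {M : Type*} [MetricSpace M] [ChartedSpace E M] [IsManifold 𝓘(ℝ, E) ∞ M]
  {F : Type*} [NormedAddCommGroup F] [InnerProductSpace ℝ F]

/-- The chart at `σ`, recentred at `z` and followed by a linear isomorphism. -/
noncomputable def recentredChart (σ : M) (z : E) (L : E ≃L[ℝ] F) (ρ : ℝ)
    (h : ∀ f ∈ Metric.ball (0 : F) ρ, z + L.symm f ∈ (extChartAt 𝓘(ℝ, E) σ).target) :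
    OpenPartialHomeomorph M F where
  toFun x := L (extChartAt 𝓘(ℝ, E) σ x - z)
  invFun f := (extChartAt 𝓘(ℝ, E) σ).symm (z + L.symm f)
  source := (extChartAt 𝓘(ℝ, E) σ).source ∩
    extChartAt 𝓘(ℝ, E) σ ⁻¹' {y | L (y - z) ∈ Metric.ball (0 : F) ρ}
  target := Metric.ball 0 ρ
  map_source' x hx := hx.2
  map_target' f hf := by
    refine ⟨(extChartAt 𝓘(ℝ, E) σ).map_target (h f hf), ?_⟩
    rw [mem_preimage, (extChartAt 𝓘(ℝ, E) σ).right_inv (h f hf), Set.mem_ofPred_eq,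
      add_sub_cancel_left, L.apply_symm_apply]
    exact hf
  left_inv' x hx := by
    rw [L.symm_apply_apply, add_sub_cancel, (extChartAt 𝓘(ℝ, E) σ).left_inv hx.1]
  right_inv' f hf := by
    rw [(extChartAt 𝓘(ℝ, E) σ).right_inv (h f hf), add_sub_cancel_left, L.apply_symm_apply]
  open_source := by
    refine (continuousOn_extChartAt (I := 𝓘(ℝ, E)) σ).isOpen_inter_preimage
      (isOpen_extChartAt_source σ) ?_
    exact Metric.isOpen_ball.preimage (L.continuous.comp (continuous_sub_right z))
  open_target := Metric.isOpen_ball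
  continuousOn_toFun := by
    refine L.continuous.comp_continuousOn (ContinuousOn.sub ?_ continuousOn_const)
    exact (continuousOn_extChartAt (I := 𝓘(ℝ, E)) σ).mono inter_subset_left
  continuousOn_invFun := by
    refine (continuousOn_extChartAt_symm (I := 𝓘(ℝ, E)) σ).comp
      (Continuous.continuousOn (by fun_prop)) h

variable [RiemannianBundle (fun x : M => TangentSpace 𝓘(ℝ, E) x)]

/-- The coordinates are the chart at σ, recentred at the singularity and followed by `L`. Tangent
vectors at p are given in the chart at p, so the isomorphism to `F` is `L` composed with the
derivative of the transition to the chart at σ. The map `k` inverts the exponential read in these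
coordinates. The hypotheses isolate constants that can be chosen independently of Y. -/
theorem exists_saddleModel [CompleteSpace F] {σ p : M} {Y : C1VectorField E M} {A : E →L[ℝ] E}
    {L : E ≃L[ℝ] F} {J A₀ : F →L[ℝ] F} {lam Λ ε ρ m r₀ a C s t e κ η η' : ℝ} {X : E → E}
    (form : SaddleForm J A₀ lam) (lam_pos : 0 < lam) (lam_le : lam ≤ 1) (hΛ : 1 ≤ Λ)
    (hA₀ : ‖A₀‖ ≤ Λ) (eps_pos : 0 < ε) (eps_small : 100 * ε * Λ ≤ lam) (rho_pos : 0 < ρ)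
    (rho_le : ρ ≤ 1 / 2) (stable : ∃ w, w ≠ 0 ∧ J w = -w) (unstable : ∃ w, w ≠ 0 ∧ J w = w)
    (hL : ∀ v, ‖L v‖ ≤ s * ‖v‖) (hL' : ∀ f, ‖L.symm f‖ ≤ t * ‖f‖) (hs : 0 < s) (ht : 0 < t)
    (hC : 0 < C) (hsC : 10 * s * C ≤ 1) (hm : 10 ≤ m) (hm' : C * t ≤ m)
    (hat : Metric.closedBall (extChartAt 𝓘(ℝ, E) σ σ) a ⊆ (extChartAt 𝓘(ℝ, E) σ).target)
    (hdist : ∀ x ∈ (extChartAt 𝓘(ℝ, E) σ).source, ∀ y ∈ (extChartAt 𝓘(ℝ, E) σ).source,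
      extChartAt 𝓘(ℝ, E) σ x ∈ Metric.closedBall (extChartAt 𝓘(ℝ, E) σ σ) a →
      extChartAt 𝓘(ℝ, E) σ y ∈ Metric.closedBall (extChartAt 𝓘(ℝ, E) σ σ) a →
        dist x y ≤ C * ‖extChartAt 𝓘(ℝ, E) σ x - extChartAt 𝓘(ℝ, E) σ y‖ ∧
        ‖extChartAt 𝓘(ℝ, E) σ x - extChartAt 𝓘(ℝ, E) σ y‖ ≤ C * dist x y)
    (hnorm : ∀ x ∈ (extChartAt 𝓘(ℝ, E) σ).source,
      extChartAt 𝓘(ℝ, E) σ x ∈ Metric.closedBall (extChartAt 𝓘(ℝ, E) σ σ) a →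
        ∀ w : TangentSpace 𝓘(ℝ, E) x,
          ‖w‖ ≤ C * ‖tangentCoordChange 𝓘(ℝ, E) x σ x w‖ ∧
          ‖tangentCoordChange 𝓘(ℝ, E) x σ x w‖ ≤ C * ‖w‖)
    (hp : p ∈ (extChartAt 𝓘(ℝ, E) σ).source)
    (hpa : ‖extChartAt 𝓘(ℝ, E) σ p - extChartAt 𝓘(ℝ, E) σ σ‖ ≤ a / 2) (zero : Y p = 0)
    (hlip : ∀ x ∈ Metric.closedBall (extChartAt 𝓘(ℝ, E) σ σ) a,
      ∀ y ∈ Metric.closedBall (extChartAt 𝓘(ℝ, E) σ σ) a,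
        ‖localRep Y σ x - localRep Y σ y - A (x - y)‖ ≤ e * ‖x - y‖)
    (hLA : ∀ f, ‖L (A (L.symm f)) - A₀ f‖ ≤ ε / 2 * ‖f‖) (he : s * t * e ≤ ε / 2)
    (block : SaddleForm J ((L : E →L[ℝ] F) ∘L
      fderiv ℝ (localRep Y σ) (extChartAt 𝓘(ℝ, E) σ p) ∘L (L.symm : F →L[ℝ] E)) (lam / 2))
    (hX0 : X 0 = extChartAt 𝓘(ℝ, E) σ p)
    (hX : ∀ w w', ‖w‖ ≤ η → ‖w'‖ ≤ η → ‖X w - X w' - (w - w')‖ ≤ κ * ‖w - w'‖)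
    (hXexp : ∀ v, ‖tangentCoordChange 𝓘(ℝ, E) p σ p v‖ ≤ η → ∀ q, IsExp p v q ↔
      q = (extChartAt 𝓘(ℝ, E) σ).symm (X (tangentCoordChange 𝓘(ℝ, E) p σ p v)))
    (hκ : s * t * κ ≤ ε / 2) (hη : t * η' ≤ η) (hρη : 2 * ρ ≤ η') (hρa : 2 * t * ρ ≤ a)
    (hr₀ : Metric.closedBall p r₀ ⊆ {x | x ∈ (extChartAt 𝓘(ℝ, E) σ).source ∧
      extChartAt 𝓘(ℝ, E) σ x ∈ Metric.closedBall (extChartAt 𝓘(ℝ, E) σ σ) a})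
    (hr₀ρ : r₀ < 10 * ρ) :
    ∃ (ζ : OpenPartialHomeomorph M F) (R : E ≃L[ℝ] F) (B : F →L[ℝ] F) (Z k : F → F),
      IsSaddleModel Y p ζ R J A₀ B Z k lam Λ ε ρ m r₀ m := by
  set χ := extChartAt 𝓘(ℝ, E) σ with hχ
  set z := χ p with hz
  have heps1 : ε ≤ 1 / 2 := by nlinarith
  have hzρ : ∀ f : F, ‖f‖ ≤ ρ → z + L.symm f ∈ Metric.closedBall (χ σ) a := by
    intro f hf
    rw [mem_closedBall_iff_norm]
    have h1 : z + L.symm f - χ σ = (z - χ σ) + L.symm f := by abel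
    have h2 : t * ‖f‖ ≤ t * ρ := by gcongr
    rw [h1]
    linarith [norm_add_le (z - χ σ) (L.symm f), hL' f]
  have htgt : ∀ f ∈ Metric.ball (0 : F) ρ, z + L.symm f ∈ χ.target := fun f hf =>
    hat (hzρ f (by rw [mem_ball_zero_iff] at hf; exact hf.le))
  set ζ := recentredChart σ z L ρ htgt with hζ
  have hζa : ∀ x, ζ x = L (χ x - z) := fun x => rfl
  have hζs : ∀ x, x ∈ ζ.source ↔ x ∈ χ.source ∧ ‖L (χ x - z)‖ < ρ := fun x => by
    rw [← mem_ball_zero_iff]; rfl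
  have hback : ∀ x, χ x = z + L.symm (ζ x) := fun x => by
    rw [hζa, L.symm_apply_apply, add_sub_cancel]
  have hball : ∀ x ∈ ζ.source, χ x ∈ Metric.closedBall (χ σ) a := fun x hx => by
    rw [hback x]; exact hzρ _ ((hζs x).1 hx).2.le
  have hpball : z ∈ Metric.closedBall (χ σ) a := by
    have := hzρ 0 (by rw [norm_zero]; exact rho_pos.le)
    rwa [map_zero, add_zero] at this
  -- the field
  set Z : F → F := fun f => L (localRep Y σ (z + L.symm f)) with hZ
  have hZ0 : Z 0 = 0 := by
    have h1 : localRep Y σ z = 0 := (localRep_eq_zero_iff Y hp).2 zero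
    simp only [hZ, map_zero, add_zero, h1]
  have hZlip : ∀ f ∈ Metric.ball (0 : F) ρ, ∀ g ∈ Metric.ball (0 : F) ρ,
      ‖Z f - Z g - A₀ (f - g)‖ ≤ ε * ‖f - g‖ := by
    intro f hf g hg
    rw [mem_ball_zero_iff] at hf hg
    have h1 := hlip _ (hzρ f hf.le) _ (hzρ g hg.le)
    rw [add_sub_add_left_eq_sub, ← map_sub] at h1
    have h2 : Z f - Z g - A₀ (f - g) = L (localRep Y σ (z + L.symm f) -
        localRep Y σ (z + L.symm g) - A (L.symm (f - g))) +
        (L (A (L.symm (f - g))) - A₀ (f - g)) := by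
      simp only [hZ, map_sub]; abel
    have h3 := hL (localRep Y σ (z + L.symm f) - localRep Y σ (z + L.symm g) -
      A (L.symm (f - g)))
    have he0 : s * (e * ‖L.symm (f - g)‖) ≤ ε / 2 * ‖f - g‖ := by
      by_cases he' : 0 ≤ e
      · calc s * (e * ‖L.symm (f - g)‖) ≤ s * (e * (t * ‖f - g‖)) := by
              gcongr; exact hL' _
          _ = s * t * e * ‖f - g‖ := by ring
          _ ≤ _ := by gcongr
      · have : e * ‖L.symm (f - g)‖ ≤ 0 :=
          mul_nonpos_of_nonpos_of_nonneg (not_le.1 he').le (norm_nonneg _)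
        have h5 : s * (e * ‖L.symm (f - g)‖) ≤ 0 := mul_nonpos_of_nonneg_of_nonpos hs.le this
        have : 0 ≤ ε / 2 * ‖f - g‖ := by positivity
        linarith
    rw [h2]
    calc _ ≤ s * (e * ‖L.symm (f - g)‖) + ε / 2 * ‖f - g‖ :=
          (norm_add_le _ _).trans (add_le_add (h3.trans (by gcongr)) (hLA _))
      _ ≤ ε * ‖f - g‖ := by linarith
  -- the exponential map
  set G : F → F := fun f => L (X (L.symm f) - z) with hG
  have hG0 : G 0 = 0 := by simp only [hG, map_zero, hX0, sub_self]
  have hη' : ∀ f : F, ‖f‖ ≤ η' → ‖L.symm f‖ ≤ η := fun f hf =>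
    ((hL' f).trans (by gcongr)).trans hη
  have hGlip : ∀ f g, ‖f‖ ≤ η' → ‖g‖ ≤ η' → ‖G f - G g - (f - g)‖ ≤ ε / 2 * ‖f - g‖ := by
    intro f g hf hg
    have h1 := hX _ _ (hη' f hf) (hη' g hg)
    rw [← map_sub] at h1
    have h2 : G f - G g - (f - g) =
        L (X (L.symm f) - X (L.symm g) - L.symm (f - g)) := by
      rw [map_sub, map_sub, L.apply_symm_apply]
      simp only [hG, map_sub]; abel
    rw [h2]
    by_cases hκ0 : 0 ≤ κ
    · calc _ ≤ s * (κ * (t * ‖f - g‖)) := (hL _).trans (by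
            gcongr; exact h1.trans (by gcongr; exact hL' _))
        _ = s * t * κ * ‖f - g‖ := by ring
        _ ≤ _ := by gcongr
    · have h3 : κ * ‖L.symm (f - g)‖ ≤ 0 :=
        mul_nonpos_of_nonpos_of_nonneg (not_le.1 hκ0).le (norm_nonneg _)
      have h4 : X (L.symm f) - X (L.symm g) - L.symm (f - g) = 0 :=
        norm_le_zero_iff.1 (h1.trans h3)
      rw [h4, map_zero, norm_zero]
      positivity
  -- The inverse of an ε/2-close map is ε-close on the ball of half the radius, which contains the
  -- ball of radius ρ because 2ρ ≤ η'.
  obtain ⟨k, hk0, -, hklip, hkG⟩ := exists_local_inverse (r := η') (c := ε / 2) (by linarith)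
    (by positivity) (by linarith) hG0 hGlip
  have hpp := mem_extChartAt_source (I := 𝓘(ℝ, E)) p
  set τ := transitionEquiv hpp hp with hτ
  refine ⟨ζ, τ.trans L, (L : E →L[ℝ] F) ∘L fderiv ℝ (localRep Y σ) z ∘L (L.symm : F →L[ℝ] E), Z, k,
    ⟨form, lam_pos, lam_le, hΛ, hA₀, eps_pos.le, eps_small, rho_pos, hZ0, hk0, hZlip, ?_⟩,
    rho_le, rfl, ?_, ?_, hm, ?_, ?_, stable, unstable, ?_, zero, block, ?_, ?_, ?_, by linarith,
    ?_, ?_⟩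
  · intro x hx y hy
    rw [mem_ball_zero_iff] at hx hy
    have := hklip x y (by linarith) (by linarith)
    linarith
  · rw [hζs, ← hz, sub_self, map_zero, norm_zero]
    exact ⟨hp, rho_pos⟩
  · rw [hζa, ← hz, sub_self, map_zero]
  · intro x hx
    have h1 := (hdist x ((hζs x).1 hx).1 p hp (hball x hx) hpball).2
    have h2 := hL (χ x - z)
    rw [hζa]
    calc 10 * ‖L (χ x - z)‖ ≤ 10 * (s * (C * dist x p)) := by
          gcongr; exact h2.trans (by gcongr)
      _ = (10 * s * C) * dist x p := by ring
      _ ≤ 1 * dist x p := by gcongr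
      _ = _ := one_mul _
  · intro x hx
    have h1 := (hdist x ((hζs x).1 hx).1 p hp (hball x hx) hpball).1
    have h2 : χ x - χ p = L.symm (ζ x) := by rw [hback x]; simp [hz]
    rw [h2] at h1
    calc dist x p ≤ C * (t * ‖ζ x‖) := h1.trans (by gcongr; exact hL' _)
      _ = C * t * ‖ζ x‖ := by ring
      _ ≤ _ := by gcongr
  · intro x hx
    obtain ⟨h1, h2⟩ := hr₀ hx
    rw [hζs]
    refine ⟨h1, ?_⟩
    have h3 := (hdist x h1 p hp h2 hpball).2
    have h4 := hL (χ x - z)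
    rw [Metric.mem_closedBall] at hx
    have h5 : s * ‖χ x - z‖ ≤ s * (C * dist x p) := by gcongr
    have h6 : s * C * dist x p ≤ 1 / 10 * dist x p := by
      gcongr; linarith
    linarith
  · rw [SingularFlow.linearization_eq Y hp zero]
    ext v
    simp only [ContinuousLinearMap.comp_apply, ContinuousLinearEquiv.coe_coe,
      ContinuousLinearEquiv.trans_apply, ContinuousLinearEquiv.symm_trans_apply,
      ContinuousLinearEquiv.symm_apply_apply]
    rfl
  · intro v hv
    have hτv : τ v = tangentCoordChange 𝓘(ℝ, E) p σ p v := rfl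
    set f := (τ.trans L) v with hf
    have hfv : L.symm f = tangentCoordChange 𝓘(ℝ, E) p σ p v := by
      rw [hf, ContinuousLinearEquiv.trans_apply, L.symm_apply_apply, hτv]
    have hfη : ‖f‖ ≤ η' := by linarith [norm_nonneg f]
    have hGf : ‖G f‖ < ρ := by
      have h1 := hGlip f 0 hfη (by rw [norm_zero]; linarith)
      rw [hG0, sub_zero, sub_zero] at h1
      have h2 : ‖G f‖ ≤ ‖G f - f‖ + ‖f‖ := by simpa using norm_add_le (G f - f) f
      nlinarith [norm_nonneg f]
    have hXt : X (L.symm f) = z + L.symm (G f) := by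
      simp only [hG, L.symm_apply_apply, add_sub_cancel]
    have hmem : X (L.symm f) ∈ χ.target := by
      rw [hXt]; exact htgt _ (by rwa [mem_ball_zero_iff])
    have hζq : L (χ (χ.symm (X (L.symm f))) - z) = G f := by
      rw [χ.right_inv hmem]
    refine ⟨χ.symm (X (L.symm f)), ?_, ?_, ?_⟩
    · rw [hζs, hζq]
      exact ⟨χ.map_target hmem, hGf⟩
    · rw [hζa, hζq]
      exact hkG f hfη (by linarith)
    · intro q'
      rw [hfv]
      exact hXexp v (by rw [← hfv]; exact hη' f hfη) q'
  · intro x hx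
    have hxσ := ((hζs x).1 hx).1
    have hxx := mem_extChartAt_source (I := 𝓘(ℝ, E)) x
    refine ⟨(L : E →L[ℝ] F) ∘L tangentCoordChange 𝓘(ℝ, E) x σ x, ?_, ?_⟩
    · exact (L : E →L[ℝ] F).hasFDerivAt.comp _ ((hasFDerivAt_transition hxx hxσ).sub_const z)
    · have h1 := localRep_apply Y hxσ
      simp only [hZ, ← hback x]
      rw [h1]
      rfl
  · intro x hx
    have hxσ := ((hζs x).1 hx).1
    have h1 := (hnorm x hxσ (hball x hx) (Y x)).1
    have h2 : tangentCoordChange 𝓘(ℝ, E) x σ x (Y x) = L.symm (Z (ζ x)) := by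
      simp only [hZ, ← hback x, L.symm_apply_apply]
      exact (localRep_apply Y hxσ).symm
    rw [h2] at h1
    calc ‖Y x‖ ≤ C * (t * ‖Z (ζ x)‖) := h1.trans (by gcongr; exact hL' _)
      _ = C * t * ‖Z (ζ x)‖ := by ring
      _ ≤ _ := by gcongr
  · intro x hx
    have hxσ := ((hζs x).1 hx).1
    have h1 := (hnorm x hxσ (hball x hx) (Y x)).2
    have h2 : Z (ζ x) = L (tangentCoordChange 𝓘(ℝ, E) x σ x (Y x)) := by
      simp only [hZ, ← hback x]
      rw [← localRep_apply Y hxσ]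
    rw [h2]
    have h3 := hL (tangentCoordChange 𝓘(ℝ, E) x σ x (Y x))
    have h4 : s * ‖tangentCoordChange 𝓘(ℝ, E) x σ x (Y x)‖ ≤ s * (C * ‖Y x‖) := by gcongr
    have h5 : s * C * ‖Y x‖ ≤ m * ‖Y x‖ := by
      gcongr
      nlinarith
    linarith

end ExistsModel

end SingularFlow

namespace SingularFlow

/-! ### Zeros of a map close to an invertible linear one. -/

section Zeros

variable {E : Type*} [NormedAddCommGroup E] [NormedSpace ℝ E]

theorem norm_sub_sub_le_of_fderiv {W : E → E} {A : E →L[ℝ] E} {z₀ : E} {a e : ℝ}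
    (hd : ∀ z ∈ Metric.closedBall z₀ a, DifferentiableAt ℝ W z)
    (hW : ∀ z ∈ Metric.closedBall z₀ a, ‖fderiv ℝ W z - A‖ ≤ e) {x y : E}
    (hx : x ∈ Metric.closedBall z₀ a) (hy : y ∈ Metric.closedBall z₀ a) :
    ‖W x - W y - A (x - y)‖ ≤ e * ‖x - y‖ :=
  (convex_closedBall z₀ a).norm_image_sub_le_of_norm_hasFDerivWithin_le'
    (fun z hz => (hd z hz).hasFDerivAt.hasFDerivWithinAt) hW hy hx

variable {W : E → E} {D : E ≃L[ℝ] E} {z₀ : E} {a b e μ : ℝ}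

theorem norm_sub_le_of_approx (hD : ∀ v, ‖D.symm v‖ ≤ μ * ‖v‖) (hμ : 0 ≤ μ) (he : e * μ ≤ 1 / 2)
    {x y : E} (h : ‖W x - W y - D (x - y)‖ ≤ e * ‖x - y‖) :
    ‖x - y‖ ≤ 2 * μ * ‖W x - W y‖ := by
  have h1 := hD (D (x - y))
  rw [D.symm_apply_apply] at h1
  have h2 : ‖D (x - y)‖ ≤ ‖W x - W y‖ + ‖W x - W y - D (x - y)‖ := by
    have := norm_sub_le (W x - W y) (W x - W y - D (x - y))
    rwa [sub_sub_cancel] at this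
  have h3 : μ * ‖D (x - y)‖ ≤ μ * (‖W x - W y‖ + e * ‖x - y‖) := by
    gcongr; exact h2.trans (by gcongr)
  have h4 : e * μ * ‖x - y‖ ≤ 1 / 2 * ‖x - y‖ := by gcongr
  linarith

/-- The map f ↦ D⁻¹(W(z₀ + f) - W(z₀)) is close to the identity, so it attains the small value
D⁻¹(-W(z₀)). -/
theorem exists_zero_of_approx [CompleteSpace E] (hD : ∀ v, ‖D.symm v‖ ≤ μ * ‖v‖) (hμ : 0 ≤ μ)
    (he0 : 0 ≤ e) (he : e * μ ≤ 1 / 2) (hb : 0 ≤ b) (hba : b ≤ a)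
    (h : ∀ x ∈ Metric.closedBall z₀ a, ∀ y ∈ Metric.closedBall z₀ a,
      ‖W x - W y - D (x - y)‖ ≤ e * ‖x - y‖) (h0 : μ * ‖W z₀‖ ≤ b / 2) :
    ∃ z ∈ Metric.closedBall z₀ b, W z = 0 := by
  have hmem : ∀ f : E, ‖f‖ ≤ b → z₀ + f ∈ Metric.closedBall z₀ a := fun f hf => by
    rw [mem_closedBall_iff_norm, add_sub_cancel_left]
    exact hf.trans hba
  obtain ⟨k, -, hk, -, -⟩ := exists_local_inverse
    (G := fun f => D.symm (W (z₀ + f) - W z₀)) (r := b) (c := e * μ) hb (by positivity) he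
    (by simp only [add_zero, sub_self, map_zero]) (fun f g hf hg => by
      have h1 := h _ (hmem f hf) _ (hmem g hg)
      rw [add_sub_add_left_eq_sub] at h1
      have h2 : D.symm (W (z₀ + f) - W z₀) - D.symm (W (z₀ + g) - W z₀) - (f - g) =
          D.symm (W (z₀ + f) - W (z₀ + g) - D (f - g)) := by
        simp only [map_sub, D.symm_apply_apply]
        abel
      rw [h2]
      calc _ ≤ μ * (e * ‖f - g‖) := (hD _).trans (by gcongr)
        _ = _ := by ring)
  obtain ⟨h1, h2⟩ := hk (D.symm (-W z₀)) ((hD _).trans (by rwa [norm_neg]))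
  refine ⟨z₀ + k (D.symm (-W z₀)), ?_, ?_⟩
  · rw [mem_closedBall_iff_norm, add_sub_cancel_left]
    exact h1
  · have h3 := D.symm.injective h2
    rwa [sub_eq_neg_self] at h3

end Zeros

/-! ### Block diagonal form for nearby linear maps, with uniform bounds. -/

section Perturbation

variable {F : Type*} [NormedAddCommGroup F] [InnerProductSpace ℝ F]

theorem SaddleForm.mono {J A : F →L[ℝ] F} {lam lam' : ℝ} (h : SaddleForm J A lam)
    (hl : lam' ≤ lam) : SaddleForm J A lam' where
  invol := h.invol
  symm := h.symm
  comm := h.comm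
  coercive v := (by gcongr : lam' * ‖v‖ ^ 2 ≤ lam * ‖v‖ ^ 2).trans (h.coercive v)

theorem SaddleForm.of_close {J A B : F →L[ℝ] F} {lam : ℝ} (h : SaddleForm J A lam)
    (hB : ‖B - A‖ ≤ lam / 2) (hJ : ∀ v, J (B v) = B (J v)) : SaddleForm J B (lam / 2) where
  invol := h.invol
  symm := h.symm
  comm := hJ
  coercive v := by
    have h1 := h.coercive v
    have h2 : |inner ℝ (J v) ((B - A) v)| ≤ ‖v‖ * (lam / 2 * ‖v‖) := by
      refine (abs_real_inner_le_norm _ _).trans ?_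
      rw [h.norm_map]
      gcongr
      exact (B - A).le_of_opNorm_le hB v
    rw [sub_apply, inner_sub_right] at h2
    have h3 := (abs_le.1 h2).1
    nlinarith

/-- Isomorphisms putting every linear map near `A` in block diagonal form. -/
theorem SaddleForm.exists_adapted_equiv {E : Type*} [NormedAddCommGroup E] [NormedSpace ℝ E]
    [FiniteDimensional ℝ F] {R : E ≃L[ℝ] F} {J : F →L[ℝ] F} {A : E →L[ℝ] E} {lam ε γ : ℝ}
    (h : SaddleForm J ((R : E →L[ℝ] F) ∘L A ∘L (R.symm : F →L[ℝ] E)) lam) (hlam : 0 < lam)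
    (hε : 0 < ε) (hε1 : ε ≤ 1) (hεl : ε ≤ lam) (hγ : 0 < γ) :
    ∃ δ > 0, ∀ B : E →L[ℝ] E, ‖B - A‖ ≤ δ → ∃ L : E ≃L[ℝ] F,
      (∀ v, ‖L v‖ ≤ 2 * (γ * (‖(R : E →L[ℝ] F)‖ + 1)) * ‖v‖) ∧
      (∀ f, ‖L.symm f‖ ≤ 2 * (γ⁻¹ * (‖(R.symm : F →L[ℝ] E)‖ + 1)) * ‖f‖) ∧
      (∀ f, ‖L (A (L.symm f)) - R (A (R.symm f))‖ ≤ ε / 2 * ‖f‖) ∧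
      SaddleForm J ((L : E →L[ℝ] F) ∘L B ∘L (L.symm : F →L[ℝ] E)) (lam / 2) := by
  set A₀ : F →L[ℝ] F := (R : E →L[ℝ] F) ∘L A ∘L (R.symm : F →L[ℝ] E) with hA₀
  have hA₀a : ∀ f, A₀ f = R (A (R.symm f)) := fun f => rfl
  set s₁ := ‖(R : E →L[ℝ] F)‖ + 1 with hs₁
  set t₁ := ‖(R.symm : F →L[ℝ] E)‖ + 1 with ht₁
  have hs₁0 : 0 < s₁ := by positivity
  have ht₁0 : 0 < t₁ := by positivity
  set s := 2 * (γ * s₁) with hs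
  set t := 2 * (γ⁻¹ * t₁) with ht
  have hs0 : 0 < s := by positivity
  have ht0 : 0 < t := by positivity
  have hcont : Continuous fun B : E →L[ℝ] E =>
      (R : E →L[ℝ] F) ∘L B ∘L (R.symm : F →L[ℝ] E) := by fun_prop
  have hev := (hcont.tendsto A).eventually
    (h.eventually_exists_blockDiagonal hlam (ε := ε / 4) (by positivity))
  obtain ⟨δ₁, hδ₁, hblock⟩ := Metric.eventually_nhds_iff.1 hev
  refine ⟨min (δ₁ / 2) (ε / (4 * s * t)), by positivity, fun B hBA => ?_⟩
  obtain ⟨P, hP1, hP2, hP3, hP4⟩ := hblock (y := B) (by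
    have := min_le_left (δ₁ / 2) (ε / (4 * s * t))
    rw [dist_eq_norm]; linarith)
  set e := min (δ₁ / 2) (ε / (4 * s * t)) with he
  have he0 : 0 < e := by positivity
  have hste : s * t * e ≤ ε / 4 := by
    have : e ≤ ε / (4 * s * t) := min_le_right _ _
    calc s * t * e ≤ s * t * (ε / (4 * s * t)) := by gcongr
      _ = ε / 4 := by field_simp
  -- The scalar γ cancels in conjugations; it only adjusts the size of `L`, as the comparison 10‖ζ
  -- x‖ ≤ dist x p requires.
  have hscale : ∃ L : E ≃L[ℝ] F, (∀ v, L v = γ • P.symm (R v)) ∧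
      ∀ f, L.symm f = γ⁻¹ • R.symm (P f) := by
    refine ⟨ContinuousLinearEquiv.equivOfInverse
      (γ • ((P.symm : F →L[ℝ] F) ∘L (R : E →L[ℝ] F)))
      (γ⁻¹ • ((R.symm : F →L[ℝ] E) ∘L (P : F →L[ℝ] F))) (fun v => ?_) (fun f => ?_),
      fun v => rfl, fun f => rfl⟩
    · simp [smul_smul, hγ.ne']
    · simp [smul_smul, hγ.ne']
  obtain ⟨L, hL, hL'⟩ := hscale
  have hPn : ∀ f, ‖P f‖ ≤ 2 * ‖f‖ := fun f => by
    have h1 := ((P : F →L[ℝ] F) - 1).le_of_opNorm_le hP1.le f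
    have h2 : P f = ((P : F →L[ℝ] F) - 1) f + f := by simp
    rw [h2]
    refine (norm_add_le _ _).trans ?_
    nlinarith [norm_nonneg f]
  have hPn' : ∀ f, ‖P.symm f‖ ≤ 2 * ‖f‖ := fun f => by
    have h1 := ((P.symm : F →L[ℝ] F) - 1).le_of_opNorm_le hP2.le f
    have h2 : P.symm f = ((P.symm : F →L[ℝ] F) - 1) f + f := by simp
    rw [h2]
    refine (norm_add_le _ _).trans ?_
    nlinarith [norm_nonneg f]
  have hLn : ∀ v, ‖L v‖ ≤ s * ‖v‖ := fun v => by
    have h1 : ‖R v‖ ≤ s₁ * ‖v‖ := (R : E →L[ℝ] F).le_of_opNorm_le (by linarith) v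
    rw [hL, norm_smul, Real.norm_of_nonneg hγ.le]
    calc γ * ‖P.symm (R v)‖ ≤ γ * (2 * (s₁ * ‖v‖)) := by
          gcongr; exact (hPn' _).trans (by gcongr)
      _ = s * ‖v‖ := by rw [hs]; ring
  have hLn' : ∀ f, ‖L.symm f‖ ≤ t * ‖f‖ := fun f => by
    have h1 : ‖R.symm (P f)‖ ≤ t₁ * ‖P f‖ :=
      (R.symm : F →L[ℝ] E).le_of_opNorm_le (by linarith) _
    rw [hL', norm_smul, Real.norm_of_nonneg (by positivity)]
    calc γ⁻¹ * ‖R.symm (P f)‖ ≤ γ⁻¹ * (t₁ * (2 * ‖f‖)) := by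
          gcongr; exact h1.trans (by gcongr; exact hPn f)
      _ = t * ‖f‖ := by rw [ht]; ring
  have hconj : (L : E →L[ℝ] F) ∘L B ∘L (L.symm : F →L[ℝ] E) =
      (P.symm : F →L[ℝ] F) ∘L ((R : E →L[ℝ] F) ∘L B ∘L (R.symm : F →L[ℝ] E)) ∘L
        (P : F →L[ℝ] F) := by
    ext1 f
    simp only [ContinuousLinearMap.comp_apply, ContinuousLinearEquiv.coe_coe, hL, hL', map_smul,
      smul_smul, inv_mul_cancel₀ hγ.ne', one_smul]
  have hLB : ‖(L : E →L[ℝ] F) ∘L B ∘L (L.symm : F →L[ℝ] E) - A₀‖ ≤ ε / 4 := by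
    rw [hconj]; exact hP3.le
  have hblk : SaddleForm J ((L : E →L[ℝ] F) ∘L B ∘L (L.symm : F →L[ℝ] E)) (lam / 2) := by
    refine h.of_close (by linarith) fun v => ?_
    rw [hconj]
    exact hP4 v
  -- The conjugation is adapted to B, while the field will be compared with A; exchanging them costs
  -- s t ‖B - A‖ ≤ ε/4.
  have hLA : ∀ f, ‖L (A (L.symm f)) - A₀ f‖ ≤ ε / 2 * ‖f‖ := fun f => by
    have h1 := ((L : E →L[ℝ] F) ∘L B ∘L (L.symm : F →L[ℝ] E) - A₀).le_of_opNorm_le hLB f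
    have h2 : L (A (L.symm f)) - A₀ f =
        ((L : E →L[ℝ] F) ∘L B ∘L (L.symm : F →L[ℝ] E) - A₀) f - L ((B - A) (L.symm f)) := by
      simp only [sub_apply, ContinuousLinearMap.comp_apply, ContinuousLinearEquiv.coe_coe,
        map_sub]
      abel
    have h3 : ‖L ((B - A) (L.symm f))‖ ≤ s * (e * (t * ‖f‖)) := by
      refine (hLn _).trans ?_
      gcongr
      exact ((B - A).le_of_opNorm_le hBA _).trans (by gcongr; exact hLn' f)
    have h4 : s * (e * (t * ‖f‖)) ≤ ε / 4 * ‖f‖ := by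
      calc s * (e * (t * ‖f‖)) = s * t * e * ‖f‖ := by ring
        _ ≤ _ := by gcongr
    rw [h2]
    refine (norm_sub_le _ _).trans ?_
    linarith
  exact ⟨L, hLn, hLn', hLA, hblk⟩

end Perturbation

/-! ### Saddle models for all fields near X. -/

section Uniform

variable {E : Type*} [NormedAddCommGroup E] [NormedSpace ℝ E] [FiniteDimensional ℝ E]
  {M : Type*} [MetricSpace M] [ChartedSpace E M] [IsManifold 𝓘(ℝ, E) ∞ M]
  [RiemannianBundle (fun x : M => TangentSpace 𝓘(ℝ, E) x)]
  [IsContMDiffRiemannianBundle 𝓘(ℝ, E) ∞ E (fun x : M => TangentSpace 𝓘(ℝ, E) x)]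
  [IsRiemannianManifold 𝓘(ℝ, E) M]

omit [FiniteDimensional ℝ E] in
/-- Comparison of the metric with the chart. -/
theorem exists_metric_chart (σ : M) :
    ∃ C > 0, ∃ N ∈ 𝓝 σ, N ⊆ (extChartAt 𝓘(ℝ, E) σ).source ∧
      (∀ x ∈ N, ∀ y ∈ N,
        dist x y ≤ C * ‖extChartAt 𝓘(ℝ, E) σ x - extChartAt 𝓘(ℝ, E) σ y‖ ∧
        ‖extChartAt 𝓘(ℝ, E) σ x - extChartAt 𝓘(ℝ, E) σ y‖ ≤ C * dist x y) ∧
      ∀ x ∈ N, ∀ w : TangentSpace 𝓘(ℝ, E) x,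
        ‖w‖ ≤ C * ‖tangentCoordChange 𝓘(ℝ, E) x σ x w‖ ∧
        ‖tangentCoordChange 𝓘(ℝ, E) x σ x w‖ ≤ C * ‖w‖ := by
  obtain ⟨C₁, hC₁, δ, hδ, hs, h₁⟩ := exists_dist_comparison (E := E) σ
  obtain ⟨C₂, hC₂, h₂⟩ := exists_norm_comparison (E := E) σ
  refine ⟨max C₁ C₂, by positivity, _, inter_mem (Metric.ball_mem_nhds σ hδ) h₂,
    inter_subset_left.trans hs, fun x hx y hy => ?_, fun x hx w => ?_⟩
  · obtain ⟨h3, h4⟩ := h₁ x hx.1 y hy.1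
    exact ⟨h3.trans (by gcongr; exact le_max_left _ _), h4.trans (by gcongr; exact le_max_left _ _)⟩
  · obtain ⟨h3, h4⟩ := hx.2 w
    exact ⟨h3.trans (by gcongr; exact le_max_right _ _),
      h4.trans (by gcongr; exact le_max_right _ _)⟩

set_option maxHeartbeats 1000000 in
/-- The saddle models of the fields near `X`. -/
theorem exists_uniform_saddleModel {F : Type*} [NormedAddCommGroup F] [InnerProductSpace ℝ F]
    [FiniteDimensional ℝ F] (X : C1VectorField E M) (σ : M) (hσ : X σ = 0) {R₁ : E ≃L[ℝ] F}
    {J : F →L[ℝ] F} {lam₁ : ℝ} (hlam₁ : 0 < lam₁)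
    (hform₁ : SaddleForm J
      ((R₁ : E →L[ℝ] F) ∘L linearization X σ ∘L (R₁.symm : F →L[ℝ] E)) lam₁)
    (hst : ∃ w, w ≠ 0 ∧ J w = -w) (hun : ∃ w, w ≠ 0 ∧ J w = w) :
    ∃ (r₀ lam Λ ε ρ m : ℝ) (A₀ : F →L[ℝ] F), 0 < r₀ ∧
      ∃ U ∈ 𝓝 X, ∃ V ∈ 𝓝 σ, ∃ c : C1VectorField E M → M, c X = σ ∧ ContinuousOn c U ∧
        ∀ Y ∈ U, Metric.closedBall (c Y) r₀ ⊆ V ∧ (∀ q ∈ V, Y q = 0 ↔ q = c Y) ∧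
          ∃ ζ R B Z k, IsSaddleModel Y (c Y) ζ R J A₀ B Z k lam Λ ε ρ m r₀ m := by
  have : CompleteSpace E := FiniteDimensional.complete ℝ E
  have : ProperSpace E := FiniteDimensional.proper ℝ E
  have : CompleteSpace F := FiniteDimensional.complete ℝ F
  set χ := extChartAt 𝓘(ℝ, E) σ with hχ
  set A := linearization X σ with hA
  have hA' : fderiv ℝ (localRep X σ) (χ σ) = A := rfl
  obtain ⟨C, hC, N, hN, hNs, hdist, hnorm⟩ := exists_metric_chart (E := E) σ
  obtain ⟨ρe, hρe, K, hK, η₀, hη₀, -, hexp⟩ := exists_exp_chart (E := E) σ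
  set A₀ : F →L[ℝ] F := (R₁ : E →L[ℝ] F) ∘L A ∘L (R₁.symm : F →L[ℝ] E) with hA₀
  have hA₀a : ∀ f, A₀ f = R₁ (A (R₁.symm f)) := fun f => rfl
  set lam := min lam₁ 1 with hlam
  have hlam0 : 0 < lam := by positivity
  have hform : SaddleForm J A₀ lam := hform₁.mono (min_le_left _ _)
  set Λ := ‖A₀‖ + 1 with hΛ
  have hΛ1 : 1 ≤ Λ := by linarith [norm_nonneg A₀]
  set ε := lam / (100 * Λ) with hε
  have hε0 : 0 < ε := by positivity
  have hεΛ : 100 * ε * Λ = lam := by rw [hε]; field_simp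
  have hε1 : ε ≤ 1 / 100 := by
    have := min_le_right lam₁ 1
    nlinarith
  have hεl : ε ≤ lam / 100 := by nlinarith
  -- the linear part is invertible
  have hinj : Function.Injective (A : E →ₗ[ℝ] E) := by
    rw [← LinearMap.ker_eq_bot, LinearMap.ker_eq_bot']
    intro v hv
    have h1 := hform.coercive (R₁ v)
    have hv' : A v = 0 := hv
    rw [hA₀a, R₁.symm_apply_apply, hv', map_zero, inner_zero_right] at h1
    have h2 : ‖R₁ v‖ ^ 2 = 0 := le_antisymm (by nlinarith [sq_nonneg ‖R₁ v‖]) (sq_nonneg _)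
    simpa using h2
  set D : E ≃L[ℝ] E := (LinearEquiv.ofInjectiveEndo (A : E →ₗ[ℝ] E) hinj).toContinuousLinearEquiv
    with hD
  have hDA : ∀ v, D v = A v := fun v => rfl
  set μ := ‖(D.symm : E →L[ℝ] E)‖ + 1 with hμ
  have hμ0 : 0 < μ := by positivity
  have hDμ : ∀ v, ‖D.symm v‖ ≤ μ * ‖v‖ := fun v =>
    (D.symm : E →L[ℝ] E).le_of_opNorm_le (by linarith) v
  -- rescaling
  set s₁ := ‖(R₁ : E →L[ℝ] F)‖ + 1 with hs₁
  set t₁ := ‖(R₁.symm : F →L[ℝ] E)‖ + 1 with ht₁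
  have hs₁0 : 0 < s₁ := by positivity
  have ht₁0 : 0 < t₁ := by positivity
  -- Chosen so that s = 1/(10C), which makes 10‖ζ x‖ at most dist x p.
  set γ := 1 / (20 * s₁ * C) with hγ
  have hγ0 : 0 < γ := by positivity
  set s := 2 * (γ * s₁) with hs
  set t := 2 * (γ⁻¹ * t₁) with ht
  have hs0 : 0 < s := by positivity
  have ht0 : 0 < t := by positivity
  have hsC : 10 * s * C ≤ 1 := by
    rw [hs, hγ]; apply le_of_eq; field_simp; norm_num
  set m := max 10 (C * t) with hm
  obtain ⟨δ₁, hδ₁, hadapt⟩ := hform.exists_adapted_equiv hlam0 hε0 (by linarith) (by linarith) hγ0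
  -- Three requirements on the error of the derivative: existence and uniqueness of the zero,
  -- applicability of the block diagonal form, and closeness to the linear saddle after conjugation.
  set e := min (min (1 / (2 * μ)) δ₁) (ε / (4 * s * t)) with he
  have he0 : 0 < e := by positivity
  have heμ : e * μ ≤ 1 / 2 := by
    have : e ≤ 1 / (2 * μ) := (min_le_left _ _).trans (min_le_left _ _)
    calc e * μ ≤ 1 / (2 * μ) * μ := by gcongr
      _ = 1 / 2 := by field_simp
  have heδ : e ≤ δ₁ := (min_le_left _ _).trans (min_le_right _ _)
  have hste : s * t * e ≤ ε / 4 := by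
    have : e ≤ ε / (4 * s * t) := min_le_right _ _
    calc s * t * e ≤ s * t * (ε / (4 * s * t)) := by gcongr
      _ = ε / 4 := by field_simp
  -- the chart ball
  have hXd : ContinuousAt (fderiv ℝ (localRep X σ)) (χ σ) :=
    (((contDiffOn_localRep X σ).contDiffAt (extChartAt_target_mem_nhds σ)).fderiv_right (m := 0)
      (by decide)).continuousAt
  have hev : ∀ᶠ z in 𝓝 (χ σ), z ∈ χ.target ∧ χ.symm z ∈ N ∧
      ‖fderiv ℝ (localRep X σ) z - A‖ < e / 2 := by
    have h1 : ∀ᶠ z in 𝓝 (χ σ), z ∈ χ.target := extChartAt_target_mem_nhds σ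
    have h2 : ∀ᶠ z in 𝓝 (χ σ), χ.symm z ∈ N :=
      (continuousAt_extChartAt_symm (I := 𝓘(ℝ, E)) σ).eventually_mem (by
        rw [extChartAt_to_inv]; exact hN)
    have h3 : ∀ᶠ z in 𝓝 (χ σ), dist (fderiv ℝ (localRep X σ) z) A < e / 2 :=
      hXd.eventually (Metric.ball_mem_nhds _ (half_pos he0))
    filter_upwards [h1, h2, h3] with z h1 h2 h3
    exact ⟨h1, h2, by rwa [← dist_eq_norm]⟩
  obtain ⟨a₁, ha₁, hball₁⟩ := Metric.nhds_basis_closedBall.mem_iff.1 hev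
  set a := min a₁ ρe with ha
  have ha0 : 0 < a := by positivity
  have hball : ∀ z ∈ Metric.closedBall (χ σ) a, z ∈ χ.target ∧ χ.symm z ∈ N ∧
      ‖fderiv ℝ (localRep X σ) z - A‖ < e / 2 := fun z hz =>
    hball₁ (Metric.closedBall_subset_closedBall (min_le_left _ _) hz)
  have hSN : ∀ x ∈ χ.source, χ x ∈ Metric.closedBall (χ σ) a → x ∈ N := fun x hx hxa => by
    have := (hball _ hxa).2.1
    rwa [χ.left_inv hx] at this
  set S : Set M := {x | x ∈ χ.source ∧ χ x ∈ Metric.closedBall (χ σ) a} with hS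
  have hSσ : S ∈ 𝓝 σ := by
    refine inter_mem (extChartAt_source_mem_nhds σ) ?_
    exact (continuousAt_extChartAt (I := 𝓘(ℝ, E)) σ).preimage_mem_nhds
      (Metric.closedBall_mem_nhds _ ha0)
  obtain ⟨r₁, hr₁, hr₁S⟩ := Metric.nhds_basis_closedBall.mem_iff.1 hSσ
  -- Zeros within b of σ in the chart are within r₁/2 of it in M, leaving room for closed balls of
  -- radius r₀ ≤ r₁/2 around them.
  set b := min (a / 2) (r₁ / (2 * C)) with hb
  have hb0 : 0 < b := by positivity
  have hba : b ≤ a / 2 := min_le_left _ _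
  have hbr : C * b ≤ r₁ / 2 := by
    calc C * b ≤ C * (r₁ / (2 * C)) := by gcongr; exact min_le_right _ _
      _ = r₁ / 2 := by field_simp
  -- The variation of the derivative of X uses the other half of `e`; the bound b/(2μ) on the value
  -- at σ places the zero of Y within b.
  set e' := min (e / 2) (b / (2 * μ)) with he'
  have he'0 : 0 < e' := by positivity
  have hσs : σ ∈ χ.source := mem_extChartAt_source σ
  have hat : Metric.closedBall (χ σ) a ⊆ χ.target := fun z hz => (hball z hz).1
  set U : Set (C1VectorField E M) := {Y | ∀ z ∈ Metric.closedBall (χ σ) a,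
    ‖localRep Y σ z - localRep X σ z‖ < e' ∧
      ‖fderiv ℝ (localRep Y σ) z - fderiv ℝ (localRep X σ) z‖ < e'} with hU
  have hUX : U ∈ 𝓝 X := eventually_localRep_close X (isCompact_closedBall (χ σ) a) hat he'0
  have hXU : X ∈ U := mem_of_mem_nhds hUX
  have hderiv : ∀ Y ∈ U, ∀ z ∈ Metric.closedBall (χ σ) a, ‖fderiv ℝ (localRep Y σ) z - A‖ ≤ e := by
    intro Y hY z hz
    have h1 := (hY z hz).2
    have h2 := (hball z hz).2.2
    have h3 : e' ≤ e / 2 := min_le_left _ _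
    have h4 := norm_add_le (fderiv ℝ (localRep Y σ) z - fderiv ℝ (localRep X σ) z)
      (fderiv ℝ (localRep X σ) z - A)
    rw [sub_add_sub_cancel] at h4
    linarith
  have hlip : ∀ Y ∈ U, ∀ x ∈ Metric.closedBall (χ σ) a, ∀ y ∈ Metric.closedBall (χ σ) a,
      ‖localRep Y σ x - localRep Y σ y - A (x - y)‖ ≤ e * ‖x - y‖ := fun Y hY x hx y hy =>
    norm_sub_sub_le_of_fderiv (fun z hz => ((contDiffOn_localRep Y σ).contDiffAt
      ((isOpen_extChartAt_target σ).mem_nhds (hat hz))).differentiableAt one_ne_zero)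
      (hderiv Y hY) hx hy
  have hsep : ∀ Y ∈ U, ∀ x ∈ Metric.closedBall (χ σ) a, ∀ y ∈ Metric.closedBall (χ σ) a,
      ‖x - y‖ ≤ 2 * μ * ‖localRep Y σ x - localRep Y σ y‖ := fun Y hY x hx y hy =>
    norm_sub_le_of_approx hDμ hμ0.le heμ (hlip Y hY x hx y hy)
  have hz₀ : localRep X σ (χ σ) = 0 := (localRep_eq_zero_iff X hσs).2 hσ
  have hzero : ∀ Y : C1VectorField E M, ∃ x, Y ∈ U →
      x ∈ S ∧ ‖χ x - χ σ‖ ≤ b ∧ Y x = 0 := by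
    intro Y
    by_cases hY : Y ∈ U
    · have hval : μ * ‖localRep Y σ (χ σ)‖ ≤ b / 2 := by
        have h1 := (hY (χ σ) (Metric.mem_closedBall_self ha0.le)).1
        rw [hz₀, sub_zero] at h1
        have h2 : ‖localRep Y σ (χ σ)‖ ≤ b / (2 * μ) := h1.le.trans (min_le_right _ _)
        calc μ * ‖localRep Y σ (χ σ)‖ ≤ μ * (b / (2 * μ)) := by gcongr
          _ = b / 2 := by field_simp
      obtain ⟨z, hz, hz0⟩ := exists_zero_of_approx hDμ hμ0.le he0.le heμ hb0.le
        (by linarith : b ≤ a) (hlip Y hY) hval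
      have hza : z ∈ Metric.closedBall (χ σ) a :=
        Metric.closedBall_subset_closedBall (by linarith) hz
      have hzt := hat hza
      refine ⟨χ.symm z, fun _ => ⟨⟨χ.map_target hzt, ?_⟩, ?_, ?_⟩⟩
      · rwa [χ.right_inv hzt]
      · rw [χ.right_inv hzt, ← mem_closedBall_iff_norm]; exact hz
      · rw [← localRep_eq_zero_iff Y (χ.map_target hzt), χ.right_inv hzt]; exact hz0
    · exact ⟨σ, fun h => absurd h hY⟩
  choose c hc using hzero
  have huniq : ∀ Y ∈ U, ∀ q ∈ S, Y q = 0 → q = c Y := by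
    intro Y hY q hq hq0
    obtain ⟨h1, -, h2⟩ := hc Y hY
    have h3 := hsep Y hY _ hq.2 _ h1.2
    rw [(localRep_eq_zero_iff Y hq.1).2 hq0, (localRep_eq_zero_iff Y h1.1).2 h2, sub_zero,
      norm_zero, mul_zero] at h3
    exact χ.injOn hq.1 h1.1 (sub_eq_zero.1 (norm_le_zero_iff.1 h3))
  have hσS : σ ∈ S := mem_of_mem_nhds hSσ
  -- the exponential map
  set η := min η₀ (ε / (2 * s * t * (K + 1))) with hη
  have hη0 : 0 < η := by positivity
  have hKη : s * t * (K * η) ≤ ε / 2 := by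
    have h1 : η ≤ ε / (2 * s * t * (K + 1)) := min_le_right _ _
    calc s * t * (K * η) ≤ s * t * ((K + 1) * (ε / (2 * s * t * (K + 1)))) := by
          gcongr; linarith
      _ = ε / 2 := by field_simp
  set ρ := min (1 / 2) (min (η / t / 2) (a / (2 * t))) with hρ
  have hρ0 : 0 < ρ := by positivity
  have hρη : 2 * ρ ≤ η / t := by
    have : ρ ≤ η / t / 2 := (min_le_right _ _).trans (min_le_left _ _)
    linarith
  have hρa : 2 * t * ρ ≤ a := by
    have : ρ ≤ a / (2 * t) := (min_le_right _ _).trans (min_le_right _ _)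
    calc 2 * t * ρ ≤ 2 * t * (a / (2 * t)) := by gcongr
      _ = a := by field_simp
  set r₀ := min (r₁ / 2) (5 * ρ) with hr₀
  have hr₀0 : 0 < r₀ := by positivity
  have hr₀S : ∀ Y ∈ U, Metric.closedBall (c Y) r₀ ⊆ S := by
    intro Y hY
    refine Subset.trans (fun x hx => ?_) hr₁S
    obtain ⟨h1, h2, -⟩ := hc Y hY
    have h3 := (hdist (c Y) (hSN _ h1.1 h1.2) σ (mem_of_mem_nhds hN)).1
    rw [Metric.mem_closedBall] at hx ⊢
    have h4 : C * ‖χ (c Y) - χ σ‖ ≤ C * b := by gcongr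
    have h5 : r₀ ≤ r₁ / 2 := min_le_left _ _
    linarith [dist_triangle x (c Y) σ]
  refine ⟨r₀, lam, Λ, ε, ρ, m, A₀, hr₀0, U, hUX, S, hSσ, c,
    (huniq X hXU σ hσS hσ).symm, ?_, fun Y hY => ⟨hr₀S Y hY, fun q hq =>
      ⟨huniq Y hY q hq, fun h => by rw [h]; exact (hc Y hY).2.2⟩, ?_⟩⟩
  -- Continuity of the zero: `hsep` bounds the distance between the zeros of Y and Y' by the size of
  -- Y at the zero of Y', which is that of Y - Y' there.
  · intro Y hY
    rw [Metric.continuousWithinAt_iff']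
    intro θ hθ
    have hclose := eventually_localRep_close Y (isCompact_closedBall (χ σ) a) hat
      (ε := θ / (2 * μ * C)) (by positivity)
    filter_upwards [hclose.filter_mono nhdsWithin_le_nhds, self_mem_nhdsWithin] with Y' hY' hYU'
    obtain ⟨h1, -, h2⟩ := hc Y hY
    obtain ⟨h1', -, h2'⟩ := hc Y' hYU'
    have h3 := (hdist _ (hSN _ h1'.1 h1'.2) _ (hSN _ h1.1 h1.2)).1
    have h4 := hsep Y hY _ h1'.2 _ h1.2
    have h5 := (hY' _ h1'.2).1
    rw [(localRep_eq_zero_iff Y' h1'.1).2 h2', zero_sub, norm_neg] at h5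
    rw [(localRep_eq_zero_iff Y h1.1).2 h2, sub_zero] at h4
    calc dist (c Y') (c Y) ≤ C * (2 * μ * ‖localRep Y σ (χ (c Y'))‖) := h3.trans (by gcongr)
      _ < C * (2 * μ * (θ / (2 * μ * C))) := by gcongr
      _ = θ := by field_simp
  · obtain ⟨hcS, hcb, hc0⟩ := hc Y hY
    set p := c Y with hp
    obtain ⟨W, hW0, -, hWlip, hWexp⟩ := hexp η hη0 (min_le_left _ _) p hcS.1 (by
      rw [mem_closedBall_iff_norm]
      have : a ≤ ρe := min_le_right _ _
      linarith)
    set B := fderiv ℝ (localRep Y σ) (χ p) with hB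
    have hBA : ‖B - A‖ ≤ e := hderiv Y hY _ hcS.2
    obtain ⟨L, hLn, hLn', hLA, hblk⟩ := hadapt B (hBA.trans heδ)
    obtain ⟨ζ, R, B', Z, k, h⟩ := exists_saddleModel (Y := Y) (p := p) (σ := σ) (m := m)
      (r₀ := r₀) (a := a) (C := C)
      hform hlam0 (min_le_right _ _) hΛ1 (by linarith : ‖A₀‖ ≤ Λ) hε0 hεΛ.le hρ0 (min_le_left _ _)
      hst hun hLn hLn' hs0 ht0 hC hsC (le_max_left _ _) (le_max_right _ _) hat
      (fun x hx y hy hxa hya => hdist x (hSN x hx hxa) y (hSN y hy hya))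
      (fun x hx hxa => hnorm x (hSN x hx hxa)) hcS.1 (hcb.trans hba) hc0 (hlip Y hY) hLA
      (by linarith) hblk hW0 hWlip hWexp hKη (mul_div_cancel₀ η ht0.ne').le hρη hρa (hr₀S Y hY)
      (by have : r₀ ≤ 5 * ρ := min_le_right _ _
          linarith)
    exact ⟨ζ, R, B', Z, k, h⟩

end Uniform

end SingularFlow

/-! ### Choice of the constants and conclusion. -/

namespace SingularFlow

theorem exists_layer_threshold {m Λ ρ r : ℝ} (hρ : 0 < ρ) (hr : 0 < r) :
    ∃ N : ℕ, 2 * m * Real.exp (-((N : ℝ) / 2)) ≤ r ∧ 8 * Λ ≤ N ∧ 3 * Real.exp (-(N : ℝ)) ≤ ρ := by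
  have hcast := tendsto_natCast_atTop_atTop (R := ℝ)
  have h1 : Tendsto (fun N : ℕ => 2 * m * Real.exp (-((N : ℝ) / 2))) atTop (𝓝 (2 * m * 0)) :=
    (Real.tendsto_exp_neg_atTop_nhds_zero.comp
      (hcast.atTop_div_const (by norm_num))).const_mul _
  have h2 : Tendsto (fun N : ℕ => 3 * Real.exp (-(N : ℝ))) atTop (𝓝 (3 * 0)) :=
    (Real.tendsto_exp_neg_atTop_nhds_zero.comp hcast).const_mul _
  rw [mul_zero] at h1 h2
  exact ((h1.eventually_le_const hr).and ((hcast.eventually_ge_atTop _).and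
    (h2.eventually_le_const hρ))).exists

end SingularFlow

theorem theoremA
    {E : Type*} [NormedAddCommGroup E] [NormedSpace ℝ E] [FiniteDimensional ℝ E]
    {M : Type*} [MetricSpace M] [ChartedSpace E M] [IsManifold 𝓘(ℝ, E) ∞ M]
    [RiemannianBundle (fun x : M => TangentSpace 𝓘(ℝ, E) x)]
    [IsContMDiffRiemannianBundle 𝓘(ℝ, E) ∞ E (fun x : M => TangentSpace 𝓘(ℝ, E) x)]
    [IsRiemannianManifold 𝓘(ℝ, E) M]
    [MeasurableSpace M] [BorelSpace M]
    (X : SingularFlow.C1VectorField E M) (σ : M)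
    (hσ : SingularFlow.IsSaddleSingularity X σ) :
    ∃ (r₀ κ L₀ L₁ K₀ K₁ H₁ : ℝ) (n₀ : ℝ → ℕ),
      0 < r₀ ∧ 0 < κ ∧ 0 < L₀ ∧ L₀ < L₁ ∧ 0 < K₀ ∧ K₀ < K₁ ∧ 0 < H₁ ∧
      ∃ U ∈ 𝓝 X, ∃ V ∈ 𝓝 σ, ∃ c : SingularFlow.C1VectorField E M → M,
        c X = σ ∧ ContinuousOn c U ∧
        ∀ Y ∈ U,
          SingularFlow.IsSaddleSingularity Y (c Y) ∧
          Metric.closedBall (c Y) r₀ ⊆ V ∧ (∀ q ∈ V, Y q = 0 ↔ q = c Y) ∧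
          ∃ Q : LinearMap.BilinForm ℝ E,
            SingularFlow.IsSplittingInner (SingularFlow.linearization Y (c Y)) Q ∧
            ∀ r : ℝ, 0 < r → r ≤ r₀ →
              SingularFlow.CrossSectionProps Y (c Y) Q r (n₀ r) L₀ L₁ ∧
              ∀ φ : Flow ℝ M, SingularFlow.IsFlowOf φ Y →
                SingularFlow.CoarsePartitionProps Y φ (c Y) Q r (n₀ r) κ K₀ K₁ H₁ := by
  have : CompleteSpace E := FiniteDimensional.complete ℝ E
  obtain ⟨R₁, J, lam₁, hlam₁, hform₁, hst, hun⟩ := SingularFlow.exists_saddleForm hσ.2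
  obtain ⟨r₀, lam, Λ, ε, ρ, m, A₀, hr₀, U, hU, V, hV, c, hcX, hc, hmodel⟩ :=
    SingularFlow.exists_uniform_saddleModel X σ hσ.1 hlam₁ hform₁ hst hun
  -- The constants are common to all models; the one of X is opened only to read off their signs and
  -- inequalities.
  obtain ⟨_, _, _, _, _, _, _, h⟩ := hmodel X (mem_of_mem_nhds hU)
  have hlam := h.lam_pos
  have hlam1 := h.lam_le_one
  have hΛ := h.one_le
  have hm := h.le_m
  have hρ := h.rho_pos
  -- The threshold depends on r only, not on Y; its value for r ≤ 0 is arbitrary.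
  have hthr : ∀ r : ℝ, ∃ N : ℕ, 0 < r → 2 * m * Real.exp (-((N : ℝ) / 2)) ≤ r ∧ 8 * Λ ≤ N ∧
      3 * Real.exp (-(N : ℝ)) ≤ ρ := fun r => by
    by_cases hr : 0 < r
    · obtain ⟨N, hN⟩ := SingularFlow.exists_layer_threshold (m := m) (Λ := Λ) hρ hr
      exact ⟨N, fun _ => hN⟩
    · exact ⟨0, fun h => absurd h hr⟩
  choose n₀ hn₀ using hthr
  refine ⟨r₀, max (Real.exp (2 * Λ + 1)) (2 * m * Real.exp (2 * Λ)), lam / (2 * m), 3 * m * Λ,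
    1 / (4 * Λ), 4 / lam, 2 / (1 / (4 * Λ)) + 3, n₀, hr₀, by positivity, by positivity, ?_,
    by positivity, ?_, by positivity, U, hU, V, hV, c, hcX, hc, fun Y hY => ?_⟩
  · rw [div_lt_iff₀ (by positivity)]
    have h1 : 1 ≤ m * m := by nlinarith
    have h2 : 1 ≤ m * m * Λ := by nlinarith
    nlinarith
  · rw [div_lt_div_iff₀ (by positivity) hlam]
    nlinarith
  · obtain ⟨h1, h2, ζ, R, B, Z, k, h⟩ := hmodel Y hY
    refine ⟨h.isSaddleSingularity, h1, h2, SingularFlow.pullbackInner R, h.isSplittingInner,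
      fun r hr hr₀' => ?_⟩
    obtain ⟨h3, h4, h5⟩ := hn₀ r hr
    exact ⟨h.crossSectionProps hr hr₀' h3 h4 h5, fun φ hφ =>
      h.coarsePartitionProps hr hr₀' h3 h4 h5 hφ (le_max_left _ _) (le_max_right _ _)⟩
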